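/- **Setting.** Let $U=[0,1]^3$ with periodic boundary conditions (the torus $\mathbb R^3/\mathbb Z^3$), and let $f_0$ be a probability density on $U\times\mathbb R^3$ and $g_0$ a probability density on $\mathbb R^3$ with $\int f_0(x,v)(1+|v|^2)\,dx\,dv<\infty$, $\int g_0(v)(1+|v|^2)\,dv<\infty$ and $\operatorname{ess\,sup}_v g_0(v)(1+|v|^{3+\eta})<\infty$ for some $\eta>0$. Let $0<T<\infty$. Throughout $\varepsilon>0$ and $N\in\mathbb N$ are related by $N\varepsilon^2=1$. **Collision trees.** $\mathcal{MT}$ is the set of all $\Phi=((x_0,v_0),(t_1,\nu_1,v_1),\dots,(t_n,\nu_n,v_n))$ with $n\ge 0$, $(x_0,v_0)\in U\times\mathbb R^3$, $0<t_1<\dots<t_n\le T$, $\nu_i\in\mathbb S^2$, $v_i\in\mathbb R^3$, with its Lebesgue measure $\lambda$ (surface measure in the $\nu_i$). The root of $\Phi$ starts at $(x_0,v_0)$ and moves freely, except that at time $t_i$ its velocity changes from $v(t_i^-)$ to $v(t_i)=v(t_i^-)-\big(\nu_i\cdot(v(t_i^-)-v_i)\big)\nu_i$; its position is denoted $x(s)$.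 **Idealized distribution.** With $\Lambda(v)=\int_{\mathbb S^2}\int_{\mathbb R^3}g_0(\bar v)[(v-\bar v)\cdot\nu]_+\,d\bar v\,d\nu$, $P_t$ is the measure on $\mathcal{MT}$ whose density with respect to $\lambda$, also denoted $P_t$, is given by $P_t(\Phi)=e^{-t\Lambda(v_0)}f_0(x_0,v_0)$ if $n=0$, and, if $n\ge1$, $$P_t(\Phi)=\mathbf 1_{t\ge\tau}\,e^{-(t-\tau)\Lambda(v(\tau))}\,P_\tau(\bar\Phi)\,g_0(v')\,[(v(\tau^-)-v')\cdot\nu]_+,$$ where $(\tau,\nu,v')=(t_n,\nu_n,v_n)$ and $\bar\Phi$ is $\Phi$ with this last marker removed. **Empirical distribution.** A tagged particle with initial law $f_0(x,v)\,dx\,dv$ and $N$ background particles with initial law $dx\otimes g_0(v)\,dv$ on $U\times\mathbb R^3$ are chosen independently. Background particles move freely for all times. The tagged particle moves freely while its centre is at distance $>\varepsilon$ (on the torus) from the centres of all background particles; when its distance to a background particle with velocity $w$ becomes $\varepsilon$, and $\nu$ is the unit vector from the tagged to the background particle, its velocity $v$ jumps to $v-(\nu\cdot(v-w))\nu$ and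 the collision $(\text{time},\nu,w)$ is recorded. For $t\in[0,T]$ and measurable $S\subset\mathcal{MT}$, $\hat P^\varepsilon_t(S)$ is the probability that there is no initial overlap, the dynamics is well defined up to time $t$ (finitely many collisions, no two of them simultaneous, and contact between the tagged and a background particle only at recorded collision times), and the tree formed by the initial phase point of the tagged particle and its collisions during $(0,t]$ belongs to $S$. **Theorem.** Uniformly for $t\in[0,T]$, $$\lim_{\varepsilon\to0}\|P_t-\hat P^\varepsilon_t\|_{TV}=0,\qquad \|\mu-\mu'\|_{TV}=\sup_{S}|\mu(S)-\mu'(S)| ,$$ the supremum being over measurable $S\subset\mathcal{MT}$. That is, for every $\delta>0$ there is $\varepsilon_0>0$ such that $\|P_t-\hat P^\varepsilon_t\|_{TV}<\delta$ for all $t\in[0,T]$ and all $\varepsilon\in(0,\varepsilon_0)$, $N\in\mathbb N$ with $N\varepsilon^2=1$. -/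

import Mathlib

open MeasureTheory Set
open scoped ENNReal

noncomputable section

namespace RayleighGas

/-- Three-dimensional Euclidean space. -/
abbrev E3 : Type := EuclideanSpace ℝ (Fin 3)

/-- The unit sphere of `E3`; it carries the surface measure `(volume : Measure E3).toSphere`. -/
abbrev S2 : Type := Metric.sphere (0 : E3) 1

/-- The unit cube, a fundamental domain of the torus `U = ℝ³ / ℤ³`. Positions of particles are
followed in the covering space `ℝ³`, and every statement about the distance between two particles
is made for all lattice translates. -/
def unitCube : Set E3 := {x | ∀ i, x i ∈ Ico (0 : ℝ) 1}

/-- The integer lattice vector with coordinates `k`. -/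
def latticeVec (k : Fin 3 → ℤ) : E3 := WithLp.toLp 2 fun i => (k i : ℝ)

/-- Lebesgue measure on the one-particle phase space `U × ℝ³`. -/
def phaseVolume : Measure (E3 × E3) := (volume.restrict unitCube).prod volume

/-- Admissible initial data: `f₀` is a probability density on `U × ℝ³` and `g₀` a probability
density on `ℝ³`, both with finite second moments, and `g₀(v) (1 + |v|^(3+η))` is essentially
bounded for some `η > 0` (`η = 1` is the case of a bounded `g₀(v) (1 + |v|⁴)`). -/
structure Admissible (f₀ : E3 × E3 → ℝ) (g₀ : E3 → ℝ) : Prop where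
  f_integrable : Integrable f₀ phaseVolume
  f_nonneg : ∀ᵐ z ∂phaseVolume, 0 ≤ f₀ z
  f_mass : ∫ z, f₀ z ∂phaseVolume = 1
  g_integrable : Integrable g₀ volume
  g_nonneg : ∀ᵐ v, 0 ≤ g₀ v
  g_mass : ∫ v, g₀ v = 1
  f_moment : Integrable (fun z : E3 × E3 => f₀ z * (1 + ‖z.2‖ ^ 2)) phaseVolume
  g_moment : Integrable (fun v : E3 => g₀ v * (1 + ‖v‖ ^ 2)) volume
  g_bound : ∃ η : ℝ, 0 < η ∧ ∃ C : ℝ, ∀ᵐ v, g₀ v * (1 + ‖v‖ ^ (3 + η)) ≤ C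

/-! ### Collision trees -/

/-- The marker `(t, ν, v)` of a collision: its time, the collision parameter, and the velocity of
the background particle. -/
abbrev Marker : Type := ℝ × S2 × E3

/-- Phase point `(x₀, v₀)` of the root together with a list of `n` markers, for some `n`. -/
abbrev Tree : Type := Σ n : ℕ, (E3 × E3) × (Fin n → Marker)

/-- The collision trees up to time `T`: the root starts in `U`, and the collision times satisfy
`0 < t₁ < ⋯ < tₙ ≤ T`. -/
def collisionTrees (T : ℝ) : Set Tree :=
  {Φ | Φ.2.1.1 ∈ unitCube ∧ (∀ i, (Φ.2.2 i).1 ∈ Ioc 0 T) ∧ StrictMono fun i => (Φ.2.2 i).1}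

/-- Lebesgue measure on the collision trees up to time `T`. -/
def treeVolume (T : ℝ) : Measure Tree :=
  (Measure.sum fun n : ℕ =>
    ((volume : Measure (E3 × E3)).prod
      (Measure.pi fun _ : Fin n =>
        (volume : Measure ℝ).prod
          ((volume : Measure E3).toSphere.prod (volume : Measure E3)))).map
      (fun p => (⟨n, p⟩ : Tree))).restrict (collisionTrees T)

/-- Velocity after a collision with parameter `ν` and a background particle of velocity `w`. -/
def collide (v : E3) (ν : S2) (w : E3) : E3 := v - inner ℝ (ν : E3) (v - w) • (ν : E3)

/-- Velocity of the root after all of its `n` collisions. -/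
def finalVel (v₀ : E3) : (n : ℕ) → (Fin n → Marker) → E3
  | 0, _ => v₀
  | n + 1, m =>
      collide (finalVel v₀ n (Fin.init m)) (m (Fin.last n)).2.1 (m (Fin.last n)).2.2

/-- Position of the root at time `s` in the covering space `ℝ³`, given its `n` collisions in
chronological order. -/
def rootPos (z : E3 × E3) : (n : ℕ) → (Fin n → Marker) → ℝ → E3
  | 0, _, s => z.1 + s • z.2
  | n + 1, m, s =>
      if s ≤ (m (Fin.last n)).1 then rootPos z n (Fin.init m) s
      else rootPos z n (Fin.init m) (m (Fin.last n)).1 +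
        (s - (m (Fin.last n)).1) • finalVel z.2 (n + 1) m

/-! ### The idealized distribution -/

/-- The collision rate `∫_{S²} ∫_{ℝ³} g₀(w) [(v - w) · ν]₊ dw dν` of the root at velocity `v`. -/
def collisionRate (g₀ : E3 → ℝ) (v : E3) : ℝ :=
  ∫ ν : S2, (∫ w : E3, g₀ w * max (inner ℝ (v - w) (ν : E3)) 0) ∂(volume : Measure E3).toSphere

/-- The density `P_t(Φ)` of the idealized distribution, by recursion on the number of collisions.
With `(τ, ν, v')` the last marker of `Φ` and `Φ̄` the tree without it,
`P_t(Φ) = 1_{t ≥ τ} exp(-(t - τ) rate(v(τ))) P_τ(Φ̄) g₀(v') [(v(τ⁻) - v') · ν]₊`. -/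
def idealDensity (f₀ : E3 × E3 → ℝ) (g₀ : E3 → ℝ) (z : E3 × E3) :
    (n : ℕ) → (Fin n → Marker) → ℝ → ℝ
  | 0, _, t => Real.exp (-t * collisionRate g₀ z.2) * f₀ z
  | n + 1, m, t =>
      if (m (Fin.last n)).1 ≤ t then
        Real.exp (-(t - (m (Fin.last n)).1) * collisionRate g₀ (finalVel z.2 (n + 1) m)) *
          idealDensity f₀ g₀ z n (Fin.init m) (m (Fin.last n)).1 *
          g₀ (m (Fin.last n)).2.2 *
          max (inner ℝ (finalVel z.2 n (Fin.init m) - (m (Fin.last n)).2.2)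
            ((m (Fin.last n)).2.1 : E3)) 0
      else 0

/-- The idealized distribution `P_t` on collision trees up to time `T`. -/
def idealLaw (f₀ : E3 × E3 → ℝ) (g₀ : E3 → ℝ) (T t : ℝ) : Measure Tree :=
  (treeVolume T).withDensity fun Φ =>
    ENNReal.ofReal (idealDensity f₀ g₀ Φ.2.1 Φ.1 Φ.2.2 t)

/-! ### The particle dynamics and the empirical distribution -/

/-- Initial phase points of the tagged particle and of the `N` background particles. -/
abbrev Config (N : ℕ) : Type := (E3 × E3) × (Fin N → E3 × E3)

/-- Law of the initial configuration: the particles are independent, the tagged one has density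
`f₀` on `U × ℝ³`, and each background particle has law `Unif(U) ⊗ g₀`. -/
def configLaw (f₀ : E3 × E3 → ℝ) (g₀ : E3 → ℝ) (N : ℕ) : Measure (Config N) :=
  (phaseVolume.withDensity fun z => ENNReal.ofReal (f₀ z)).prod
    (Measure.pi fun _ : Fin N =>
      (volume.restrict unitCube).prod (volume.withDensity fun v => ENNReal.ofReal (g₀ v)))

/-- `Φ` is the collision tree up to time `t` of the particle dynamics at diameter `ε` started from
the configuration `ω`: there is a labelling `ι` of the collisions of `Φ` by background particles
such that

* the root of `Φ` starts at the phase point of the tagged particle, and the collision times satisfy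
  `0 < t₁ < ⋯ < tₙ ≤ t`;
* at the time of collision `i` the particle `ι i`, moving freely, is at distance `ε` from the
  tagged one in the direction `νᵢ` (from the tagged to the background particle);
* at no time in `[0, t]` is any other translate of a background particle at distance `≤ ε`.

In particular there is no overlap at time `0`, and no two collisions are simultaneous. -/
def IsCollisionTree {N : ℕ} (ε t : ℝ) (ω : Config N) (Φ : Tree) : Prop :=
  Φ.2.1 = ω.1 ∧ (∀ i, (Φ.2.2 i).1 ∈ Ioc 0 t) ∧ (StrictMono fun i => (Φ.2.2 i).1) ∧
  ∃ ι : Fin Φ.1 → Fin N,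
    (∀ i, (Φ.2.2 i).2.2 = (ω.2 (ι i)).2 ∧
      ∃ k, rootPos Φ.2.1 Φ.1 Φ.2.2 (Φ.2.2 i).1 + ε • ((Φ.2.2 i).2.1 : E3) =
        (ω.2 (ι i)).1 + (Φ.2.2 i).1 • (ω.2 (ι i)).2 + latticeVec k) ∧
    ∀ s ∈ Icc 0 t, ∀ j k,
      ‖rootPos Φ.2.1 Φ.1 Φ.2.2 s - ((ω.2 j).1 + s • (ω.2 j).2 + latticeVec k)‖ ≤ ε →
      ∃ i, (Φ.2.2 i).1 = s ∧ ι i = j ∧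
        rootPos Φ.2.1 Φ.1 Φ.2.2 s + ε • ((Φ.2.2 i).2.1 : E3) =
          (ω.2 j).1 + s • (ω.2 j).2 + latticeVec k

/-- The position at time `s` depends only on the collisions before time `s`. -/
theorem rootPos_prefix (z : E3 × E3) (k : ℕ) (s : ℝ) :
    ∀ (n : ℕ) (m : Fin n → Marker) (h : k ≤ n), (∀ i : Fin n, k ≤ i → s ≤ (m i).1) →
      rootPos z n m s = rootPos z k (fun i => m (Fin.castLE h i)) s := by
  intro n
  induction n with
  | zero =>
    intro m h _
    obtain rfl : k = 0 := by omega
    rfl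
  | succ n ih =>
    intro m h hs
    rcases Nat.lt_or_ge n k with hk | hk
    · obtain rfl : k = n + 1 := by omega
      rfl
    · have h1 : s ≤ (m (Fin.last n)).1 := hs _ (by simpa using hk)
      rw [rootPos, if_pos h1, ih (Fin.init m) hk fun i hi => hs i.castSucc hi]
      rfl

theorem IsCollisionTree.step {N : ℕ} {ε t : ℝ} (hε : 0 < ε) {ω : Config N} {Φ Ψ : Tree}
    (hΦ : IsCollisionTree ε t ω Φ) (hΨ : IsCollisionTree ε t ω Ψ) (k : ℕ) (hk : k < Φ.1)
    (hk' : k ≤ Ψ.1)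
    (hag : ∀ i (h : i < Φ.1) (h' : i < Ψ.1), i < k → Φ.2.2 ⟨i, h⟩ = Ψ.2.2 ⟨i, h'⟩)
    (hle : ∀ h' : k < Ψ.1, (Φ.2.2 ⟨k, hk⟩).1 ≤ (Ψ.2.2 ⟨k, h'⟩).1) :
    ∃ h' : k < Ψ.1, Φ.2.2 ⟨k, hk⟩ = Ψ.2.2 ⟨k, h'⟩ := by
  obtain ⟨hz, hI, hmono, ι, hc, -⟩ := hΦ
  obtain ⟨hz', -, hmono', ι', hc', hex'⟩ := hΨ
  obtain ⟨hv, l, hl⟩ := hc ⟨k, hk⟩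
  have hpos : rootPos Φ.2.1 Φ.1 Φ.2.2 (Φ.2.2 ⟨k, hk⟩).1 =
      rootPos Ψ.2.1 Ψ.1 Ψ.2.2 (Φ.2.2 ⟨k, hk⟩).1 := by
    rw [rootPos_prefix _ k _ Φ.1 Φ.2.2 hk.le fun i hi => hmono.monotone (by exact hi),
      rootPos_prefix _ k _ Ψ.1 Ψ.2.2 hk' fun i hi =>
        (hle (lt_of_le_of_lt hi i.2)).trans (hmono'.monotone (by exact hi)), hz, hz']
    congr 1
    funext i
    exact hag i _ _ i.2
  rw [hpos] at hl
  have hcontact := hex' _ ⟨(hI ⟨k, hk⟩).1.le, (hI ⟨k, hk⟩).2⟩ (ι ⟨k, hk⟩) l (by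
    rw [← hl, sub_add_cancel_left, norm_neg, norm_smul, Real.norm_of_nonneg hε.le]
    simp)
  obtain ⟨i, hit, hij, hν⟩ := hcontact
  have hνeq : (Φ.2.2 ⟨k, hk⟩).2.1 = (Ψ.2.2 i).2.1 := by
    have h1 := add_left_cancel (hl.trans hν.symm)
    exact Subtype.ext (smul_right_injective E3 hε.ne' h1)
  have hik : (i : ℕ) = k := by
    rcases lt_trichotomy (i : ℕ) k with h | h | h
    · have h1 := hag i (h.trans hk) i.2 h
      have h2 : (Φ.2.2 ⟨i, h.trans hk⟩).1 < (Φ.2.2 ⟨k, hk⟩).1 := hmono (by exact h)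
      rw [h1] at h2
      exact absurd hit h2.ne
    · exact h
    · have h0 : k < Ψ.1 := h.trans i.2
      have h2 : (Ψ.2.2 ⟨k, h0⟩).1 < (Ψ.2.2 i).1 := hmono' (by exact h)
      exact absurd (hle h0) (by rw [← hit]; exact not_le.mpr h2)
  subst hik
  exact ⟨i.2, Prod.ext hit.symm (Prod.ext hνeq (by rw [hv, (hc' i).1, hij]))⟩

/-- A configuration has at most one collision tree. -/
theorem IsCollisionTree.unique {N : ℕ} {ε t : ℝ} (hε : 0 < ε) {ω : Config N} {Φ Ψ : Tree}
    (hΦ : IsCollisionTree ε t ω Φ) (hΨ : IsCollisionTree ε t ω Ψ) : Φ = Ψ := by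
  have key : ∀ k : ℕ, (k ≤ Φ.1 ↔ k ≤ Ψ.1) ∧
      ∀ i (h : i < Φ.1) (h' : i < Ψ.1), i < k → Φ.2.2 ⟨i, h⟩ = Ψ.2.2 ⟨i, h'⟩ := by
    intro k
    induction k with
    | zero => simp
    | succ k ih =>
      obtain ⟨ih1, ih2⟩ := ih
      have ih3 : ∀ i (h : i < Ψ.1) (h' : i < Φ.1), i < k → Ψ.2.2 ⟨i, h⟩ = Φ.2.2 ⟨i, h'⟩ :=
        fun i h h' hi => (ih2 i h' h hi).symm
      by_cases h1 : k < Φ.1 <;> by_cases h2 : k < Ψ.1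
      · refine ⟨by omega, fun i h h' hi => ?_⟩
        rcases Nat.lt_succ_iff_lt_or_eq.mp hi with hi | rfl
        · exact ih2 i h h' hi
        · rcases le_total (Φ.2.2 ⟨i, h⟩).1 (Ψ.2.2 ⟨i, h'⟩).1 with hle | hle
          · exact (hΦ.step hε hΨ i h h'.le ih2 fun _ => hle).2
          · exact (hΨ.step hε hΦ i h' h.le ih3 fun _ => hle).2.symm
      · exact absurd (hΦ.step hε hΨ k h1 (ih1.1 h1.le) ih2 fun h => absurd h h2).1 h2
      · exact absurd (hΨ.step hε hΦ k h2 (ih1.2 h2.le) ih3 fun h => absurd h h1).1 h1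
      · exact ⟨by omega, fun i h h' hi => ih2 i h h' (by omega)⟩
  have hroot : Φ.2.1 = Ψ.2.1 := hΦ.1.trans hΨ.1.symm
  obtain ⟨n, z, m⟩ := Φ
  obtain ⟨n', z', m'⟩ := Ψ
  obtain rfl : n = n' := le_antisymm ((key n).1.1 le_rfl) ((key n').1.2 le_rfl)
  obtain rfl : z = z' := hroot
  have : m = m' := funext fun i => (key n).2 i i.2 i.2 i.2
  rw [this]

open Classical in
/-- The collision tree of a configuration (a default value where the dynamics has none). -/
def collisionTree {N : ℕ} (ε t : ℝ) (ω : Config N) : Tree :=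
  if h : ∃ Φ, IsCollisionTree ε t ω Φ then h.choose else ⟨0, ω.1, Fin.elim0⟩

/-- The empirical distribution `P̂_t^ε`: the law of the collision tree up to time `t`, on the event
that the dynamics is well defined up to time `t` from a configuration without initial overlap.
Its total mass at time `0` is the probability of no initial overlap. -/
def empiricalLaw (f₀ : E3 × E3 → ℝ) (g₀ : E3 → ℝ) (N : ℕ) (ε t : ℝ) : Measure Tree :=
  ((configLaw f₀ g₀ N).restrict {ω | ∃ Φ, IsCollisionTree ε t ω Φ}).map (collisionTree ε t)

/-- Total variation distance `sup_S |μ(S) - ν(S)|` over all measurable sets `S`. -/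
def tvDist {α : Type*} [MeasurableSpace α] (μ ν : Measure α) : ℝ≥0∞ :=
  ⨆ (S : Set α) (_ : MeasurableSet S), max (μ S - ν S) (ν S - μ S)

end RayleighGas

end

/-! The proof needs only a lower bound for the empirical law. The idealized law has total mass one
and the empirical law has mass at most one. So an estimate P_t(S) ≤ P̂_t(S) + o(1), uniform in S and
t, gives the opposite inequality when applied to the complement of S (`tvDist_le_missingMass`). No
evolution equation for the empirical law is required: it suffices to exhibit enough configurations
that realize a given tree.

Fix a tree with n collisions and n distinct labels, and put each labelled background particle at the
initial position from which it produces its collision. For fixed velocity w, the map from (time, ν)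
to this position has Jacobian ε²[(v - w)·ν]₊ (`lintegral_flux`), and it is injective as long as no
partner touches the root earlier. Inserting the partners one after another therefore realizes trees
with density at least ε^(2n) times the product of the collision densities
(`setLIntegral_insertPartners_le`), multiplied by the probability that the bath particles avoid a
tube around the path of the root. There are N(N-1)⋯(N-n+1) labellings, and Nε² = 1 makes their
number times ε^(2n) tend to one. The tube has bath measure close to ε² times the collision rate
integrated along the path (`bathLaw_tube_le`), so the avoidance probability is at least the
exponential survival factor of P_t, up to a small relative error.

The construction fails on trees in which a partner meets the root a second time at scale ε. Almost
every tree has no such recollision for point particles (`ae_goodTree`), because in each case the bad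
velocities lie in an affine subspace of dimension at most two. For a tree of positive weight without
point recollisions, compactness excludes recollisions at all small ε (`eventually_goodTree`).

The missing mass then tends to zero by dominated convergence. The majorant is the density at the
time of the last collision. It does not depend on t, which gives uniformity in t, and its total mass
is one plus the expected number of collisions up to time T. This is finite because the mean of 1 +
|v| grows at most linearly: a collision that raises the speed has flux and speed gain both
controlled by |w| (`flux_mul_norm_collide_le`). Finiteness also excludes infinitely many collisions
in finite time, which is why the idealized law has mass one. -/

noncomputable section

namespace RayleighGas

/-- The surface measure of the unit sphere. -/
abbrev sphereMeasure : Measure S2 := (volume : Measure E3).toSphere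

/-! ### Flux through a moving hemisphere and the volume it sweeps out -/

theorem lintegral_polar (h : E3 → ℝ≥0∞) (hh : Measurable h) :
    ∫⁻ x, h x = ∫⁻ ν : S2, ∫⁻ r in Ioi (0 : ℝ), ENNReal.ofReal (r ^ 2) * h (r • (ν : E3))
      ∂volume ∂sphereMeasure := by
  have h0 : ∫⁻ x, h x = ∫⁻ x : ({0}ᶜ : Set E3), h x ∂(Measure.comap Subtype.val volume) := by
    rw [lintegral_subtype_comap (measurableSet_singleton _).compl, restrict_compl_singleton]
  have hp := (volume : Measure E3).measurePreserving_homeomorphUnitSphereProd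
  have h1 : ∫⁻ x : ({0}ᶜ : Set E3), h x ∂(Measure.comap Subtype.val volume) =
      ∫⁻ p : S2 × Ioi (0 : ℝ), h ((p.2 : ℝ) • (p.1 : E3))
        ∂(sphereMeasure.prod (Measure.volumeIoiPow 2)) := by
    have h3 : Module.finrank ℝ E3 - 1 = 2 := by simp
    rw [h3] at hp
    rw [← hp.lintegral_comp (f := fun p : S2 × Ioi (0 : ℝ) => h ((p.2 : ℝ) • (p.1 : E3)))
      (by fun_prop)]
    refine lintegral_congr fun x => ?_
    congr 1
    simp
    rw [smul_smul, mul_inv_cancel₀ (norm_ne_zero_iff.2 x.2), one_smul]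
  rw [h0, h1, lintegral_prod _ (by fun_prop)]
  refine lintegral_congr fun ν => ?_
  rw [Measure.volumeIoiPow, lintegral_withDensity_eq_lintegral_mul _ (by fun_prop) (by fun_prop)]
  simp only [Pi.mul_apply]
  exact lintegral_subtype_comap measurableSet_Ioi
    (fun r : ℝ => ENNReal.ofReal (r ^ 2) * h (r • (ν : E3)))

/-- One-dimensional substitution by the distance to a moving point. -/
theorem lintegral_approach (u y : E3) (hu : u ≠ 0) (φ : ℝ → ℝ≥0∞) :
    ∫⁻ t : ℝ, ENNReal.ofReal (max (inner ℝ u (y - t • u)) 0 / ‖y - t • u‖) * φ ‖y - t • u‖ =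
      ∫⁻ ρ in {ρ : ℝ | 0 < ρ ∧ ∃ t : ℝ, ‖y - t • u‖ < ρ}, φ ρ := by
  -- These are the times before closest approach. The distance strictly decreases there, so it is a
  -- valid substitution; at all other times the integrand vanishes.
  set s : Set ℝ := {t | 0 < inner ℝ u (y - t • u)} with hs
  have hupos : 0 < ‖u‖ := norm_pos_iff.2 hu
  have hin : ∀ t : ℝ, inner ℝ u (y - t • u) = inner ℝ u y - t * ‖u‖ ^ 2 := fun t => by
    rw [inner_sub_right, inner_smul_right, real_inner_self_eq_norm_sq]
  have hsq : ∀ t : ℝ, ‖y - t • u‖ ^ 2 = ‖y‖ ^ 2 - 2 * t * inner ℝ u y + t ^ 2 * ‖u‖ ^ 2 :=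
    fun t => by
    rw [norm_sub_sq_real, inner_smul_right, norm_smul, mul_pow, Real.norm_eq_abs, sq_abs,
      real_inner_comm]
    ring
  have hsm : MeasurableSet s := measurableSet_lt measurable_const (by fun_prop)
  have hne : ∀ t ∈ s, ‖y - t • u‖ ≠ 0 := fun t ht h0 => by
    have h1 : (0 : ℝ) < inner ℝ u (y - t • u) := ht
    rw [norm_eq_zero.1 h0, inner_zero_right] at h1
    exact lt_irrefl _ h1
  have hder : ∀ t ∈ s, HasDerivWithinAt (fun t : ℝ => ‖y - t • u‖)
      (-(inner ℝ u (y - t • u) / ‖y - t • u‖)) s t := fun t ht => by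
    have h1 : HasDerivAt (fun t : ℝ => ‖y - t • u‖ ^ 2) (-(2 * inner ℝ u (y - t • u))) t := by
      simp_rw [hsq, hin]
      have := ((((hasDerivAt_id t).const_mul 2).mul_const (inner ℝ u y)).const_sub
        (‖y‖ ^ 2)).add (((hasDerivAt_id t).pow 2).mul_const (‖u‖ ^ 2))
      refine this.congr_deriv ?_
      simp
      ring
    have h2 := h1.sqrt (pow_ne_zero 2 (hne t ht))
    simp only [Real.sqrt_sq (norm_nonneg _)] at h2
    refine (h2.congr_deriv ?_).hasDerivWithinAt
    have := hne t ht
    field_simp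
  have hinj : InjOn (fun t : ℝ => ‖y - t • u‖) s := by
    intro a ha b hb hab
    have h1 : ‖y - a • u‖ ^ 2 = ‖y - b • u‖ ^ 2 := by simp only at hab; rw [hab]
    rw [hsq, hsq] at h1
    have ha' : 0 < inner ℝ u y - a * ‖u‖ ^ 2 := by rw [← hin]; exact ha
    have hb' : 0 < inner ℝ u y - b * ‖u‖ ^ 2 := by rw [← hin]; exact hb
    have h2 : (a - b) * ((inner ℝ u y - a * ‖u‖ ^ 2) + (inner ℝ u y - b * ‖u‖ ^ 2)) = 0 := by
      linarith
    rcases mul_eq_zero.1 h2 with h | h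
    · linarith
    · linarith
  have himg : (fun t : ℝ => ‖y - t • u‖) '' s = {ρ : ℝ | 0 < ρ ∧ ∃ t : ℝ, ‖y - t • u‖ < ρ} := by
    ext ρ
    constructor
    · rintro ⟨t, ht, rfl⟩
      -- The witness is the time of closest approach.
      refine ⟨lt_of_le_of_ne (norm_nonneg _) (hne t ht).symm, inner ℝ u y / ‖u‖ ^ 2, ?_⟩
      refine lt_of_pow_lt_pow_left₀ 2 (norm_nonneg _) ?_
      rw [hsq, hsq]
      have ht' : 0 < inner ℝ u y - t * ‖u‖ ^ 2 := by rw [← hin]; exact ht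
      have h3 : 0 < (inner ℝ u y - t * ‖u‖ ^ 2) ^ 2 / ‖u‖ ^ 2 := by positivity
      have h4 : ‖y‖ ^ 2 - 2 * t * inner ℝ u y + t ^ 2 * ‖u‖ ^ 2 -
        (‖y‖ ^ 2 - 2 * (inner ℝ u y / ‖u‖ ^ 2) * inner ℝ u y +
          (inner ℝ u y / ‖u‖ ^ 2) ^ 2 * ‖u‖ ^ 2) = (inner ℝ u y - t * ‖u‖ ^ 2) ^ 2 / ‖u‖ ^ 2 := by
        field_simp
        ring
      linarith
    · rintro ⟨hρ, t, ht⟩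
      have h5 : ‖y - t • u‖ ^ 2 < ρ ^ 2 := pow_lt_pow_left₀ ht (norm_nonneg _) two_ne_zero
      set D : ℝ := ρ ^ 2 - ‖y‖ ^ 2 + (inner ℝ u y) ^ 2 / ‖u‖ ^ 2 with hD
      have hDpos : 0 < D := by
        have h6 : D = ρ ^ 2 - ‖y - t • u‖ ^ 2 + (inner ℝ u y - t * ‖u‖ ^ 2) ^ 2 / ‖u‖ ^ 2 := by
          rw [hD, hsq]
          field_simp
          ring
        have : 0 ≤ (inner ℝ u y - t * ‖u‖ ^ 2) ^ 2 / ‖u‖ ^ 2 := by positivity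
        rw [h6]; linarith
      have hu2 := hupos.ne'
      -- `D` is ρ² minus the squared distance of `y` from the line through 0 in direction `u`. The
      -- witness is the earlier of the two times at which the distance equals ρ.
      refine ⟨inner ℝ u y / ‖u‖ ^ 2 - √D / ‖u‖, ?_, ?_⟩
      · change 0 < inner ℝ u _
        rw [hin]
        have : inner ℝ u y - (inner ℝ u y / ‖u‖ ^ 2 - √D / ‖u‖) * ‖u‖ ^ 2 = √D * ‖u‖ := by
          field_simp
          ring
        rw [this]
        positivity
      · change ‖_‖ = ρ
        refine (pow_left_inj₀ (norm_nonneg _) hρ.le two_ne_zero).1 ?_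
        rw [hsq]
        have h7 := Real.sq_sqrt hDpos.le
        have h8 : ‖y‖ ^ 2 - 2 * (inner ℝ u y / ‖u‖ ^ 2 - √D / ‖u‖) * inner ℝ u y +
          (inner ℝ u y / ‖u‖ ^ 2 - √D / ‖u‖) ^ 2 * ‖u‖ ^ 2 =
            ‖y‖ ^ 2 - (inner ℝ u y) ^ 2 / ‖u‖ ^ 2 + √D ^ 2 := by
          field_simp
          ring
        rw [h8, h7, hD]
        ring
  have key := lintegral_image_eq_lintegral_abs_deriv_mul hsm hder hinj φ
  rw [himg] at key
  rw [key, ← lintegral_indicator hsm]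
  refine lintegral_congr fun t => ?_
  by_cases ht : t ∈ s
  · have ht' : 0 < inner ℝ u (y - t • u) := ht
    rw [indicator_of_mem ht, max_eq_left ht'.le, abs_neg, abs_of_pos
      (div_pos ht' (lt_of_le_of_ne (norm_nonneg _) (hne t ht).symm))]
  · have ht' : inner ℝ u (y - t • u) ≤ 0 := not_lt.1 ht
    rw [indicator_of_notMem ht, max_eq_right ht']
    simp

theorem indicator_eq_of_iff {α β : Type*} {s : Set α} {t : Set β} {F : α → ℝ≥0∞} {G : β → ℝ≥0∞}
    {x : α} {y : β} (h : x ∈ s ↔ y ∈ t) (hFG : y ∈ t → F x = G y) :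
    s.indicator F x = t.indicator G y := by
  by_cases hy : y ∈ t
  · rw [indicator_of_mem (h.2 hy), indicator_of_mem hy, hFG hy]
  · rw [indicator_of_notMem (mt h.1 hy), indicator_of_notMem hy]

theorem lintegral_comp_mul_left_pos (G : ℝ → ℝ≥0∞) (hG : Measurable G) {a : ℝ} (ha : 0 < a) :
    ∫⁻ t, G (a * t) = ENNReal.ofReal a⁻¹ * ∫⁻ t, G t := by
  have h := Measure.map_addHaar_smul (volume : Measure ℝ) ha.ne'
  have h2 : ∫⁻ t, G t ∂(Measure.map (fun x : ℝ => a • x) volume) = ∫⁻ t, G (a * t) :=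
    lintegral_map hG (by fun_prop)
  rw [← h2, h, lintegral_smul_measure]
  simp [abs_of_pos ha]

theorem lintegral_comp_smul_pos (G : E3 → ℝ≥0∞) (hG : Measurable G) {a : ℝ} (ha : 0 < a) :
    ∫⁻ y, G (a • y) = ENNReal.ofReal (a⁻¹ ^ 3) * ∫⁻ y, G y := by
  have h := Measure.map_addHaar_smul (volume : Measure E3) ha.ne'
  have h2 : ∫⁻ t, G t ∂(Measure.map (fun x : E3 => a • x) volume) = ∫⁻ t, G (a • t) :=
    lintegral_map hG (by fun_prop)
  rw [← h2, h, lintegral_smul_measure]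
  simp [abs_of_pos ha]

theorem isOpen_cylinder (u : E3) (r : ℝ) : IsOpen {y : E3 | ∃ t : ℝ, ‖y - t • u‖ < r} := by
  rw [ofPred_exists]
  exact isOpen_iUnion fun t => isOpen_lt (by fun_prop) continuous_const

/-- Dilation by ρ carries the unit cylinder to the cylinder of radius ρ, and the factor ρ⁻³ cancels
its Jacobian. -/
theorem setLIntegral_cylinder_rescale (u : E3) {ρ : ℝ} (hρ : 0 < ρ) (F : E3 → ℝ≥0∞)
    (hF : Measurable F) :
    ∫⁻ y in {y | ∃ t : ℝ, ‖y - t • u‖ < ρ}, ENNReal.ofReal (ρ⁻¹ ^ 3) * F (ρ⁻¹ • y) =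
      ∫⁻ y in {y | ∃ t : ℝ, ‖y - t • u‖ < 1}, F y := by
  have h1 : ∀ y : E3, (∃ t : ℝ, ‖y - t • u‖ < ρ) ↔ ∃ t : ℝ, ‖ρ⁻¹ • y - t • u‖ < 1 := by
    intro y
    have key : ∀ t : ℝ, ‖ρ⁻¹ • y - (ρ⁻¹ * t) • u‖ < 1 ↔ ‖y - t • u‖ < ρ := fun t => by
      rw [mul_smul, ← smul_sub, norm_smul, Real.norm_of_nonneg (inv_pos.2 hρ).le,
        inv_mul_lt_iff₀ hρ, mul_one]
    constructor
    · rintro ⟨t, ht⟩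
      exact ⟨ρ⁻¹ * t, (key t).2 ht⟩
    · rintro ⟨t, ht⟩
      refine ⟨ρ * t, (key _).1 ?_⟩
      rwa [inv_mul_cancel_left₀ hρ.ne']
  have h2 := lintegral_comp_smul_pos _ (hF.indicator (isOpen_cylinder u 1).measurableSet)
    (inv_pos.2 hρ)
  rw [lintegral_indicator (isOpen_cylinder u 1).measurableSet] at h2
  rw [lintegral_const_mul _ (by fun_prop), ← lintegral_indicator
    (isOpen_cylinder u ρ).measurableSet]
  have h3 : ∫⁻ y, {y | ∃ t : ℝ, ‖y - t • u‖ < ρ}.indicator (fun y => F (ρ⁻¹ • y)) y =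
      ∫⁻ y, {y | ∃ t : ℝ, ‖y - t • u‖ < 1}.indicator F (ρ⁻¹ • y) :=
    lintegral_congr fun y => indicator_eq_of_iff (h1 y) fun _ => rfl
  rw [h3, h2, ← mul_assoc, ← ENNReal.ofReal_mul (by positivity), ← mul_pow, inv_inv,
    inv_mul_cancel₀ hρ.ne']
  simp

set_option maxHeartbeats 1000000 in
/-- The flux through the unit hemisphere moving with velocity `u` is Lebesgue measure on the
cylinder that it sweeps out. -/
theorem lintegral_flux_unit (u : E3) (hu : u ≠ 0) (F : E3 → ℝ≥0∞) (hF : Measurable F) :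
    ∫⁻ t : ℝ, ∫⁻ ν : S2, F (t • u + (ν : E3)) * ENNReal.ofReal (max (inner ℝ u (ν : E3)) 0)
      ∂sphereMeasure = ∫⁻ y in {y | ∃ t : ℝ, ‖y - t • u‖ < 1}, F y := by
  set I := ∫⁻ t : ℝ, ∫⁻ ν : S2, F (t • u + (ν : E3)) *
    ENNReal.ofReal (max (inner ℝ u (ν : E3)) 0) ∂sphereMeasure with hI
  have hvol : volume (Ioo (1 : ℝ) 2) = 1 := by rw [Real.volume_Ioo]; norm_num
  -- A surface integral is turned into a volume integral by averaging over the radius ρ in (1, 2), a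
  -- window of length one. `φ` is the integrand rescaled to radius ρ and cut off to this window.
  set φ : E3 → ℝ → ℝ≥0∞ := fun y =>
    (Ioo (1 : ℝ) 2).indicator fun ρ => ENNReal.ofReal (ρ⁻¹ ^ 3) * F (ρ⁻¹ • y) with hφ
  have hφm : Measurable fun p : E3 × ℝ => φ p.1 p.2 := by
    have : (fun p : E3 × ℝ => φ p.1 p.2) = (Prod.snd ⁻¹' Ioo (1 : ℝ) 2).indicator
        fun p => ENNReal.ofReal (p.2⁻¹ ^ 3) * F (p.2⁻¹ • p.1) := by
      ext p; exact indicator_eq_of_iff Iff.rfl fun _ => rfl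
    rw [this]
    exact Measurable.indicator (by fun_prop) (measurable_snd measurableSet_Ioo)
  have hφ0 : ∀ y ρ, ρ ∉ Ioo (1 : ℝ) 2 → φ y ρ = 0 := fun y ρ h => indicator_of_notMem h _
  have hφ1 : ∀ y ρ, ρ ∈ Ioo (1 : ℝ) 2 → φ y ρ = ENNReal.ofReal (ρ⁻¹ ^ 3) * F (ρ⁻¹ • y) :=
    fun y ρ h => indicator_of_mem h _
  clear_value φ
  -- Rescaling time by ρ shows that every radius yields the same value. The weight ρ² = ρ³ρ⁻¹ is the
  -- Jacobian of polar coordinates.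
  have hscale : ∀ ρ ∈ Ioo (1 : ℝ) 2, I = ∫⁻ t : ℝ, ∫⁻ ν : S2, ENNReal.ofReal (ρ ^ 2) *
      (φ (t • u + ρ • (ν : E3)) ρ * ENNReal.ofReal (max (inner ℝ u (ν : E3)) 0))
        ∂sphereMeasure := by
    intro ρ hρ
    have hρ0 : 0 < ρ := by linarith [hρ.1]
    have h1 := lintegral_comp_mul_left_pos (fun t => ∫⁻ ν : S2, F (t • u + (ν : E3)) *
      ENNReal.ofReal (max (inner ℝ u (ν : E3)) 0) ∂sphereMeasure) (by fun_prop) (inv_pos.2 hρ0)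
    rw [inv_inv, ← hI] at h1
    have h2 : I = ENNReal.ofReal ρ⁻¹ * (ENNReal.ofReal ρ * I) := by
      rw [← mul_assoc, ← ENNReal.ofReal_mul (by positivity), inv_mul_cancel₀ hρ0.ne']
      simp
    rw [h2, ← h1, ← lintegral_const_mul _ (by fun_prop)]
    refine lintegral_congr fun t => ?_
    rw [← lintegral_const_mul _ (by fun_prop)]
    refine lintegral_congr fun ν => ?_
    rw [hφ1 _ _ hρ]
    simp only [← mul_assoc]
    rw [← ENNReal.ofReal_mul (by positivity), smul_add, smul_smul, smul_smul,
      inv_mul_cancel₀ hρ0.ne', one_smul]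
    congr 3
    field_simp
  have hstep1 : I = ∫⁻ t : ℝ, ∫⁻ ν : S2, ∫⁻ ρ in Ioi (0 : ℝ), ENNReal.ofReal (ρ ^ 2) *
      (φ (t • u + ρ • (ν : E3)) ρ * ENNReal.ofReal (max (inner ℝ u (ν : E3)) 0))
        ∂volume ∂sphereMeasure := by
    have hm : Measurable fun q : ℝ × ℝ × S2 => φ (q.2.1 • u + q.1 • (q.2.2 : E3)) q.1 :=
      hφm.comp (by fun_prop : Measurable fun q : ℝ × ℝ × S2 =>
        (q.2.1 • u + q.1 • (q.2.2 : E3), q.1))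
    have hm2 : Measurable fun q : ℝ × ℝ × S2 => ENNReal.ofReal (q.1 ^ 2) *
      (φ (q.2.1 • u + q.1 • (q.2.2 : E3)) q.1 *
        ENNReal.ofReal (max (inner ℝ u (q.2.2 : E3)) 0)) := by fun_prop
    have hm3 : ∀ t : ℝ, Measurable fun q : ℝ × S2 => ENNReal.ofReal (q.1 ^ 2) *
      (φ (t • u + q.1 • (q.2 : E3)) q.1 *
        ENNReal.ofReal (max (inner ℝ u (q.2 : E3)) 0)) := fun t =>
      hm2.comp (by fun_prop : Measurable fun q : ℝ × S2 => (q.1, t, q.2))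
    have hm4 : Measurable fun q : ℝ × ℝ => ∫⁻ ν : S2, ENNReal.ofReal (q.1 ^ 2) *
      (φ (q.2 • u + q.1 • (ν : E3)) q.1 * ENNReal.ofReal (max (inner ℝ u (ν : E3)) 0))
        ∂sphereMeasure := Measurable.lintegral_prod_right'
          (f := fun q : (ℝ × ℝ) × S2 => ENNReal.ofReal (q.1.1 ^ 2) *
            (φ (q.1.2 • u + q.1.1 • (q.2 : E3)) q.1.1 *
              ENNReal.ofReal (max (inner ℝ u (q.2 : E3)) 0)))
          (hm2.comp (by fun_prop : Measurable fun q : (ℝ × ℝ) × S2 => (q.1.1, q.1.2, q.2)))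
    calc I = ∫⁻ ρ in Ioo (1 : ℝ) 2, I := by rw [setLIntegral_const, hvol, mul_one]
      _ = ∫⁻ ρ in Ioo (1 : ℝ) 2, ∫⁻ t : ℝ, ∫⁻ ν : S2, ENNReal.ofReal (ρ ^ 2) *
          (φ (t • u + ρ • (ν : E3)) ρ * ENNReal.ofReal (max (inner ℝ u (ν : E3)) 0))
            ∂sphereMeasure := setLIntegral_congr_fun measurableSet_Ioo hscale
      _ = ∫⁻ ρ in Ioi (0 : ℝ), ∫⁻ t : ℝ, ∫⁻ ν : S2, ENNReal.ofReal (ρ ^ 2) *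
          (φ (t • u + ρ • (ν : E3)) ρ * ENNReal.ofReal (max (inner ℝ u (ν : E3)) 0))
            ∂sphereMeasure := by
        rw [← lintegral_indicator measurableSet_Ioo, ← lintegral_indicator measurableSet_Ioi]
        refine lintegral_congr fun ρ => ?_
        by_cases h : ρ ∈ Ioo (1 : ℝ) 2
        · rw [indicator_of_mem h, indicator_of_mem (mem_Ioi.2 (by linarith [h.1]))]
        · rw [indicator_of_notMem h]
          simp only [indicator, hφ0 _ _ h, zero_mul, mul_zero, lintegral_zero, ite_self]
      _ = ∫⁻ t : ℝ, ∫⁻ ρ in Ioi (0 : ℝ), ∫⁻ ν : S2, ENNReal.ofReal (ρ ^ 2) *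
          (φ (t • u + ρ • (ν : E3)) ρ * ENNReal.ofReal (max (inner ℝ u (ν : E3)) 0))
            ∂sphereMeasure := lintegral_lintegral_swap hm4.aemeasurable
      _ = _ := lintegral_congr fun t => lintegral_lintegral_swap (hm3 t).aemeasurable
  -- Polar coordinates with x = ρν.
  have hstep2 : I = ∫⁻ t : ℝ, ∫⁻ x : E3, φ (t • u + x) ‖x‖ *
      ENNReal.ofReal (max (inner ℝ u x) 0 / ‖x‖) := by
    rw [hstep1]
    refine lintegral_congr fun t => ?_
    have hm : Measurable fun x : E3 => φ (t • u + x) ‖x‖ :=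
      hφm.comp (by fun_prop : Measurable fun x : E3 => (t • u + x, ‖x‖))
    rw [lintegral_polar _ (by fun_prop)]
    refine lintegral_congr fun ν => ?_
    refine setLIntegral_congr_fun measurableSet_Ioi fun ρ hρ => ?_
    have hρ0 : (0 : ℝ) < ρ := hρ
    have hν : ‖(ν : E3)‖ = 1 := by simp
    simp only [norm_smul, hν, mul_one, Real.norm_of_nonneg hρ0.le, inner_smul_right]
    rw [show (0 : ℝ) = ρ * 0 by simp, ← mul_max_of_nonneg _ _ hρ0.le, mul_zero,
      mul_div_cancel_left₀ _ hρ0.ne']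
  have hm5 : Measurable fun p : ℝ × E3 => φ p.2 ‖p.2 - p.1 • u‖ *
      ENNReal.ofReal (max (inner ℝ u (p.2 - p.1 • u)) 0 / ‖p.2 - p.1 • u‖) := by
    have hm : Measurable fun p : ℝ × E3 => φ p.2 ‖p.2 - p.1 • u‖ :=
      hφm.comp (by fun_prop : Measurable fun p : ℝ × E3 => (p.2, ‖p.2 - p.1 • u‖))
    fun_prop
  have hopen : MeasurableSet {p : E3 × ℝ | 0 < p.2 ∧ ∃ t : ℝ, ‖p.1 - t • u‖ < p.2} := by
    have h2 : IsOpen {p : E3 × ℝ | ∃ t : ℝ, ‖p.1 - t • u‖ < p.2} := by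
      rw [ofPred_exists]
      exact isOpen_iUnion fun t => isOpen_lt (by fun_prop) (by fun_prop)
    exact (measurableSet_lt measurable_const measurable_snd).inter h2.measurableSet
  -- With y = tu + x and the order of integration exchanged, the time integral at fixed `y` is the
  -- substitution `lintegral_approach`. It leaves an integral over radii ρ and cylinders of radius
  -- ρ, each of which rescales back to the unit cylinder.
  calc I = ∫⁻ t : ℝ, ∫⁻ y : E3, φ y ‖y - t • u‖ *
      ENNReal.ofReal (max (inner ℝ u (y - t • u)) 0 / ‖y - t • u‖) := by
        rw [hstep2]
        refine lintegral_congr fun t => ?_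
        rw [← lintegral_sub_right_eq_self _ (t • u)]
        simp only [add_sub_cancel]
    _ = ∫⁻ y : E3, ∫⁻ t : ℝ, φ y ‖y - t • u‖ *
      ENNReal.ofReal (max (inner ℝ u (y - t • u)) 0 / ‖y - t • u‖) :=
        lintegral_lintegral_swap hm5.aemeasurable
    _ = ∫⁻ y : E3, ∫⁻ ρ in {ρ : ℝ | 0 < ρ ∧ ∃ t : ℝ, ‖y - t • u‖ < ρ}, φ y ρ := by
        refine lintegral_congr fun y => ?_
        rw [← lintegral_approach u y hu]
        simp only [mul_comm]
    _ = ∫⁻ y : E3, ∫⁻ ρ : ℝ, {p : E3 × ℝ | 0 < p.2 ∧ ∃ t : ℝ, ‖p.1 - t • u‖ < p.2}.indicator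
          (fun p => φ p.1 p.2) (y, ρ) := by
        refine lintegral_congr fun y => ?_
        rw [← lintegral_indicator (s := {ρ : ℝ | 0 < ρ ∧ ∃ t : ℝ, ‖y - t • u‖ < ρ})
          (hopen.preimage measurable_prodMk_left)]
        rfl
    _ = ∫⁻ ρ : ℝ, ∫⁻ y : E3, {p : E3 × ℝ | 0 < p.2 ∧ ∃ t : ℝ, ‖p.1 - t • u‖ < p.2}.indicator
          (fun p => φ p.1 p.2) (y, ρ) :=
        lintegral_lintegral_swap (hφm.indicator hopen).aemeasurable
    _ = ∫⁻ ρ in Ioo (1 : ℝ) 2, ∫⁻ y in {y | ∃ t : ℝ, ‖y - t • u‖ < 1}, F y := by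
        rw [← lintegral_indicator measurableSet_Ioo]
        refine lintegral_congr fun ρ => ?_
        by_cases h : ρ ∈ Ioo (1 : ℝ) 2
        · have hρ0 : 0 < ρ := by linarith [h.1]
          rw [indicator_of_mem h, ← setLIntegral_cylinder_rescale u hρ0 F hF,
            ← lintegral_indicator (isOpen_cylinder u ρ).measurableSet]
          refine lintegral_congr fun y => indicator_eq_of_iff ?_ fun _ => hφ1 _ _ h
          exact ⟨fun hy => hy.2, fun hy => ⟨hρ0, hy⟩⟩
        · rw [indicator_of_notMem h]
          simp only [indicator, hφ0 _ _ h, lintegral_zero, ite_self]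
    _ = _ := by rw [setLIntegral_const, hvol, mul_one]

/-- The flux through a hemisphere of radius `r`. -/
theorem lintegral_flux (u : E3) (hu : u ≠ 0) {r : ℝ} (hr : 0 < r) (F : E3 → ℝ≥0∞)
    (hF : Measurable F) :
    ∫⁻ t : ℝ, ∫⁻ ν : S2, F (t • u + r • (ν : E3)) *
      ENNReal.ofReal (r ^ 2 * max (inner ℝ u (ν : E3)) 0)
      ∂sphereMeasure = ∫⁻ y in {y | ∃ t : ℝ, ‖y - t • u‖ < r}, F y := by
  have h1 := lintegral_flux_unit u hu (fun y => F (r • y)) (by fun_prop)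
  have h2 := lintegral_comp_mul_left_pos (fun t => ∫⁻ ν : S2, F (t • u + r • (ν : E3)) *
      ENNReal.ofReal (r ^ 2 * max (inner ℝ u (ν : E3)) 0) ∂sphereMeasure) (by fun_prop) hr
  have h3 := lintegral_comp_smul_pos ({y | ∃ t : ℝ, ‖y - t • u‖ < r}.indicator F)
    (hF.indicator (isOpen_cylinder u r).measurableSet) hr
  rw [lintegral_indicator (isOpen_cylinder u r).measurableSet] at h3
  have h4 : (∫⁻ y, {y | ∃ t : ℝ, ‖y - t • u‖ < r}.indicator F (r • y)) =
      ∫⁻ y in {y | ∃ t : ℝ, ‖y - t • u‖ < 1}, F (r • y) := by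
    rw [← lintegral_indicator (isOpen_cylinder u 1).measurableSet]
    refine lintegral_congr fun y => ?_
    have key : ∀ t : ℝ, ‖r • y - (r * t) • u‖ < r ↔ ‖y - t • u‖ < 1 := fun t => by
      rw [mul_smul, ← smul_sub, norm_smul, Real.norm_of_nonneg hr.le, mul_lt_iff_lt_one_right hr]
    have hiff : (∃ t : ℝ, ‖r • y - t • u‖ < r) ↔ ∃ t : ℝ, ‖y - t • u‖ < 1 := by
      constructor
      · rintro ⟨t, ht⟩
        refine ⟨r⁻¹ * t, (key _).1 ?_⟩
        rwa [mul_inv_cancel_left₀ hr.ne']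
      · rintro ⟨t, ht⟩
        exact ⟨r * t, (key t).2 ht⟩
    exact indicator_eq_of_iff hiff fun _ => rfl
  have h5 : ∀ X Y : ℝ≥0∞, ENNReal.ofReal r⁻¹ * X = ENNReal.ofReal r⁻¹ * Y → X = Y := fun X Y h =>
    (ENNReal.mul_right_inj (by simpa using hr) ENNReal.ofReal_ne_top).1 h
  apply h5
  rw [← h2]
  have h6 : ∀ t : ℝ, ∫⁻ ν : S2, F ((r * t) • u + r • (ν : E3)) *
      ENNReal.ofReal (r ^ 2 * max (inner ℝ u (ν : E3)) 0) ∂sphereMeasure =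
      ENNReal.ofReal (r ^ 2) * ∫⁻ ν : S2, F (r • (t • u + (ν : E3))) *
        ENNReal.ofReal (max (inner ℝ u (ν : E3)) 0) ∂sphereMeasure := fun t => by
    rw [← lintegral_const_mul _ (by fun_prop)]
    refine lintegral_congr fun ν => ?_
    rw [ENNReal.ofReal_mul (by positivity), smul_add, smul_smul]
    ring
  simp_rw [h6]
  rw [lintegral_const_mul _ (by fun_prop), h1, ← h4, h3, ← mul_assoc,
    ← ENNReal.ofReal_mul (by positivity)]
  congr 2
  field_simp

/-! ### Folding the covering space into the unit cube -/

/-- The integer parts of the coordinates of a point. -/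
def floorVec (y : E3) : Fin 3 → ℤ := fun i => ⌊y i⌋

/-- The representative in the unit cube of a point of the covering space. -/
def frac (y : E3) : E3 := y - latticeVec (floorVec y)

theorem latticeVec_apply (k : Fin 3 → ℤ) (i : Fin 3) : latticeVec k i = k i := rfl

theorem latticeVec_zero : latticeVec 0 = 0 := by ext i; simp [latticeVec_apply]

theorem latticeVec_sub (k l : Fin 3 → ℤ) : latticeVec (k - l) = latticeVec k - latticeVec l := by
  ext i; simp [latticeVec_apply]

theorem one_le_norm_latticeVec {k : Fin 3 → ℤ} (hk : k ≠ 0) : 1 ≤ ‖latticeVec k‖ := by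
  obtain ⟨i, hi⟩ := Function.ne_iff.1 hk
  refine le_trans ?_ (PiLp.norm_apply_le (latticeVec k) i)
  rw [latticeVec_apply, Real.norm_eq_abs, ← Int.cast_abs]
  exact_mod_cast Int.one_le_abs hi

theorem frac_mem (y : E3) : frac y ∈ unitCube := fun i => by
  simp only [frac, PiLp.sub_apply, latticeVec_apply, floorVec]
  exact ⟨Int.fract_nonneg _, Int.fract_lt_one _⟩

theorem floorVec_add_latticeVec {x : E3} (hx : x ∈ unitCube) (k : Fin 3 → ℤ) :
    floorVec (x + latticeVec k) = k := by
  funext i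
  simp only [floorVec, PiLp.add_apply, latticeVec_apply, Int.floor_add_intCast]
  have := hx i
  rw [Int.floor_eq_zero_iff.2 this, zero_add]

theorem frac_add_latticeVec {x : E3} (hx : x ∈ unitCube) (k : Fin 3 → ℤ) :
    frac (x + latticeVec k) = x := by
  rw [frac, floorVec_add_latticeVec hx, add_sub_cancel_right]

theorem add_latticeVec_mem_unitCube_iff (y : E3) (k : Fin 3 → ℤ) :
    floorVec (y + latticeVec k) = k ↔ y ∈ unitCube := by
  refine ⟨fun h => ?_, fun h => floorVec_add_latticeVec h k⟩
  have := frac_mem (y + latticeVec k)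
  rwa [frac, h, add_sub_cancel_right] at this

theorem measurable_floorVec : Measurable floorVec :=
  measurable_pi_lambda _ fun i => Int.measurable_floor.comp (by fun_prop)

theorem measurable_latticeVec : Measurable latticeVec := measurable_of_countable _

theorem measurable_frac : Measurable frac :=
  measurable_id.sub (measurable_latticeVec.comp measurable_floorVec)

theorem measurableSet_unitCube : MeasurableSet unitCube := by
  have : unitCube = ⋂ i : Fin 3, {x : E3 | x i ∈ Ico (0 : ℝ) 1} := by ext x; simp [unitCube]
  rw [this]
  exact MeasurableSet.iInter fun i => measurableSet_Ico.preimage (by fun_prop)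

/-- The level sets of `floorVec` are the lattice translates of the unit cube and tile the space. -/
theorem lintegral_eq_tsum_unitCube (G : E3 → ℝ≥0∞) :
    ∫⁻ y, G y = ∑' k, ∫⁻ x in unitCube, G (x + latticeVec k) := by
  have hU : (⋃ k : Fin 3 → ℤ, floorVec ⁻¹' {k}) = univ := by ext y; simp
  rw [← setLIntegral_univ, ← hU, lintegral_iUnion
    (fun k => measurable_floorVec (measurableSet_singleton k))
    (fun k l hkl => disjoint_left.2 fun y h1 h2 => hkl (h1.symm.trans h2))]
  refine tsum_congr fun k => ?_
  rw [← lintegral_indicator (measurable_floorVec (measurableSet_singleton k)),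
    ← lintegral_indicator measurableSet_unitCube, ← lintegral_add_right_eq_self _ (latticeVec k)]
  refine lintegral_congr fun y => ?_
  exact indicator_eq_of_iff (add_latticeVec_mem_unitCube_iff y k) fun _ => rfl

theorem volume_unitCube : volume unitCube = 1 := by
  have h : unitCube = (MeasurableEquiv.toLp 2 (Fin 3 → ℝ)).symm ⁻¹' (Set.univ.pi fun _ => Ico (0 : ℝ) 1) := by
    ext x; simp [unitCube]
  rw [h, (EuclideanSpace.volume_preserving_symm_measurableEquiv_toLp (Fin 3)).measure_preimage
    (MeasurableSet.univ_pi fun _ => measurableSet_Ico).nullMeasurableSet]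
  simp [Real.volume_pi_Ico]

/-- Folding into the unit cube does not increase the integral over a set without equivalent
points. -/
theorem setLIntegral_frac_le {D : Set E3} (hD : MeasurableSet D) (hinj : InjOn frac D)
    (F : E3 → ℝ≥0∞) (hF : Measurable F) :
    ∫⁻ y in D, F (frac y) ≤ ∫⁻ x in unitCube, F x := by
  have hm : ∀ k, Measurable fun x => D.indicator (fun y => F (frac y)) (x + latticeVec k) :=
    fun k => ((hF.comp measurable_frac).indicator hD).comp (measurable_add_const _)
  rw [← lintegral_indicator hD, lintegral_eq_tsum_unitCube,
    ← lintegral_tsum fun k => (hm k).aemeasurable]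
  refine setLIntegral_mono hF fun x hx => ?_
  by_cases h : ∃ k, x + latticeVec k ∈ D
  · obtain ⟨k, hk⟩ := h
    -- Injectivity of `frac` on `D` leaves at most one nonzero term in the sum over translates.
    rw [tsum_eq_single k, indicator_of_mem hk, frac_add_latticeVec hx]
    intro l hl
    refine indicator_of_notMem (fun h => hl ?_) _
    have h1 := hinj h hk (by rw [frac_add_latticeVec hx, frac_add_latticeVec hx])
    rw [← floorVec_add_latticeVec hx l, h1, floorVec_add_latticeVec hx k]
  · push Not at h
    rw [ENNReal.tsum_eq_zero.2 fun k => indicator_of_notMem (h k) _]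
    exact zero_le

/-- Union bound over translates: those of the cube cut `D` into pieces whose volumes add up to that
of `D`. -/
theorem volume_exists_add_latticeVec_le (D : Set E3) (hD : MeasurableSet D) :
    volume.restrict unitCube {x | ∃ k, x + latticeVec k ∈ D} ≤ volume D := by
  rw [← lintegral_indicator_one hD, lintegral_eq_tsum_unitCube, ofPred_exists]
  refine (measure_iUnion_le _).trans (ENNReal.tsum_le_tsum fun k => le_of_eq ?_)
  exact (lintegral_indicator_one (hD.preimage (measurable_add_const (latticeVec k)))).symm

/-! ### Change of variables from collision markers to initial bath positions -/

/-- The law of a background particle. -/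
def bathLaw (g : E3 → ℝ) : Measure (E3 × E3) :=
  (volume.restrict unitCube).prod (volume.withDensity fun v => ENNReal.ofReal (g v))

/-- Lebesgue measure on markers. -/
def markerMeasure : Measure Marker :=
  (volume : Measure ℝ).prod (sphereMeasure.prod (volume : Measure E3))

instance : SFinite (sphereMeasure.prod (volume : Measure E3)) := Measure.prod.instSFinite

instance : SigmaFinite markerMeasure := by unfold markerMeasure; infer_instance

instance : StandardBorelSpace S2 := by
  have : PolishSpace S2 := Metric.isClosed_sphere.polishSpace
  infer_instance

theorem lintegral_marker (h : Marker → ℝ≥0∞) (hh : Measurable h) :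
    ∫⁻ x, h x ∂markerMeasure = ∫⁻ t : ℝ, ∫⁻ ν : S2, ∫⁻ w : E3, h (t, ν, w) ∂volume
      ∂sphereMeasure ∂volume := by
  rw [markerMeasure, lintegral_prod _ hh.aemeasurable]
  refine lintegral_congr fun t => ?_
  rw [lintegral_prod _ (by fun_prop)]

theorem lintegral_marker' (h : Marker → ℝ≥0∞) (hh : Measurable h) :
    ∫⁻ x, h x ∂markerMeasure = ∫⁻ w : E3, ∫⁻ t : ℝ, ∫⁻ ν : S2, h (t, ν, w)
      ∂sphereMeasure ∂volume ∂volume := by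
  rw [markerMeasure, lintegral_prod _ hh.aemeasurable]
  have h1 : ∀ t : ℝ, ∫⁻ y, h (t, y) ∂(sphereMeasure.prod (volume : Measure E3)) =
      ∫⁻ w : E3, ∫⁻ ν : S2, h (t, ν, w) ∂sphereMeasure := fun t => by
    rw [lintegral_prod_symm _ (by fun_prop)]
  simp_rw [h1]
  rw [lintegral_lintegral_swap]
  refine Measurable.aemeasurable ?_
  exact Measurable.lintegral_prod_right' (f := fun q : (ℝ × E3) × S2 => h (q.1.1, q.2, q.1.2))
    (by fun_prop)

theorem lintegral_bathLaw {g : E3 → ℝ} (hg : Measurable g) (F : E3 × E3 → ℝ≥0∞)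
    (hF : Measurable F) :
    ∫⁻ q, F q ∂bathLaw g = ∫⁻ w, ENNReal.ofReal (g w) * ∫⁻ x in unitCube, F (x, w) := by
  rw [bathLaw, lintegral_prod_symm _ hF.aemeasurable,
    lintegral_withDensity_eq_lintegral_mul _ (by fun_prop) (by fun_prop)]
  rfl

/-- The initial positions of background particles of velocity `w` that the root meets at the
time `x.1` in the direction `x.2` are distributed with density at most that of the bath. -/
theorem setLIntegral_collision_le {g : E3 → ℝ} (hg : Measurable g) (a v : E3) {ε : ℝ} (hε : 0 < ε)
    {B : Set Marker} (hB : MeasurableSet B)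
    (hinj : ∀ x ∈ B, ∀ x' ∈ B, x.2.2 = x'.2.2 →
      frac (a + x.1 • (v - x.2.2) + ε • (x.2.1 : E3)) =
        frac (a + x'.1 • (v - x'.2.2) + ε • (x'.2.1 : E3)) → x.1 = x'.1 ∧ x.2.1 = x'.2.1)
    (F : E3 × E3 → ℝ≥0∞) (hF : Measurable F) :
    ∫⁻ x in B, ENNReal.ofReal (ε ^ 2 * max (inner ℝ (v - x.2.2) (x.2.1 : E3)) 0) *
      ENNReal.ofReal (g x.2.2) * F (frac (a + x.1 • (v - x.2.2) + ε • (x.2.1 : E3)), x.2.2)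
        ∂markerMeasure ≤ ∫⁻ q, F q ∂bathLaw g := by
  have hfm := measurable_frac
  have hm1 : Measurable fun x : Marker =>
      F (frac (a + x.1 • (v - x.2.2) + ε • (x.2.1 : E3)), x.2.2) :=
    hF.comp (by fun_prop)
  rw [← lintegral_indicator hB, lintegral_marker' _ (Measurable.indicator (by fun_prop) hB),
    lintegral_bathLaw hg F hF]
  refine lintegral_mono fun w => ?_
  -- At zero relative velocity nothing is swept out and the flux factor vanishes; the flux formula
  -- needs a nonzero velocity.
  by_cases hu : v - w = 0
  · have : ∀ (t : ℝ) (ν : S2), B.indicator (fun x : Marker =>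
        ENNReal.ofReal (ε ^ 2 * max (inner ℝ (v - x.2.2) (x.2.1 : E3)) 0) *
        ENNReal.ofReal (g x.2.2) * F (frac (a + x.1 • (v - x.2.2) + ε • (x.2.1 : E3)), x.2.2))
          (t, ν, w) = 0 := fun t ν => by
      refine indicator_apply_eq_zero.2 fun _ => ?_
      simp [hu]
    simp [this]
  set Bw : Set (ℝ × S2) := {p | (p.1, p.2, w) ∈ B} with hBw
  have hBwm : MeasurableSet Bw := hB.preimage (by fun_prop)
  set Θ : ℝ × S2 → E3 := fun p => a + p.1 • (v - w) + ε • (p.2 : E3) with hΘ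
  have hfinj : InjOn (frac ∘ Θ) Bw := fun p hp p' hp' h => by
    have := hinj (p.1, p.2, w) hp (p'.1, p'.2, w) hp' rfl h
    exact Prod.ext this.1 this.2
  have hΘinj : InjOn Θ Bw := hfinj.of_comp
  -- Lusin–Souslin: an injective Borel image is Borel.
  have hD : MeasurableSet (Θ '' Bw) :=
    hBwm.image_of_measurable_injOn (by fun_prop) hΘinj
  have hDinj : InjOn frac (Θ '' Bw) := by
    rintro _ ⟨p, hp, rfl⟩ _ ⟨p', hp', rfl⟩ h
    rw [hfinj hp hp' h]
  -- Restricting to the image of the admissible markers is what allows folding by `frac` without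
  -- overcounting.
  set F' : E3 → ℝ≥0∞ := (Θ '' Bw).indicator fun y => F (frac y, w) with hF'
  have hF'm : Measurable F' := Measurable.indicator (by fun_prop) hD
  have hflux := lintegral_flux (v - w) hu hε (fun y => F' (a + y)) (by fun_prop)
  calc ∫⁻ t : ℝ, ∫⁻ ν : S2, B.indicator (fun x : Marker =>
        ENNReal.ofReal (ε ^ 2 * max (inner ℝ (v - x.2.2) (x.2.1 : E3)) 0) *
        ENNReal.ofReal (g x.2.2) * F (frac (a + x.1 • (v - x.2.2) + ε • (x.2.1 : E3)), x.2.2))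
          (t, ν, w) ∂sphereMeasure
      ≤ ∫⁻ t : ℝ, ∫⁻ ν : S2, ENNReal.ofReal (g w) * (F' (a + (t • (v - w) + ε • (ν : E3))) *
          ENNReal.ofReal (ε ^ 2 * max (inner ℝ (v - w) (ν : E3)) 0)) ∂sphereMeasure := by
        refine lintegral_mono fun t => lintegral_mono fun ν => ?_
        refine indicator_apply_le' (fun h => ?_) fun _ => zero_le
        have h2 : F' (a + (t • (v - w) + ε • (ν : E3))) =
            F (frac (a + t • (v - w) + ε • (ν : E3)), w) := by
          rw [← add_assoc, hF']
          exact indicator_of_mem (mem_image_of_mem Θ (show (t, ν) ∈ Bw from h)) _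
        rw [h2]
        exact le_of_eq (by ring)
    _ = ENNReal.ofReal (g w) * ∫⁻ y in {y | ∃ t : ℝ, ‖y - t • (v - w)‖ < ε}, F' (a + y) := by
        rw [← hflux, ← lintegral_const_mul _ (by fun_prop)]
        refine lintegral_congr fun t => ?_
        rw [← lintegral_const_mul _ (by fun_prop)]
    _ ≤ ENNReal.ofReal (g w) * ∫⁻ x in unitCube, F (x, w) := by
        refine mul_le_mul_right ?_ _
        refine (setLIntegral_le_lintegral _ _).trans ?_
        rw [lintegral_add_left_eq_self F' a, hF', lintegral_indicator hD]
        exact setLIntegral_frac_le hD hDinj (fun x => F (x, w)) (by fun_prop)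

/-- A swept point lies at distance r from the centre while the centre is still approaching it. The
distance strictly decreases during the approach, so it takes the value r only once. -/
theorem swept_injOn (u : E3) {r : ℝ} (hr : 0 < r) {s s' : ℝ} {ν ν' : S2}
    (hν : 0 < inner ℝ u (ν : E3)) (hν' : 0 < inner ℝ u (ν' : E3))
    (h : s • u + r • (ν : E3) = s' • u + r • (ν' : E3)) : s = s' ∧ ν = ν' := by
  have h1 : r • (ν' : E3) = (s - s') • u + r • (ν : E3) := by
    rw [sub_smul, sub_add_eq_add_sub, h]; abel
  have hn : ∀ ν : S2, ‖(ν : E3)‖ = 1 := fun ν => by simp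
  have h2 : ‖r • (ν' : E3)‖ ^ 2 = ‖(s - s') • u + r • (ν : E3)‖ ^ 2 := by rw [h1]
  rw [norm_add_sq_real, norm_smul, norm_smul, norm_smul, hn, hn, inner_smul_left, inner_smul_right,
    mul_pow ‖s - s'‖, Real.norm_eq_abs (s - s'), sq_abs] at h2
  have h3 : r * inner ℝ u (ν' : E3) = (s - s') * ‖u‖ ^ 2 + r * inner ℝ u (ν : E3) := by
    rw [← inner_smul_right, h1, inner_add_right, inner_smul_right, inner_smul_right,
      real_inner_self_eq_norm_sq]
  simp only [conj_trivial] at h2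
  have h4 : (s - s') * (r * inner ℝ u (ν' : E3) + r * inner ℝ u (ν : E3)) = 0 := by
    rw [h3]; linarith
  have h5 : 0 < r * inner ℝ u (ν' : E3) + r * inner ℝ u (ν : E3) := by positivity
  have h6 : s = s' := by
    rcases mul_eq_zero.1 h4 with h | h
    · linarith
    · exact absurd h h5.ne'
  refine ⟨h6, ?_⟩
  rw [h6, sub_self, zero_smul, zero_add] at h1
  exact Subtype.ext (smul_right_injective E3 hr.ne' h1).symm

/-- A centre moving towards a point at distance r comes strictly closer; the witness is the time of
closest approach. -/
theorem mem_cylinder_of_inner_pos (u : E3) {r : ℝ} (hr : 0 < r) {ν : S2}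
    (hν : 0 < inner ℝ u (ν : E3)) (s : ℝ) : ∃ t : ℝ, ‖s • u + r • (ν : E3) - t • u‖ < r := by
  have hu : u ≠ 0 := fun h => by simp [h] at hν
  have hupos : 0 < ‖u‖ := norm_pos_iff.2 hu
  set c : ℝ := inner ℝ u (ν : E3) with hc
  refine ⟨s + r * c / ‖u‖ ^ 2, lt_of_pow_lt_pow_left₀ 2 hr.le ?_⟩
  have h1 : s • u + r • (ν : E3) - (s + r * c / ‖u‖ ^ 2) • u =
      r • (ν : E3) - (r * c / ‖u‖ ^ 2) • u := by rw [add_smul]; abel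
  have hn : ‖(ν : E3)‖ = 1 := by simp
  rw [h1, norm_sub_sq_real, norm_smul, norm_smul, hn, inner_smul_left, inner_smul_right,
    real_inner_comm, ← hc, mul_pow, mul_pow, Real.norm_eq_abs, Real.norm_eq_abs, sq_abs, sq_abs]
  simp only [conj_trivial]
  have h2 : r ^ 2 * 1 ^ 2 - 2 * (r * (r * c / ‖u‖ ^ 2 * c)) + (r * c / ‖u‖ ^ 2) ^ 2 * ‖u‖ ^ 2 =
      r ^ 2 - r ^ 2 * c ^ 2 / ‖u‖ ^ 2 := by
    field_simp
    ring
  rw [h2]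
  have : 0 < r ^ 2 * c ^ 2 / ‖u‖ ^ 2 := by positivity
  linarith

/-- Volume of the region entered by a ball of radius `r` that moves with velocity `u`. -/
theorem volume_entered_le (b u : E3) {r : ℝ} (hr : 0 < r) (τ t : ℝ) :
    volume.restrict unitCube {x | ∃ k, r ≤ ‖b + τ • u - (x + latticeVec k)‖ ∧
      ∃ s ∈ Icc τ t, ‖b + s • u - (x + latticeVec k)‖ < r} ≤
    ∫⁻ ν : S2, ENNReal.ofReal (r ^ 2 * (t - τ)) * ENNReal.ofReal (max (inner ℝ u (ν : E3)) 0)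
      ∂sphereMeasure := by
  set H : Set (ℝ × S2) := Icc τ t ×ˢ {ν : S2 | 0 < inner ℝ u (ν : E3)} with hH
  have hHm : MeasurableSet H :=
    measurableSet_Icc.prod (measurableSet_lt measurable_const (by fun_prop))
  set Θ : ℝ × S2 → E3 := fun p => p.1 • u + r • (p.2 : E3) with hΘ
  have hinj : InjOn Θ H := fun p hp p' hp' h => by
    have := swept_injOn u hr hp.2 hp'.2 h
    exact Prod.ext this.1 this.2
  have hD : MeasurableSet (Θ '' H) := hHm.image_of_measurable_injOn (by fun_prop) hinj
  have hsub : {x | ∃ k, r ≤ ‖b + τ • u - (x + latticeVec k)‖ ∧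
      ∃ s ∈ Icc τ t, ‖b + s • u - (x + latticeVec k)‖ < r} ⊆
      {x | ∃ k, x + latticeVec k ∈ (fun y => y - b) ⁻¹' (Θ '' H)} := by
    rintro x ⟨k, h1, s₁, hs₁, h2⟩
    refine ⟨k, ?_⟩
    have hcont : ContinuousOn (fun s : ℝ => ‖b + s • u - (x + latticeVec k)‖) (Icc τ s₁) := by
      fun_prop
    -- At some time before `s₁` the distance is exactly r. Since it is smaller at `s₁`, the motion
    -- at time `s` is inward, so the point is swept by the forward hemisphere.
    obtain ⟨s, hs, hsr⟩ := intermediate_value_Icc' hs₁.1 hcont ⟨h2.le, h1⟩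
    have hlt : s < s₁ := lt_of_le_of_ne hs.2 fun h => by
      simp only at hsr; rw [h] at hsr; exact h2.ne hsr
    set y : E3 := x + latticeVec k - b with hy
    have hyr : ‖y - s • u‖ = r := by
      rw [← hsr, ← norm_neg]; congr 1; rw [hy]; abel
    have hν : ‖r⁻¹ • (y - s • u)‖ = 1 := by
      rw [norm_smul, hyr, Real.norm_of_nonneg (inv_pos.2 hr).le, inv_mul_cancel₀ hr.ne']
    refine ⟨(s, ⟨r⁻¹ • (y - s • u), by simpa using hν⟩), ⟨⟨hs.1, hs.2.trans hs₁.2⟩, ?_⟩, ?_⟩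
    · change 0 < inner ℝ u (r⁻¹ • (y - s • u))
      rw [inner_smul_right]
      refine mul_pos (inv_pos.2 hr) ?_
      have h3 : ‖(y - s • u) - (s₁ - s) • u‖ < r := by
        rw [show (y - s • u) - (s₁ - s) • u = -(b + s₁ • u - (x + latticeVec k)) by
          rw [hy, sub_smul]; abel, norm_neg]
        exact h2
      have h4 := pow_lt_pow_left₀ h3 (norm_nonneg _) two_ne_zero
      rw [norm_sub_sq_real, hyr, inner_smul_right, real_inner_comm] at h4
      have h5 : 0 < (s₁ - s) * inner ℝ u (y - s • u) := by
        have := sq_nonneg ‖(s₁ - s) • u‖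
        linarith
      exact (pos_iff_pos_of_mul_pos h5).1 (sub_pos.2 hlt)
    · simp only [hΘ]
      rw [smul_smul, mul_inv_cancel₀ hr.ne', one_smul, hy]
      abel
  refine (measure_mono hsub).trans ((volume_exists_add_latticeVec_le _
    (hD.preimage (measurable_sub_const b))).trans ?_)
  have hshift : volume ((fun y => y - b) ⁻¹' (Θ '' H)) = volume (Θ '' H) := by
    simp only [sub_eq_add_neg]
    exact measure_preimage_add_right _ _ _
  rw [hshift]
  by_cases hu : u = 0
  · have : Θ '' H = ∅ := by
      rw [image_eq_empty, hH]
      ext p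
      simp [hu]
    simp [this]
  rw [← lintegral_indicator_one hD]
  have hflux := lintegral_flux u hu hr ((Θ '' H).indicator 1) (measurable_one.indicator hD)
  have h1 : ∫⁻ y, (Θ '' H).indicator 1 y =
      ∫⁻ y in {y | ∃ t : ℝ, ‖y - t • u‖ < r}, (Θ '' H).indicator 1 y := by
    rw [← lintegral_indicator (isOpen_cylinder u r).measurableSet]
    refine lintegral_congr fun y => ?_
    by_cases hy : y ∈ Θ '' H
    · obtain ⟨p, hp, rfl⟩ := hy
      rw [indicator_of_mem (s := {y | ∃ t : ℝ, ‖y - t • u‖ < r})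
        (mem_cylinder_of_inner_pos u hr hp.2 p.1)]
    · rw [indicator_of_notMem hy, indicator_apply_eq_zero.2 fun _ => indicator_of_notMem hy _]
  rw [h1, ← hflux]
  calc ∫⁻ t : ℝ, ∫⁻ ν : S2, (Θ '' H).indicator 1 (t • u + r • (ν : E3)) *
        ENNReal.ofReal (r ^ 2 * max (inner ℝ u (ν : E3)) 0) ∂sphereMeasure
      ≤ ∫⁻ s : ℝ, (Icc τ t).indicator (fun _ => ∫⁻ ν : S2,
          ENNReal.ofReal (r ^ 2 * max (inner ℝ u (ν : E3)) 0) ∂sphereMeasure) s := by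
        refine lintegral_mono fun s => ?_
        by_cases hs : s ∈ Icc τ t
        · rw [indicator_of_mem hs]
          refine lintegral_mono fun ν => mul_le_of_le_one_left zero_le ?_
          exact indicator_apply_le' (fun _ => le_rfl) fun _ => zero_le
        -- Outside the time window the integrand vanishes: a point swept with positive flux has a
        -- unique sweeping time.
        · rw [indicator_of_notMem hs, nonpos_iff_eq_zero]
          refine (lintegral_congr fun ν => ?_).trans lintegral_zero
          by_cases hν : 0 < inner ℝ u (ν : E3)
          · rw [indicator_of_notMem, zero_mul]
            rintro ⟨p, hp, h⟩
            exact hs ((swept_injOn u hr hp.2 hν h).1 ▸ hp.1)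
          · rw [max_eq_right (not_lt.1 hν)]
            simp
    _ = _ := by
        rw [lintegral_indicator measurableSet_Icc, setLIntegral_const, Real.volume_Icc, mul_comm,
          ← lintegral_const_mul _ (by fun_prop)]
        refine lintegral_congr fun ν => ?_
        rw [ENNReal.ofReal_mul (by positivity), ENNReal.ofReal_mul (by positivity)]
        rw [mul_left_comm, mul_assoc]

/-! ### Collision integrals and collision rates -/

/-- A measurable and nonnegative version of the background density. -/
structure GasDensity (g : E3 → ℝ) : Prop where
  meas : Measurable g
  nonneg : ∀ v, 0 ≤ g v
  mass : ∫⁻ v, ENNReal.ofReal (g v) = 1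
  moment : ∫⁻ v, ENNReal.ofReal (g v * (1 + ‖v‖ ^ 2)) < ∞

/-- The flux factor `[(v - w) · ν]₊`. -/
def flux (v : E3) (ν : S2) (w : E3) : ℝ := max (inner ℝ (v - w) (ν : E3)) 0

theorem flux_nonneg (v : E3) (ν : S2) (w : E3) : 0 ≤ flux v ν w := le_max_right _ _

@[fun_prop]
theorem measurable_flux {α : Type*} [MeasurableSpace α] {a : α → E3} {b : α → S2} {c : α → E3}
    (ha : Measurable a) (hb : Measurable b) (hc : Measurable c) :
    Measurable fun x => flux (a x) (b x) (c x) := by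
  unfold flux
  fun_prop

/-- The product form separates the speed of the root from a factor controlled by the second moment
of the bath. -/
theorem flux_le (v : E3) (ν : S2) (w : E3) : flux v ν w ≤ (1 + ‖v‖) * (1 + ‖w‖ ^ 2) := by
  have h1 : inner ℝ (v - w) (ν : E3) ≤ ‖v‖ + ‖w‖ := by
    refine (real_inner_le_norm _ _).trans ?_
    rw [show ‖(ν : E3)‖ = 1 by simp, mul_one]
    exact norm_sub_le _ _
  have h2 := norm_nonneg v
  have h3 := norm_nonneg w
  refine max_le (h1.trans ?_) (by positivity)
  nlinarith [sq_nonneg (‖w‖ - 1), mul_nonneg h2 (sq_nonneg ‖w‖)]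

variable {g : E3 → ℝ}

/-- Integrals over the impact parameter and the background velocity of a collision at
velocity `v`. -/
def collisionIntegral (g : E3 → ℝ) (v : E3) (ψ : S2 → E3 → ℝ≥0∞) : ℝ≥0∞ :=
  ∫⁻ ν : S2, ∫⁻ w : E3, ENNReal.ofReal (g w) * ENNReal.ofReal (flux v ν w) * ψ ν w
    ∂volume ∂sphereMeasure

theorem collisionIntegral_le (hg : GasDensity g) (v : E3) :
    collisionIntegral g v (fun _ _ => 1) ≤ ENNReal.ofReal (1 + ‖v‖) *
      (sphereMeasure univ * ∫⁻ w, ENNReal.ofReal (g w * (1 + ‖w‖ ^ 2))) := by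
  have hm := hg.meas
  calc collisionIntegral g v (fun _ _ => 1)
      ≤ ∫⁻ _ν : S2, ∫⁻ w : E3, ENNReal.ofReal (1 + ‖v‖) * ENNReal.ofReal (g w * (1 + ‖w‖ ^ 2))
        ∂volume ∂sphereMeasure := by
        refine lintegral_mono fun ν => lintegral_mono fun w => ?_
        simp only [mul_one]
        rw [← ENNReal.ofReal_mul (hg.nonneg w), ← ENNReal.ofReal_mul (by positivity)]
        refine ENNReal.ofReal_le_ofReal ?_
        have := mul_le_mul_of_nonneg_left (flux_le v ν w) (hg.nonneg w)
        linarith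
    _ = _ := by
        rw [lintegral_const, lintegral_const_mul _ (by fun_prop)]
        ring

theorem collisionIntegral_one_lt_top (hg : GasDensity g) (v : E3) :
    collisionIntegral g v (fun _ _ => 1) < ∞ :=
  (collisionIntegral_le hg v).trans_lt (ENNReal.mul_lt_top ENNReal.ofReal_lt_top
    (ENNReal.mul_lt_top (measure_lt_top _ _) hg.moment))

theorem measurable_collisionIntegral (hg : Measurable g) {ψ : E3 → S2 → E3 → ℝ≥0∞}
    (hψ : Measurable fun p : E3 × S2 × E3 => ψ p.1 p.2.1 p.2.2) :
    Measurable fun v => collisionIntegral g v (ψ v) := by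
  have h1 : Measurable fun p : (E3 × S2) × E3 => ψ p.1.1 p.1.2 p.2 :=
    hψ.comp (by fun_prop : Measurable fun p : (E3 × S2) × E3 => (p.1.1, p.1.2, p.2))
  have h2 : Measurable fun p : E3 × S2 => ∫⁻ w : E3, ENNReal.ofReal (g w) *
      ENNReal.ofReal (flux p.1 p.2 w) * ψ p.1 p.2 w :=
    Measurable.lintegral_prod_right' (f := fun p : (E3 × S2) × E3 => ENNReal.ofReal (g p.2) *
      ENNReal.ofReal (flux p.1.1 p.1.2 p.2) * ψ p.1.1 p.1.2 p.2) (by fun_prop)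
  exact h2.lintegral_prod_right'

/-- The second moment makes both Bochner integrals in the rate finite, so they agree with the
extended nonnegative integral used from here on. -/
theorem collisionIntegral_eq_ofReal (hg : GasDensity g) (v : E3) :
    collisionIntegral g v (fun _ _ => 1) = ENNReal.ofReal (collisionRate g v) := by
  have hm := hg.meas
  have h1 : ∀ ν : S2, ∫⁻ w : E3, ENNReal.ofReal (g w) * ENNReal.ofReal (flux v ν w) * 1 =
      ENNReal.ofReal (∫ w : E3, g w * flux v ν w) := fun ν => by
    rw [integral_eq_lintegral_of_nonneg_ae
      (Filter.Eventually.of_forall fun w => mul_nonneg (hg.nonneg w) (flux_nonneg v ν w))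
      (by fun_prop), ENNReal.ofReal_toReal]
    · refine lintegral_congr fun w => ?_
      rw [mul_one, ENNReal.ofReal_mul (hg.nonneg w)]
    · refine ne_of_lt (lt_of_le_of_lt (b := ∫⁻ w, ENNReal.ofReal (1 + ‖v‖) *
        ENNReal.ofReal (g w * (1 + ‖w‖ ^ 2))) (lintegral_mono fun w => ?_) ?_)
      · rw [← ENNReal.ofReal_mul (by positivity)]
        refine ENNReal.ofReal_le_ofReal ?_
        have := mul_le_mul_of_nonneg_left (flux_le v ν w) (hg.nonneg w)
        linarith
      · rw [lintegral_const_mul _ (by fun_prop)]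
        exact ENNReal.mul_lt_top ENNReal.ofReal_lt_top hg.moment
  have h0 : collisionIntegral g v (fun _ _ => 1) =
      ∫⁻ ν : S2, ENNReal.ofReal (∫ w : E3, g w * flux v ν w) ∂sphereMeasure :=
    lintegral_congr h1
  have hpos : ∀ ν : S2, 0 ≤ ∫ w : E3, g w * flux v ν w := fun ν =>
    integral_nonneg fun w => mul_nonneg (hg.nonneg w) (flux_nonneg v ν w)
  have hsm : StronglyMeasurable fun ν : S2 => ∫ w : E3, g w * flux v ν w :=
    StronglyMeasurable.integral_prod_right' (f := fun p : S2 × E3 => g p.2 * flux v p.1 p.2)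
      (by fun_prop : Measurable fun p : S2 × E3 => g p.2 * flux v p.1 p.2).stronglyMeasurable
  have hrate : collisionRate g v = ∫ ν : S2, (∫ w : E3, g w * flux v ν w) ∂sphereMeasure := rfl
  rw [hrate, integral_eq_lintegral_of_nonneg_ae
    (Filter.Eventually.of_forall hpos) hsm.aestronglyMeasurable, ENNReal.ofReal_toReal]
  · exact h0
  · have := (collisionIntegral_one_lt_top hg v).ne
    rwa [h0] at this

theorem collisionRate_nonneg (hg : GasDensity g) (v : E3) : 0 ≤ collisionRate g v :=
  integral_nonneg fun ν => integral_nonneg fun w => mul_nonneg (hg.nonneg w) (flux_nonneg v ν w)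

theorem measurable_collisionRate (hg : GasDensity g) : Measurable (collisionRate g) := by
  have h : collisionRate g = fun v => (collisionIntegral g v fun _ _ => 1).toReal := by
    funext v
    rw [collisionIntegral_eq_ofReal hg, ENNReal.toReal_ofReal (collisionRate_nonneg hg v)]
  rw [h]
  exact (measurable_collisionIntegral hg.meas (ψ := fun _ _ _ => 1) measurable_const).ennreal_toReal

/-! ### Paths of the root -/

/-- Time of the last collision, `0` if there is none. -/
def lastTime : (n : ℕ) → (Fin n → Marker) → ℝ
  | 0, _ => 0
  | n + 1, m => (m (Fin.last n)).1

/-- The integrated collision rate along the path of the root up to time `t`. -/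
def pathRate (g : E3 → ℝ) (v₀ : E3) : (n : ℕ) → (Fin n → Marker) → ℝ → ℝ
  | 0, _, t => t * collisionRate g v₀
  | n + 1, m, t => pathRate g v₀ n (Fin.init m) (m (Fin.last n)).1 +
      (t - (m (Fin.last n)).1) * collisionRate g (finalVel v₀ (n + 1) m)

/-- The collision times are increasing and lie in `(0, t]`. -/
def Ordered : (n : ℕ) → (Fin n → Marker) → ℝ → Prop
  | 0, _, _ => True
  | n + 1, m, t => Ordered n (Fin.init m) (m (Fin.last n)).1 ∧
      lastTime n (Fin.init m) < (m (Fin.last n)).1 ∧ (m (Fin.last n)).1 ≤ t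

theorem rootPos_of_lastTime_le (z : E3 × E3) (n : ℕ) (m : Fin n → Marker) {s : ℝ}
    (hs : lastTime n m ≤ s) : rootPos z n m s =
      rootPos z n m (lastTime n m) + (s - lastTime n m) • finalVel z.2 n m := by
  cases n with
  | zero => simp [rootPos, lastTime, finalVel]
  | succ n =>
    simp only [lastTime] at hs ⊢
    rcases hs.eq_or_lt with rfl | h
    · simp
    · rw [rootPos, if_neg (not_le.2 h), rootPos, if_pos le_rfl]

theorem rootPos_init (z : E3 × E3) (n : ℕ) (m : Fin (n + 1) → Marker) {s : ℝ}
    (hs : s ≤ (m (Fin.last n)).1) : rootPos z (n + 1) m s = rootPos z n (Fin.init m) s := by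
  rw [rootPos, if_pos hs]

theorem continuous_rootPos (z : E3 × E3) (n : ℕ) (m : Fin n → Marker) :
    Continuous (rootPos z n m) := by
  induction n with
  | zero =>
    have h : rootPos z 0 m = fun s => z.1 + s • z.2 := by funext s; rw [rootPos]
    rw [h]
    fun_prop
  | succ n ih =>
    have h : rootPos z (n + 1) m = fun s => if s ≤ (m (Fin.last n)).1 then
        rootPos z n (Fin.init m) s else rootPos z n (Fin.init m) (m (Fin.last n)).1 +
          (s - (m (Fin.last n)).1) • finalVel z.2 (n + 1) m := by funext s; rw [rootPos]
    rw [h]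
    have := ih (Fin.init m)
    refine Continuous.if_le this (by fun_prop) continuous_id continuous_const fun s hs => ?_
    simp [show s = (m (Fin.last n)).1 from hs]

theorem Ordered.lastTime_nonneg {n : ℕ} {m : Fin n → Marker} {t : ℝ} (h : Ordered n m t) :
    0 ≤ lastTime n m := by
  induction n generalizing t with
  | zero => exact le_rfl
  | succ n ih => exact (ih h.1).trans h.2.1.le

theorem Ordered.mono {n : ℕ} {m : Fin n → Marker} {t t' : ℝ} (h : Ordered n m t) (ht : t ≤ t') :
    Ordered n m t' := by
  cases n with
  | zero => trivial
  | succ n => exact ⟨h.1, h.2.1, h.2.2.trans ht⟩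

theorem Ordered.of_lastTime_le {n : ℕ} {m : Fin n → Marker} {t t' : ℝ} (h : Ordered n m t)
    (ht : lastTime n m ≤ t') : Ordered n m t' := by
  cases n with
  | zero => trivial
  | succ n => exact ⟨h.1, h.2.1, ht⟩

theorem Ordered.lastTime_le {n : ℕ} {m : Fin n → Marker} {t : ℝ} (h : Ordered n m t)
    (ht : 0 ≤ t) : lastTime n m ≤ t := by
  cases n with
  | zero => exact ht
  | succ n => exact h.2.2

theorem pathRate_nonneg (hg : GasDensity g) (v₀ : E3) {n : ℕ} {m : Fin n → Marker} {t : ℝ}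
    (h : Ordered n m t) (ht : 0 ≤ t) : 0 ≤ pathRate g v₀ n m t := by
  induction n generalizing t with
  | zero => exact mul_nonneg ht (collisionRate_nonneg hg _)
  | succ n ih =>
    exact add_nonneg (ih h.1 (h.1.lastTime_nonneg.trans h.2.1.le))
      (mul_nonneg (sub_nonneg.2 h.2.2) (collisionRate_nonneg hg _))

theorem pathRate_eq_add (v₀ : E3) (n : ℕ) (m : Fin n → Marker) (t : ℝ) :
    pathRate g v₀ n m t = pathRate g v₀ n m (lastTime n m) +
      (t - lastTime n m) * collisionRate g (finalVel v₀ n m) := by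
  cases n with
  | zero => simp [pathRate, lastTime, finalVel]
  | succ n => simp [pathRate, lastTime]

/-! ### The region swept out by the root -/

/-- The initial data of background particles that come within distance `r` of the root. -/
def tube (z : E3 × E3) (n : ℕ) (m : Fin n → Marker) (r t : ℝ) : Set (E3 × E3) :=
  {q | ∃ s ∈ Icc 0 t, ∃ k, ‖rootPos z n m s - (q.1 + s • q.2 + latticeVec k)‖ < r}

/-- The strict inequality makes the uncountable union over times open, hence measurable. The closed
contact condition at distance ε is later covered by a radius slightly larger than ε. -/
theorem isOpen_tube (z : E3 × E3) (n : ℕ) (m : Fin n → Marker) (r t : ℝ) :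
    IsOpen (tube z n m r t) := by
  have : tube z n m r t = ⋃ s ∈ Icc 0 t, ⋃ k,
      {q : E3 × E3 | ‖rootPos z n m s - (q.1 + s • q.2 + latticeVec k)‖ < r} := by
    ext q; simp [tube]
  rw [this]
  exact isOpen_biUnion fun s _ => isOpen_iUnion fun k => isOpen_lt (by fun_prop) continuous_const

/-- The initial data of background particles that get into contact with the root during a free
flight. -/
def entered (a v : E3) (r τ t : ℝ) : Set (E3 × E3) :=
  {q | ∃ k, r ≤ ‖a - (q.1 + τ • q.2 + latticeVec k)‖ ∧
    ∃ s ∈ Icc τ t, ‖a + (s - τ) • v - (q.1 + s • q.2 + latticeVec k)‖ < r}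

theorem measurableSet_entered (a v : E3) (r τ t : ℝ) : MeasurableSet (entered a v r τ t) := by
  have : entered a v r τ t = ⋃ k, ({q : E3 × E3 | r ≤ ‖a - (q.1 + τ • q.2 + latticeVec k)‖} ∩
      ⋃ s ∈ Icc τ t, {q : E3 × E3 | ‖a + (s - τ) • v - (q.1 + s • q.2 + latticeVec k)‖ < r}) := by
    ext q; simp [entered]
  rw [this]
  refine MeasurableSet.iUnion fun k => MeasurableSet.inter ?_ (IsOpen.measurableSet ?_)
  · exact measurableSet_le measurable_const (by fun_prop)
  · exact isOpen_biUnion fun s _ => isOpen_lt (by fun_prop) continuous_const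

theorem bathLaw_apply (hg : Measurable g) {A : Set (E3 × E3)} (hA : MeasurableSet A) :
    bathLaw g A = ∫⁻ w, ENNReal.ofReal (g w) * volume.restrict unitCube {x | (x, w) ∈ A} := by
  rw [← lintegral_indicator_one hA, lintegral_bathLaw hg _ (measurable_one.indicator hA)]
  refine lintegral_congr fun w => ?_
  congr 1
  exact lintegral_indicator_one (μ := volume.restrict unitCube)
    (hA.preimage (measurable_prodMk_right (y := w)))

theorem isProbabilityMeasure_bathLaw (hg : GasDensity g) : IsProbabilityMeasure (bathLaw g) := by
  constructor
  rw [bathLaw_apply hg.meas MeasurableSet.univ]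
  simp [volume_unitCube, hg.mass]

/-- In the frame of a background particle of velocity w the ball around the root moves with velocity
v - w. `volume_entered_le` bounds the volume entered by a flux, whose average over w is the
collision rate. -/
theorem bathLaw_entered_le (hg : GasDensity g) (a v : E3) {r : ℝ} (hr : 0 < r) {τ t : ℝ}
    (hτ : τ ≤ t) : bathLaw g (entered a v r τ t) ≤
      ENNReal.ofReal (r ^ 2 * ((t - τ) * collisionRate g v)) := by
  have hm := hg.meas
  rw [bathLaw_apply hg.meas (measurableSet_entered a v r τ t)]
  calc ∫⁻ w, ENNReal.ofReal (g w) * volume.restrict unitCube {x | (x, w) ∈ entered a v r τ t}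
      ≤ ∫⁻ w, ENNReal.ofReal (g w) * ∫⁻ ν : S2, ENNReal.ofReal (r ^ 2 * (t - τ)) *
          ENNReal.ofReal (flux v ν w) ∂sphereMeasure := by
        refine lintegral_mono fun w => mul_le_mul_right ?_ _
        refine (measure_mono ?_).trans (volume_entered_le (a - τ • v) (v - w) hr τ t)
        rintro x ⟨k, h1, s, hs, h2⟩
        refine ⟨k, ?_, s, hs, ?_⟩
        · rw [show a - τ • v + τ • (v - w) - (x + latticeVec k) =
            a - (x + τ • w + latticeVec k) by rw [smul_sub]; abel]
          exact h1
        · rw [show a - τ • v + s • (v - w) - (x + latticeVec k) =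
            a + (s - τ) • v - (x + s • w + latticeVec k) by rw [smul_sub, sub_smul]; abel]
          exact h2
    _ = ENNReal.ofReal (r ^ 2 * (t - τ)) * collisionIntegral g v (fun _ _ => 1) := by
        rw [collisionIntegral, lintegral_lintegral_swap (by fun_prop),
          ← lintegral_const_mul _ (by fun_prop)]
        refine lintegral_congr fun w => ?_
        rw [← lintegral_const_mul _ (by fun_prop), ← lintegral_const_mul _ (by fun_prop)]
        refine lintegral_congr fun ν => ?_
        ring
    _ = _ := by
        rw [collisionIntegral_eq_ofReal hg, ← ENNReal.ofReal_mul
          (mul_nonneg (sq_nonneg r) (sub_nonneg.2 hτ)), mul_assoc]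

theorem bathLaw_ball_le (hg : GasDensity g) (a : E3) (r : ℝ) :
    bathLaw g {q | ∃ k, ‖a - (q.1 + latticeVec k)‖ < r} ≤ volume (Metric.ball (0 : E3) r) := by
  have hm := hg.meas
  have hA : MeasurableSet {q : E3 × E3 | ∃ k, ‖a - (q.1 + latticeVec k)‖ < r} := by
    rw [ofPred_exists]
    exact MeasurableSet.iUnion fun k => measurableSet_lt (by fun_prop) measurable_const
  rw [bathLaw_apply hg.meas hA]
  calc ∫⁻ w, ENNReal.ofReal (g w) * volume.restrict unitCube
        {x | (x, w) ∈ {q : E3 × E3 | ∃ k, ‖a - (q.1 + latticeVec k)‖ < r}}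
      ≤ ∫⁻ w, ENNReal.ofReal (g w) * volume (Metric.ball a r) := by
        refine lintegral_mono fun w => mul_le_mul_right ?_ _
        refine (measure_mono ?_).trans
          (volume_exists_add_latticeVec_le (Metric.ball a r) measurableSet_ball)
        rintro x ⟨k, h⟩
        exact ⟨k, by rwa [Metric.mem_ball, dist_comm, dist_eq_norm]⟩
    _ = _ := by
        rw [lintegral_mul_const _ (by fun_prop), hg.mass, one_mul, Measure.addHaar_ball_center]

/-- A particle meets the tube either because it starts within distance r or because it enters during
one of the free flights. Each flight contributes at most r² times its duration times the collision
rate, and the velocity jumps cost nothing because the path is continuous. -/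
theorem bathLaw_tube_le (hg : GasDensity g) (z : E3 × E3) {r : ℝ} (hr : 0 < r) {n : ℕ}
    {m : Fin n → Marker} {t : ℝ} (h : Ordered n m t) (ht : 0 ≤ t) :
    bathLaw g (tube z n m r t) ≤ volume (Metric.ball (0 : E3) r) +
      ENNReal.ofReal (r ^ 2 * pathRate g z.2 n m t) := by
  induction n generalizing t with
  | zero =>
    have hsub : tube z 0 m r t ⊆ {q | ∃ k, ‖z.1 - (q.1 + latticeVec k)‖ < r} ∪
        entered z.1 z.2 r 0 t := by
      rintro q ⟨s, hs, k, hk⟩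
      by_cases h0 : ‖z.1 - (q.1 + latticeVec k)‖ < r
      · exact Or.inl ⟨k, h0⟩
      · refine Or.inr ⟨k, by simpa using not_lt.1 h0, s, hs, ?_⟩
        simpa [rootPos] using hk
    refine (measure_mono hsub).trans ((measure_union_le _ _).trans
      (add_le_add (bathLaw_ball_le hg z.1 r) ((bathLaw_entered_le hg _ _ hr ht).trans ?_)))
    simp [pathRate]
  | succ n ih =>
    set τ := (m (Fin.last n)).1 with hτ
    have hτ0 : 0 ≤ τ := h.1.lastTime_nonneg.trans h.2.1.le
    have hτt : τ ≤ t := h.2.2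
    have hsub : tube z (n + 1) m r t ⊆ tube z n (Fin.init m) r τ ∪
        entered (rootPos z (n + 1) m τ) (finalVel z.2 (n + 1) m) r τ t := by
      rintro q ⟨s, hs, k, hk⟩
      rcases le_or_gt s τ with hsτ | hsτ
      · exact Or.inl ⟨s, ⟨hs.1, hsτ⟩, k, by rwa [← rootPos_init z n m hsτ]⟩
      by_cases h0 : ‖rootPos z (n + 1) m τ - (q.1 + τ • q.2 + latticeVec k)‖ < r
      · exact Or.inl ⟨τ, ⟨hτ0, le_rfl⟩, k, by rwa [← rootPos_init z n m le_rfl]⟩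
      · refine Or.inr ⟨k, not_lt.1 h0, s, ⟨hsτ.le, hs.2⟩, ?_⟩
        rwa [rootPos_of_lastTime_le z (n + 1) m (s := s) hsτ.le] at hk
    refine (measure_mono hsub).trans ((measure_union_le _ _).trans
      ((add_le_add (ih h.1 hτ0) (bathLaw_entered_le hg _ _ hr hτt)).trans ?_))
    rw [add_assoc, ← ENNReal.ofReal_add, ← mul_add]
    · rfl
    · exact mul_nonneg (sq_nonneg r) (pathRate_nonneg hg _ h.1 hτ0)
    · exact mul_nonneg (sq_nonneg r) (mul_nonneg (sub_nonneg.2 hτt) (collisionRate_nonneg hg _))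

/-! ### Measurability -/

theorem measurableSet_and {α : Type*} [MeasurableSpace α] {p q : α → Prop}
    (hp : MeasurableSet {x | p x}) (hq : MeasurableSet {x | q x}) :
    MeasurableSet {x | p x ∧ q x} := hp.inter hq

theorem measurableSet_forall {α κ : Type*} [MeasurableSpace α] [Countable κ] {p : κ → α → Prop}
    (hp : ∀ k, MeasurableSet {x | p k x}) : MeasurableSet {x | ∀ k, p k x} := by
  rw [ofPred_forall]
  exact MeasurableSet.iInter hp

theorem measurableSet_exists {α κ : Type*} [MeasurableSpace α] [Countable κ] {p : κ → α → Prop}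
    (hp : ∀ k, MeasurableSet {x | p k x}) : MeasurableSet {x | ∃ k, p k x} := by
  rw [ofPred_exists]
  exact MeasurableSet.iUnion hp

/-- On a compact set a positive continuous function has a positive lower bound 1/(r+1), and such a
bound needs checking only on a countable dense subset. -/
theorem measurableSet_forall_pos {α : Type*} [MeasurableSpace α] {K : Set ℝ} (hK : IsCompact K)
    {h : α → ℝ → ℝ} (hm : ∀ s, Measurable fun x => h x s) (hc : ∀ x, Continuous (h x)) :
    MeasurableSet {x | ∀ s ∈ K, 0 < h x s} := by
  obtain ⟨c, hcK, hcc, hcl⟩ := hK.isSeparable.exists_countable_dense_subset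
  have : {x | ∀ s ∈ K, 0 < h x s} = ⋃ r : ℕ, ⋂ s ∈ c, {x | (1 : ℝ) / (r + 1) ≤ h x s} := by
    ext x
    simp only [mem_ofPred_eq, mem_iUnion, mem_iInter]
    constructor
    · intro hx
      rcases K.eq_empty_or_nonempty with rfl | hne
      · exact ⟨0, fun s hs => absurd (hcK hs) (notMem_empty s)⟩
      · obtain ⟨s₀, hs₀, hmin⟩ := hK.exists_isMinOn hne (hc x).continuousOn
        obtain ⟨r, hr⟩ := exists_nat_one_div_lt (hx s₀ hs₀)
        exact ⟨r, fun s hs => hr.le.trans (hmin (hcK hs))⟩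
    · rintro ⟨r, hr⟩ s hs
      have hcls : IsClosed {s | (1 : ℝ) / (r + 1) ≤ h x s} := isClosed_le continuous_const (hc x)
      have : s ∈ {s | (1 : ℝ) / (r + 1) ≤ h x s} :=
        closure_minimal (fun s hs => hr s hs) hcls (hcl hs)
      exact lt_of_lt_of_le (by positivity) this
  rw [this]
  exact MeasurableSet.iUnion fun r => MeasurableSet.biInter hcc fun s _ =>
    measurableSet_le measurable_const (hm s)

/-- The open constraint φ > 0 is exhausted by the closed constraints φ ≥ 1/(p+1). Each of these
implications is the positivity of a maximum of continuous functions. -/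
theorem measurableSet_forall_imp_pos {α : Type*} [MeasurableSpace α] {K : Set ℝ} (hK : IsCompact K)
    {φ h : α → ℝ → ℝ} (hφm : ∀ s, Measurable fun x => φ x s) (hφc : ∀ x, Continuous (φ x))
    (hm : ∀ s, Measurable fun x => h x s) (hc : ∀ x, Continuous (h x)) :
    MeasurableSet {x | ∀ s ∈ K, 0 < φ x s → 0 < h x s} := by
  have : {x | ∀ s ∈ K, 0 < φ x s → 0 < h x s} =
      ⋂ p : ℕ, {x | ∀ s ∈ K, 0 < max ((1 : ℝ) / (p + 1) - φ x s) (h x s)} := by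
    ext x
    simp only [mem_ofPred_eq, mem_iInter]
    constructor
    · intro hx p s hs
      rcases lt_or_ge (φ x s) ((1 : ℝ) / (p + 1)) with h1 | h1
      · exact lt_max_of_lt_left (sub_pos.2 h1)
      · exact lt_max_of_lt_right (hx s hs (lt_of_lt_of_le (by positivity) h1))
    · intro hx s hs hpos
      obtain ⟨p, hp⟩ := exists_nat_one_div_lt hpos
      rcases lt_max_iff.1 (hx p s hs) with h1 | h1
      · linarith
      · exact h1
  rw [this]
  refine MeasurableSet.iInter fun p => measurableSet_forall_pos hK (fun s => ?_) fun x => ?_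
  · exact (measurable_const.sub (hφm s)).max (hm s)
  · exact (continuous_const.sub (hφc x)).max (hc x)

theorem measurableSet_forall_nonneg_imp_pos {α : Type*} [MeasurableSpace α]
    {φ h : α → ℝ → ℝ} (hφm : ∀ s, Measurable fun x => φ x s) (hφc : ∀ x, Continuous (φ x))
    (hm : ∀ s, Measurable fun x => h x s) (hc : ∀ x, Continuous (h x)) :
    MeasurableSet {x | ∀ s, 0 ≤ s → 0 < φ x s → 0 < h x s} := by
  have : {x | ∀ s, 0 ≤ s → 0 < φ x s → 0 < h x s} =
      ⋂ p : ℕ, {x | ∀ s ∈ Icc (0 : ℝ) p, 0 < φ x s → 0 < h x s} := by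
    ext x
    simp only [mem_ofPred_eq, mem_iInter]
    refine ⟨fun hx p s hs => hx s hs.1, fun hx s hs => ?_⟩
    obtain ⟨p, hp⟩ := exists_nat_ge s
    exact hx p s ⟨hs, hp⟩
  rw [this]
  exact MeasurableSet.iInter fun p => measurableSet_forall_imp_pos isCompact_Icc hφm hφc hm hc

section
variable {α : Type*} [MeasurableSpace α]

@[fun_prop]
theorem measurable_init {n : ℕ} {b : α → Fin (n + 1) → Marker} (hb : Measurable b) :
    Measurable fun x => (Fin.init (b x) : Fin n → Marker) :=
  measurable_pi_lambda _ fun i => (measurable_pi_apply i.castSucc).comp hb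

@[fun_prop]
theorem measurable_snoc {n : ℕ} {b : α → Fin n → Marker} {c : α → Marker} (hb : Measurable b)
    (hc : Measurable c) : Measurable fun x => (Fin.snoc (b x) (c x) : Fin (n + 1) → Marker) := by
  refine measurable_pi_lambda _ fun i => ?_
  refine Fin.lastCases ?_ (fun i => ?_) i
  · simpa using hc
  · simp only [Fin.snoc_castSucc]
    fun_prop

@[fun_prop]
theorem measurable_collide {a : α → E3} {b : α → S2} {c : α → E3}
    (ha : Measurable a) (hb : Measurable b) (hc : Measurable c) :
    Measurable fun x => collide (a x) (b x) (c x) := by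
  unfold collide
  fun_prop

@[fun_prop]
theorem measurable_finalVel {a : α → E3} (ha : Measurable a) {n : ℕ} {b : α → Fin n → Marker}
    (hb : Measurable b) : Measurable fun x => finalVel (a x) n (b x) := by
  induction n with
  | zero => simpa only [finalVel] using ha
  | succ n ih =>
    simp only [finalVel]
    have := ih (measurable_init hb)
    fun_prop

@[fun_prop]
theorem measurable_lastTime {n : ℕ} {b : α → Fin n → Marker} (hb : Measurable b) :
    Measurable fun x => lastTime n (b x) := by
  cases n with
  | zero => simp only [lastTime]; fun_prop
  | succ n => simp only [lastTime]; fun_prop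

@[fun_prop]
theorem measurable_rootPos {a : α → E3 × E3} (ha : Measurable a) {n : ℕ} {b : α → Fin n → Marker}
    (hb : Measurable b) {c : α → ℝ} (hc : Measurable c) :
    Measurable fun x => rootPos (a x) n (b x) (c x) := by
  induction n generalizing c with
  | zero => simp only [rootPos]; fun_prop
  | succ n ih =>
    simp only [rootPos]
    refine Measurable.ite (measurableSet_le hc (by fun_prop)) (ih (measurable_init hb) hc) ?_
    have := ih (measurable_init hb) (c := fun x => (b x (Fin.last n)).1) (by fun_prop)
    fun_prop

theorem measurableSet_ordered {n : ℕ} {b : α → Fin n → Marker} (hb : Measurable b) {c : α → ℝ}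
    (hc : Measurable c) : MeasurableSet {x | Ordered n (b x) (c x)} := by
  induction n generalizing c with
  | zero => simp only [Ordered]; exact MeasurableSet.univ
  | succ n ih =>
    simp only [Ordered]
    exact measurableSet_and (ih (measurable_init hb) (by fun_prop))
      (measurableSet_and (measurableSet_lt (by fun_prop) (by fun_prop))
        (measurableSet_le (by fun_prop) hc))

end

/-! ### Integration over the last marker -/

/-- Lebesgue measure on lists of `n` markers. -/
def markersMeasure (n : ℕ) : Measure (Fin n → Marker) := Measure.pi fun _ => markerMeasure

instance (n : ℕ) : SigmaFinite (markersMeasure n) := by unfold markersMeasure; infer_instance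

theorem measurePreserving_snoc (n : ℕ) :
    MeasurePreserving (fun p : Marker × (Fin n → Marker) =>
      (Fin.snoc p.2 p.1 : Fin (n + 1) → Marker)) (markerMeasure.prod (markersMeasure n))
      (markersMeasure (n + 1)) := by
  have h := (measurePreserving_piFinSuccAbove (fun _ : Fin (n + 1) => markerMeasure)
    (Fin.last n)).symm
  have he : (fun p : Marker × (Fin n → Marker) => (Fin.snoc p.2 p.1 : Fin (n + 1) → Marker)) =
      (MeasurableEquiv.piFinSuccAbove (fun _ : Fin (n + 1) => Marker) (Fin.last n)).symm := by
    funext p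
    simp [MeasurableEquiv.piFinSuccAbove, Fin.insertNthEquiv]
  rw [he]
  exact h

theorem lintegral_snoc {n : ℕ} (h : (Fin (n + 1) → Marker) → ℝ≥0∞) (hh : Measurable h) :
    ∫⁻ m, h m ∂markersMeasure (n + 1) =
      ∫⁻ m, ∫⁻ x, h (Fin.snoc m x) ∂markerMeasure ∂markersMeasure n := by
  rw [← (measurePreserving_snoc n).lintegral_comp hh, lintegral_prod_symm _ (by fun_prop)]

/-! ### Placing the colliding particles -/

/-- The initial phase point of the background particle of a collision. -/
def partner (ε : ℝ) (z : E3 × E3) (n : ℕ) (m : Fin n → Marker) (x : Marker) : E3 × E3 :=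
  (frac (rootPos z n m x.1 + ε • (x.2.1 : E3) - x.1 • x.2.2), x.2.2)

/-- Replace the phase points of the particles `ι i` by those that realize the collisions `m`. -/
def insertPartners (ε : ℝ) (z : E3 × E3) {N : ℕ} :
    (n : ℕ) → (Fin n → Fin N) → (Fin n → Marker) → (Fin N → E3 × E3) → Fin N → E3 × E3
  | 0, _, _, ω => ω
  | n + 1, ι, m, ω => insertPartners ε z n (Fin.init ι) (Fin.init m)
      (Function.update ω (ι (Fin.last n)) (partner ε z n (Fin.init m) (m (Fin.last n))))

/-- The product of the collision densities `g₀(w) [(v - w) · ν]₊`. -/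
def collisionWeight (g : E3 → ℝ) (v₀ : E3) : (n : ℕ) → (Fin n → Marker) → ℝ≥0∞
  | 0, _ => 1
  | n + 1, m => collisionWeight g v₀ n (Fin.init m) *
      (ENNReal.ofReal (g (m (Fin.last n)).2.2) * ENNReal.ofReal
        (flux (finalVel v₀ n (Fin.init m)) (m (Fin.last n)).2.1 (m (Fin.last n)).2.2))

/-- No colliding particle is in contact with the root before its collision. -/
def NoEarlierContact (ε : ℝ) (z : E3 × E3) : (n : ℕ) → (Fin n → Marker) → Prop
  | 0, _ => True
  | n + 1, m => NoEarlierContact ε z n (Fin.init m) ∧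
      ∀ s, 0 ≤ s → 0 < (m (Fin.last n)).1 - s → ∀ k,
        0 < ‖rootPos z n (Fin.init m) s - (rootPos z n (Fin.init m) (m (Fin.last n)).1 +
          ε • ((m (Fin.last n)).2.1 : E3) + (s - (m (Fin.last n)).1) • (m (Fin.last n)).2.2 +
            latticeVec k)‖ - ε

section
variable {α : Type*} [MeasurableSpace α]

theorem measurable_insertPartners (ε : ℝ) {N : ℕ} (n : ℕ) (ι : Fin n → Fin N)
    {a : α → E3 × E3} (ha : Measurable a) {b : α → Fin n → Marker} (hb : Measurable b)
    {c : α → Fin N → E3 × E3} (hc : Measurable c) :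
    Measurable fun x => insertPartners ε (a x) n ι (b x) (c x) := by
  induction n generalizing c with
  | zero => simpa only [insertPartners] using hc
  | succ n ih =>
    simp only [insertPartners]
    refine ih (Fin.init ι) (measurable_init hb) (measurable_pi_lambda _ fun j => ?_)
    by_cases hj : j = ι (Fin.last n)
    · subst hj
      simp only [Function.update_self, partner]
      have := measurable_frac
      fun_prop
    · simp only [Function.update_of_ne hj]
      fun_prop

theorem measurable_collisionWeight {g : E3 → ℝ} (hg : Measurable g) {n : ℕ}
    {a : α → E3} (ha : Measurable a) {b : α → Fin n → Marker} (hb : Measurable b) :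
    Measurable fun x => collisionWeight g (a x) n (b x) := by
  induction n with
  | zero => simp only [collisionWeight]; fun_prop
  | succ n ih =>
    simp only [collisionWeight]
    have := ih (measurable_init hb)
    fun_prop

theorem measurableSet_noEarlierContact (ε : ℝ) {n : ℕ} {a : α → E3 × E3} (ha : Measurable a)
    {b : α → Fin n → Marker} (hb : Measurable b) :
    MeasurableSet {x | NoEarlierContact ε (a x) n (b x)} := by
  induction n with
  | zero => simp only [NoEarlierContact]; exact MeasurableSet.univ
  | succ n ih =>
    simp only [NoEarlierContact]
    refine measurableSet_and (ih (measurable_init hb)) ?_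
    have h : ∀ x, (∀ s, 0 ≤ s → 0 < (b x (Fin.last n)).1 - s → ∀ k,
        0 < ‖rootPos (a x) n (Fin.init (b x)) s - (rootPos (a x) n (Fin.init (b x))
          (b x (Fin.last n)).1 + ε • ((b x (Fin.last n)).2.1 : E3) +
            (s - (b x (Fin.last n)).1) • (b x (Fin.last n)).2.2 + latticeVec k)‖ - ε) ↔
        ∀ k, ∀ s, 0 ≤ s → 0 < (b x (Fin.last n)).1 - s →
        0 < ‖rootPos (a x) n (Fin.init (b x)) s - (rootPos (a x) n (Fin.init (b x))
          (b x (Fin.last n)).1 + ε • ((b x (Fin.last n)).2.1 : E3) +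
            (s - (b x (Fin.last n)).1) • (b x (Fin.last n)).2.2 + latticeVec k)‖ - ε :=
      fun x => ⟨fun h k s h0 h1 => h s h0 h1 k, fun h s h0 h1 k => h k s h0 h1⟩
    simp only [h]
    refine measurableSet_forall fun k =>
      measurableSet_forall_nonneg_imp_pos (fun s => ?_) (fun x => ?_) (fun s => ?_) fun x => ?_
    · fun_prop
    · fun_prop
    · fun_prop
    · have := continuous_rootPos (a x) n (Fin.init (b x))
      fun_prop

end

/-- Resampling one coordinate independently preserves a product law, since the discarded coordinate
has total mass one. -/
theorem measurePreserving_update {X : Type*} [MeasurableSpace X] (μ : Measure X)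
    [IsProbabilityMeasure μ] {N : ℕ} (j : Fin N) :
    MeasurePreserving (fun p : (Fin N → X) × X => Function.update p.1 j p.2)
      ((Measure.pi fun _ => μ).prod μ) (Measure.pi fun _ => μ) := by
  have hm : Measurable fun p : (Fin N → X) × X => Function.update p.1 j p.2 := by
    refine measurable_pi_lambda _ fun i => ?_
    by_cases hi : i = j
    · subst hi; simpa using measurable_snd
    · simp only [Function.update_of_ne hi]; fun_prop
  refine ⟨hm, (Measure.pi_eq fun s hs => ?_).symm⟩
  rw [Measure.map_apply hm (MeasurableSet.univ_pi hs)]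
  have h1 : (fun p : (Fin N → X) × X => Function.update p.1 j p.2) ⁻¹' (univ.pi s) =
      (univ.pi (Function.update s j univ)) ×ˢ s j := by
    ext p
    simp only [mem_preimage, mem_univ_pi, mem_prod]
    constructor
    · intro h
      refine ⟨fun i => ?_, by simpa using h j⟩
      by_cases hi : i = j
      · subst hi; simp
      · simpa [Function.update_of_ne hi] using h i
    · rintro ⟨h, hj⟩ i
      by_cases hi : i = j
      · subst hi; simpa using hj
      · simpa [Function.update_of_ne hi] using h i
  rw [h1, Measure.prod_prod, Measure.pi_pi, ← Finset.prod_erase_mul _ _ (Finset.mem_univ j),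
    ← Finset.prod_erase_mul (Finset.univ) (fun i => μ (s i)) (Finset.mem_univ j)]
  simp only [Function.update_self, measure_univ, mul_one]
  congr 1
  refine Finset.prod_congr rfl fun i hi => ?_
  rw [Function.update_of_ne (Finset.ne_of_mem_erase hi)]

theorem lintegral_update_pi {X : Type*} [MeasurableSpace X] (μ : Measure X)
    [IsProbabilityMeasure μ] {N : ℕ} (j : Fin N) (F : (Fin N → X) → ℝ≥0∞) (hF : Measurable F) :
    ∫⁻ ω, ∫⁻ q, F (Function.update ω j q) ∂μ ∂(Measure.pi fun _ => μ) =
      ∫⁻ ω, F ω ∂(Measure.pi fun _ => μ) := by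
  have h := measurePreserving_update μ j
  have hm : Measurable fun p : (Fin N → X) × X => F (Function.update p.1 j p.2) :=
    hF.comp h.measurable
  rw [← h.lintegral_comp hF, lintegral_prod _ hm.aemeasurable]

theorem eq_add_latticeVec_of_frac_eq {y y' : E3} (h : frac y = frac y') :
    ∃ k, y = y' + latticeVec k := by
  refine ⟨floorVec y - floorVec y', ?_⟩
  rw [latticeVec_sub]
  simp only [frac] at h
  rw [← sub_eq_zero] at h ⊢
  rw [← h]
  abel

theorem collisionWeight_ne_top (g : E3 → ℝ) (v₀ : E3) (n : ℕ) (m : Fin n → Marker) :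
    collisionWeight g v₀ n m ≠ ∞ := by
  induction n with
  | zero => exact ENNReal.one_ne_top
  | succ n ih =>
    exact ENNReal.mul_ne_top (ih _) (ENNReal.mul_ne_top ENNReal.ofReal_ne_top ENNReal.ofReal_ne_top)

/-- The markers that can follow `m` without an earlier contact of the new particle. -/
def nextMarkers (ε : ℝ) (z : E3 × E3) (n : ℕ) (m : Fin n → Marker) : Set Marker :=
  {x | lastTime n m < x.1 ∧ ∀ s, 0 ≤ s → 0 < x.1 - s → ∀ k,
    0 < ‖rootPos z n m s - (rootPos z n m x.1 + ε • (x.2.1 : E3) + (s - x.1) • x.2.2 +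
      latticeVec k)‖ - ε}

theorem measurableSet_nextMarkers (ε : ℝ) (z : E3 × E3) (n : ℕ) (m : Fin n → Marker) :
    MeasurableSet (nextMarkers ε z n m) := by
  refine measurableSet_and (measurableSet_lt measurable_const (by fun_prop)) ?_
  have h : ∀ x : Marker, (∀ s, 0 ≤ s → 0 < x.1 - s → ∀ k,
      0 < ‖rootPos z n m s - (rootPos z n m x.1 + ε • (x.2.1 : E3) + (s - x.1) • x.2.2 +
        latticeVec k)‖ - ε) ↔ ∀ k, ∀ s, 0 ≤ s → 0 < x.1 - s →
      0 < ‖rootPos z n m s - (rootPos z n m x.1 + ε • (x.2.1 : E3) + (s - x.1) • x.2.2 +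
        latticeVec k)‖ - ε :=
    fun x => ⟨fun h k s h0 h1 => h s h0 h1 k, fun h s h0 h1 k => h k s h0 h1⟩
  simp only [h]
  refine measurableSet_forall fun k =>
    measurableSet_forall_nonneg_imp_pos (fun s => ?_) (fun x => ?_) (fun s => ?_) fun x => ?_
  · fun_prop
  · fun_prop
  · fun_prop
  · have := continuous_rootPos z n m
    fun_prop

/-- After its last collision the root moves on a straight line. Extrapolating it back to time zero
brings the partner's position into the form required by the flux formula. -/
theorem partner_eq (ε : ℝ) (z : E3 × E3) (n : ℕ) (m : Fin n → Marker) {x : Marker}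
    (hx : lastTime n m ≤ x.1) : partner ε z n m x =
      (frac ((rootPos z n m (lastTime n m) - lastTime n m • finalVel z.2 n m) +
        x.1 • (finalVel z.2 n m - x.2.2) + ε • (x.2.1 : E3)), x.2.2) := by
  rw [partner, rootPos_of_lastTime_le z n m hx]
  congr 2
  rw [sub_smul, smul_sub]
  abel

/-- For fixed velocity the partner's initial position determines the marker. If two markers with
different times gave the same position, the partner of the later one would already touch the root at
the earlier time, against the definition of `nextMarkers`. At equal times the two contact points
differ by a lattice vector of length at most 2ε < 1, hence coincide. -/
theorem lintegral_insertPartner_le {g : E3 → ℝ} (hg : GasDensity g) {ε : ℝ} (hε : 0 < ε)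
    (hε2 : ε < 1 / 2) (z : E3 × E3) (n : ℕ) (m : Fin n → Marker) (h0 : 0 ≤ lastTime n m)
    (F : E3 × E3 → ℝ≥0∞) (hF : Measurable F) :
    ∫⁻ x in nextMarkers ε z n m, ENNReal.ofReal (ε ^ 2) * (ENNReal.ofReal (g x.2.2) *
      ENNReal.ofReal (flux (finalVel z.2 n m) x.2.1 x.2.2)) * F (partner ε z n m x)
        ∂markerMeasure ≤ ∫⁻ q, F q ∂bathLaw g := by
  refine le_trans (le_of_eq ?_) (setLIntegral_collision_le hg.meas
    (rootPos z n m (lastTime n m) - lastTime n m • finalVel z.2 n m) (finalVel z.2 n m) hε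
      (measurableSet_nextMarkers ε z n m) ?_ F hF)
  · refine setLIntegral_congr_fun (measurableSet_nextMarkers ε z n m) fun x hx => ?_
    rw [partner_eq ε z n m hx.1.le, ENNReal.ofReal_mul (sq_nonneg ε), flux]
    ring
  · have key : ∀ x ∈ nextMarkers ε z n m, ∀ x' ∈ nextMarkers ε z n m, x.2.2 = x'.2.2 →
        frac (rootPos z n m x.1 + ε • (x.2.1 : E3) - x.1 • x.2.2) =
          frac (rootPos z n m x'.1 + ε • (x'.2.1 : E3) - x'.1 • x'.2.2) → ¬ x.1 < x'.1 := by
      intro x hx x' hx' hw hfr hlt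
      obtain ⟨k, hk⟩ := eq_add_latticeVec_of_frac_eq hfr
      have h1 := hx'.2 x.1 (h0.trans hx.1.le) (sub_pos.2 hlt) k
      have h2 : rootPos z n m x.1 - (rootPos z n m x'.1 + ε • (x'.2.1 : E3) +
          (x.1 - x'.1) • x'.2.2 + latticeVec k) = -(ε • (x.2.1 : E3)) := by
        rw [← hw] at hk ⊢
        have h3 : rootPos z n m x.1 = rootPos z n m x'.1 + ε • (x'.2.1 : E3) - x'.1 • x.2.2 +
          latticeVec k - ε • (x.2.1 : E3) + x.1 • x.2.2 := by rw [← hk]; abel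
        rw [h3, sub_smul]
        abel
      rw [h2, norm_neg, norm_smul, Real.norm_of_nonneg hε.le] at h1
      simp at h1
    intro x hx x' hx' hw hfr
    have hp := partner_eq ε z n m hx.1.le
    have hp' := partner_eq ε z n m hx'.1.le
    have hfr' : frac (rootPos z n m x.1 + ε • (x.2.1 : E3) - x.1 • x.2.2) =
        frac (rootPos z n m x'.1 + ε • (x'.2.1 : E3) - x'.1 • x'.2.2) := by
      have h1 := congrArg Prod.fst hp
      have h2 := congrArg Prod.fst hp'
      simp only [partner] at h1 h2
      rw [h1, h2, hfr]
    have ht : x.1 = x'.1 := le_antisymm (not_lt.1 (key x' hx' x hx hw.symm hfr'.symm))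
      (not_lt.1 (key x hx x' hx' hw hfr'))
    refine ⟨ht, ?_⟩
    obtain ⟨k, hk⟩ := eq_add_latticeVec_of_frac_eq hfr'
    rw [ht, hw] at hk
    have h3 : ε • (x.2.1 : E3) - ε • (x'.2.1 : E3) = latticeVec k := by
      rw [sub_eq_iff_eq_add, ← add_right_inj (rootPos z n m x'.1),
        ← sub_left_inj (a := x'.1 • x'.2.2), hk]
      abel
    have hk0 : k = 0 := by
      by_contra hk0
      have h4 := one_le_norm_latticeVec hk0
      rw [← h3] at h4
      have h5 := h4.trans (norm_sub_le _ _)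
      rw [norm_smul, norm_smul, Real.norm_of_nonneg hε.le] at h5
      simp at h5
      linarith
    rw [hk0, latticeVec_zero, sub_eq_zero] at h3
    exact Subtype.ext (smul_right_injective E3 hε.ne' h3)

/-- The same bound with the remaining bath particles as parameters, by Tonelli. -/
theorem lintegral_insertPartner_prod_le {g : E3 → ℝ} (hg : GasDensity g) {ε : ℝ} (hε : 0 < ε)
    (hε2 : ε < 1 / 2) (z : E3 × E3) (n : ℕ) (m : Fin n → Marker) (h0 : 0 ≤ lastTime n m)
    {Ω : Type*} [MeasurableSpace Ω] (P : Measure Ω) [SFinite P]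
    (H : Ω × (E3 × E3) → ℝ≥0∞) (hH : Measurable H) :
    ∫⁻ x in nextMarkers ε z n m, ENNReal.ofReal (ε ^ 2) * (ENNReal.ofReal (g x.2.2) *
      ENNReal.ofReal (flux (finalVel z.2 n m) x.2.1 x.2.2)) *
        ∫⁻ ω, H (ω, partner ε z n m x) ∂P ∂markerMeasure ≤ ∫⁻ ω, ∫⁻ q, H (ω, q) ∂bathLaw g ∂P := by
  have hm := hg.meas
  have hpm : Measurable (partner ε z n m) := by
    have := measurable_frac
    unfold partner
    fun_prop
  have h1 : ∀ x : Marker, ENNReal.ofReal (ε ^ 2) * (ENNReal.ofReal (g x.2.2) *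
      ENNReal.ofReal (flux (finalVel z.2 n m) x.2.1 x.2.2)) * ∫⁻ ω, H (ω, partner ε z n m x) ∂P =
      ∫⁻ ω, ENNReal.ofReal (ε ^ 2) * (ENNReal.ofReal (g x.2.2) *
        ENNReal.ofReal (flux (finalVel z.2 n m) x.2.1 x.2.2)) * H (ω, partner ε z n m x) ∂P :=
    fun x => by rw [lintegral_const_mul _ (by fun_prop)]
  simp_rw [h1]
  rw [lintegral_lintegral_swap (by fun_prop)]
  exact lintegral_mono fun ω => lintegral_insertPartner_le hg hε hε2 z n m h0
    (fun q => H (ω, q)) (by fun_prop)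

/-- Trees whose colliding particles have no earlier contact are realized with at least the product
of the collision densities. -/
theorem setLIntegral_insertPartners_le {g : E3 → ℝ} (hg : GasDensity g) {ε : ℝ} (hε : 0 < ε)
    (hε2 : ε < 1 / 2) (z : E3 × E3) {N : ℕ} (n : ℕ) (ι : Fin n → Fin N) (T : ℝ)
    (F : (Fin N → E3 × E3) → ℝ≥0∞) (hF : Measurable F) :
    ∫⁻ m in {m | Ordered n m T ∧ NoEarlierContact ε z n m},
      ENNReal.ofReal (ε ^ 2) ^ n * collisionWeight g z.2 n m *
        ∫⁻ ω, F (insertPartners ε z n ι m ω) ∂(Measure.pi fun _ => bathLaw g)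
          ∂markersMeasure n ≤ ∫⁻ ω, F ω ∂(Measure.pi fun _ => bathLaw g) := by
  have := isProbabilityMeasure_bathLaw hg
  have hm := hg.meas
  have hHm : ∀ n, MeasurableSet {m : Fin n → Marker | Ordered n m T ∧ NoEarlierContact ε z n m} :=
    fun n => measurableSet_and (measurableSet_ordered measurable_id measurable_const)
      (measurableSet_noEarlierContact ε measurable_const measurable_id)
  have hIm : ∀ (n : ℕ) (ι : Fin n → Fin N), Measurable fun m : Fin n → Marker =>
      ENNReal.ofReal (ε ^ 2) ^ n * collisionWeight g z.2 n m *
        ∫⁻ ω, F (insertPartners ε z n ι m ω) ∂(Measure.pi fun _ => bathLaw g) := fun n ι => by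
    refine (measurable_const.mul (measurable_collisionWeight hm measurable_const
      measurable_id)).mul ?_
    exact Measurable.lintegral_prod_right' (f := fun p : (Fin n → Marker) × (Fin N → E3 × E3) =>
      F (insertPartners ε z n ι p.1 p.2)) (hF.comp
        (measurable_insertPartners ε n ι measurable_const measurable_fst measurable_snd))
  induction n with
  | zero =>
    refine (setLIntegral_le_lintegral _ _).trans (le_of_eq ?_)
    rw [markersMeasure, lintegral_unique]
    simp [insertPartners, collisionWeight]
  | succ n ih =>
    refine le_trans ?_ (ih (Fin.init ι))
    rw [← lintegral_indicator (hHm _), ← lintegral_indicator (hHm _),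
      lintegral_snoc _ ((hIm _ _).indicator (hHm _))]
    refine lintegral_mono fun m => ?_
    by_cases hmH : Ordered n m T ∧ NoEarlierContact ε z n m
    swap
    · rw [indicator_of_notMem (s := {m | Ordered n m T ∧ NoEarlierContact ε z n m}) hmH,
        nonpos_iff_eq_zero]
      refine (lintegral_congr fun x => ?_).trans lintegral_zero
      refine indicator_of_notMem (fun h => hmH ?_) _
      obtain ⟨h1, h2⟩ := h
      simp only [Ordered, NoEarlierContact, Fin.init_snoc] at h1 h2
      exact ⟨h1.1.mono h1.2.2, h2.1⟩
    rw [indicator_of_mem (s := {m | Ordered n m T ∧ NoEarlierContact ε z n m}) hmH]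
    have hF2 : Measurable fun p : (Fin N → E3 × E3) × (E3 × E3) => F (insertPartners ε z n
        (Fin.init ι) m (Function.update p.1 (ι (Fin.last n)) p.2)) :=
      hF.comp (measurable_insertPartners ε n _ measurable_const measurable_const
        (measurePreserving_update (bathLaw g) (ι (Fin.last n))).measurable)
    -- For fixed first `n` markers the integral over the last one is dominated by an independent
    -- bath sample in slot `ι (Fin.last n)`, and resampling a slot does not change the product law.
    have hstep := lintegral_insertPartner_prod_le hg hε hε2 z n m hmH.1.lastTime_nonneg
      (Measure.pi fun _ : Fin N => bathLaw g) _ hF2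
    have hupd := lintegral_update_pi (bathLaw g) (ι (Fin.last n))
      (fun ω => F (insertPartners ε z n (Fin.init ι) m ω))
      (hF.comp (measurable_insertPartners ε n _ measurable_const measurable_const measurable_id))
    simp only at hstep hupd
    rw [hupd] at hstep
    refine le_trans ?_ (mul_le_mul_right hstep _)
    rw [← lintegral_const_mul' _ _ (ENNReal.mul_ne_top (ENNReal.pow_ne_top ENNReal.ofReal_ne_top)
      (collisionWeight_ne_top g z.2 n m))]
    rw [← lintegral_indicator (measurableSet_nextMarkers ε z n m)]
    refine lintegral_mono fun x => ?_
    refine indicator_apply_le' (fun h => ?_) fun _ => zero_le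
    obtain ⟨h1, h2⟩ := h
    simp only [Ordered, NoEarlierContact, Fin.init_snoc, Fin.snoc_last] at h1 h2
    rw [indicator_of_mem (show x ∈ nextMarkers ε z n m from ⟨h1.2.1, h2.2⟩)]
    simp only [collisionWeight, insertPartners, Fin.init_snoc, Fin.snoc_last]
    rw [pow_succ]
    exact le_of_eq (by ring)

/-! ### Measurability of the collision tree and splitting of the empirical law by labels -/

theorem measurableSet_or {α : Type*} [MeasurableSpace α] {p q : α → Prop}
    (hp : MeasurableSet {x | p x}) (hq : MeasurableSet {x | q x}) :
    MeasurableSet {x | p x ∨ q x} := hp.union hq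

theorem measurableSet_not {α : Type*} [MeasurableSpace α] {p : α → Prop}
    (hp : MeasurableSet {x | p x}) : MeasurableSet {x | ¬ p x} := hp.compl

instance standardBorelSpace_phaseSpace : StandardBorelSpace (E3 × E3) := StandardBorelSpace.prod

/-- Standard Borel structure is needed for Lusin–Souslin, which projects the markers out of events
about configurations and trees. -/
instance standardBorelSpace_config (N : ℕ) : StandardBorelSpace (Config N) :=
  have : StandardBorelSpace (Fin N → E3 × E3) := StandardBorelSpace.pi_countable
  StandardBorelSpace.prod

instance countablySeparated_config (N : ℕ) : MeasurableSpace.CountablySeparated (Config N) :=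
  have : MeasurableSpace.CountablyGenerated (Config N) := countablyGenerated_of_standardBorel
  have : MeasurableSingletonClass (Config N) := measurableSingleton_of_standardBorel
  have : MeasurableSpace.SeparatesPoints (Config N) := inferInstance
  MeasurableSpace.countablySeparated_of_separatesPoints

instance standardBorelSpace_marker : StandardBorelSpace Marker :=
  have : StandardBorelSpace (S2 × E3) := StandardBorelSpace.prod
  StandardBorelSpace.prod

instance standardBorelSpace_markers (n : ℕ) : StandardBorelSpace (Fin n → Marker) :=
  StandardBorelSpace.pi_countable

theorem le_lastTime {n : ℕ} {m : Fin n → Marker} (h : StrictMono fun i => (m i).1) (i : Fin n) :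
    (m i).1 ≤ lastTime n m := by
  cases n with
  | zero => exact i.elim0
  | succ n => exact h.monotone (Fin.le_last i)

/-- The recursive form suits inductions that remove the last marker; the explicit form is the one in
the definition of collision trees. -/
theorem ordered_iff {n : ℕ} {m : Fin n → Marker} {t : ℝ} :
    Ordered n m t ↔ (∀ i, (m i).1 ∈ Ioc 0 t) ∧ StrictMono fun i => (m i).1 := by
  induction n generalizing t with
  | zero => exact ⟨fun _ => ⟨fun i => i.elim0, fun i => i.elim0⟩, fun _ => trivial⟩
  | succ n ih =>
    constructor
    · intro h
      have h1 := ih.1 h.1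
      have hpos : 0 < (m (Fin.last n)).1 := h.1.lastTime_nonneg.trans_lt h.2.1
      have h2 : ∀ i : Fin n, (m i.castSucc).1 < (m (Fin.last n)).1 := fun i =>
        (le_lastTime h1.2 i).trans_lt h.2.1
      refine ⟨fun i => ?_, fun a b hab => ?_⟩
      · refine Fin.lastCases ⟨hpos, h.2.2⟩ (fun i => ?_) i
        exact ⟨(h1.1 i).1, (h2 i).le.trans h.2.2⟩
      · revert a hab
        refine Fin.lastCases (fun a ha => ?_) (fun b a hab => ?_) b
        · obtain ⟨a, rfl⟩ := Fin.exists_castSucc_eq.2 ha.ne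
          exact h2 a
        · obtain ⟨a, rfl⟩ := Fin.exists_castSucc_eq.2 (hab.trans (Fin.castSucc_lt_last b)).ne
          exact h1.2 (Fin.castSucc_lt_castSucc_iff.1 hab)
    · rintro ⟨h1, h2⟩
      refine ⟨ih.2 ⟨fun i => ⟨(h1 i.castSucc).1, (h2 (Fin.castSucc_lt_last i)).le⟩,
        fun a b hab => h2 (Fin.castSucc_lt_castSucc_iff.2 hab)⟩, ?_, (h1 _).2⟩
      cases n with
      | zero => exact (h1 _).1
      | succ n => exact h2 (Fin.castSucc_lt_last _)

/-- `m` lists the collisions of the configuration `ω`, and `ι` the particles involved. -/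
def IsLabelledTree {N : ℕ} (ε t : ℝ) (ω : Config N) (n : ℕ) (m : Fin n → Marker)
    (ι : Fin n → Fin N) : Prop :=
  ((∀ i, (m i).1 ∈ Ioc 0 t) ∧ StrictMono fun i => (m i).1) ∧
    (∀ i, (m i).2.2 = (ω.2 (ι i)).2 ∧
      ∃ k, rootPos ω.1 n m (m i).1 + ε • ((m i).2.1 : E3) =
        (ω.2 (ι i)).1 + (m i).1 • (ω.2 (ι i)).2 + latticeVec k) ∧
    ∀ s ∈ Icc 0 t, ∀ j k,
      ‖rootPos ω.1 n m s - ((ω.2 j).1 + s • (ω.2 j).2 + latticeVec k)‖ ≤ ε →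
      ∃ i, (m i).1 = s ∧ ι i = j ∧
        rootPos ω.1 n m s + ε • ((m i).2.1 : E3) = (ω.2 j).1 + s • (ω.2 j).2 + latticeVec k

theorem isCollisionTree_iff {N : ℕ} {ε t : ℝ} {ω : Config N} {n : ℕ} {z : E3 × E3}
    {m : Fin n → Marker} :
    IsCollisionTree ε t ω ⟨n, z, m⟩ ↔ z = ω.1 ∧ ∃ ι, IsLabelledTree ε t ω n m ι := by
  constructor
  · rintro ⟨hz, h1, h2, ι, h3, h4⟩
    obtain rfl : z = ω.1 := hz
    exact ⟨rfl, ι, ⟨h1, h2⟩, h3, h4⟩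
  · rintro ⟨rfl, ι, ⟨h1, h2⟩, h3, h4⟩
    exact ⟨rfl, h1, h2, ι, h3, h4⟩

/-- At a collision time the partner is in contact with the root, and the contact clause for the
other labelling must then name the same particle. -/
theorem IsLabelledTree.label_unique {N : ℕ} {ε t : ℝ} (hε : 0 < ε) {ω : Config N} {n : ℕ}
    {m : Fin n → Marker} {ι ι' : Fin n → Fin N} (h : IsLabelledTree ε t ω n m ι)
    (h' : IsLabelledTree ε t ω n m ι') : ι = ι' := by
  funext i
  obtain ⟨-, k, hk⟩ := h.2.1 i
  have hi := h.1.1 i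
  obtain ⟨i', h1, h2, -⟩ := h'.2.2 (m i).1 ⟨hi.1.le, hi.2⟩ (ι i) k (by
    rw [← hk, sub_add_cancel_left, norm_neg, norm_smul, Real.norm_of_nonneg hε.le]
    simp)
  rw [← h2, h.1.2.injective h1]

/-- The contact clause quantifies over a continuum of times. It splits into finitely many conditions
at the collision times and a strict inequality at all others. The latter times are singled out by
positivity of ∏ |s - tᵢ|, so `measurableSet_forall_imp_pos` applies. -/
theorem measurableSet_isLabelledTree {N : ℕ} (ε t : ℝ) (n : ℕ) (ι : Fin n → Fin N) :
    MeasurableSet {p : Config N × (Fin n → Marker) | IsLabelledTree ε t p.1 n p.2 ι} := by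
  have hiff : ∀ p : Config N × (Fin n → Marker), IsLabelledTree ε t p.1 n p.2 ι ↔
      Ordered n p.2 t ∧
      (∀ i, (p.2 i).2.2 = (p.1.2 (ι i)).2 ∧
        ∃ k, rootPos p.1.1 n p.2 (p.2 i).1 + ε • ((p.2 i).2.1 : E3) =
          (p.1.2 (ι i)).1 + (p.2 i).1 • (p.1.2 (ι i)).2 + latticeVec k) ∧
      (∀ j k i₀, ¬ ‖rootPos p.1.1 n p.2 (p.2 i₀).1 -
          ((p.1.2 j).1 + (p.2 i₀).1 • (p.1.2 j).2 + latticeVec k)‖ ≤ ε ∨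
        ∃ i, (p.2 i).1 = (p.2 i₀).1 ∧ ι i = j ∧
          rootPos p.1.1 n p.2 (p.2 i₀).1 + ε • ((p.2 i).2.1 : E3) =
            (p.1.2 j).1 + (p.2 i₀).1 • (p.1.2 j).2 + latticeVec k) ∧
      ∀ j k, ∀ s ∈ Icc 0 t, 0 < ∏ i, |s - (p.2 i).1| →
        0 < ‖rootPos p.1.1 n p.2 s - ((p.1.2 j).1 + s • (p.1.2 j).2 + latticeVec k)‖ - ε := by
    intro p
    rw [IsLabelledTree, ← ordered_iff]
    refine and_congr_right fun hord => and_congr_right fun _ => ?_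
    have hI := (ordered_iff.1 hord).1
    constructor
    · intro h
      refine ⟨fun j k i₀ => ?_, fun j k s hs hprod => ?_⟩
      · by_cases hle : ‖rootPos p.1.1 n p.2 (p.2 i₀).1 -
          ((p.1.2 j).1 + (p.2 i₀).1 • (p.1.2 j).2 + latticeVec k)‖ ≤ ε
        · exact Or.inr (h _ ⟨(hI i₀).1.le, (hI i₀).2⟩ j k hle)
        · exact Or.inl hle
      · by_contra hcon
        obtain ⟨i, hi, -⟩ := h s hs j k (by linarith)
        rw [Finset.prod_eq_zero (Finset.mem_univ i) (by rw [hi]; simp)] at hprod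
        exact lt_irrefl _ hprod
    · rintro ⟨h1, h2⟩ s hs j k hle
      by_cases hex : ∃ i₀, (p.2 i₀).1 = s
      · obtain ⟨i₀, rfl⟩ := hex
        exact (h1 j k i₀).resolve_left (not_not.2 hle)
      · push Not at hex
        have := h2 j k s hs (Finset.prod_pos fun i _ => abs_pos.2 (sub_ne_zero.2 (hex i).symm))
        linarith
  simp only [hiff]
  refine measurableSet_and (measurableSet_ordered measurable_snd measurable_const)
    (measurableSet_and (measurableSet_forall fun i => measurableSet_and ?_
      (measurableSet_exists fun k => ?_)) (measurableSet_and (measurableSet_forall fun j =>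
        measurableSet_forall fun k => measurableSet_forall fun i₀ => ?_)
          (measurableSet_forall fun j => measurableSet_forall fun k =>
            measurableSet_forall_imp_pos isCompact_Icc (fun s => ?_) (fun p => ?_)
              (fun s => ?_) fun p => ?_)))
  · exact measurableSet_eq_fun (by fun_prop) (by fun_prop)
  · exact measurableSet_eq_fun (by fun_prop) (by fun_prop)
  · refine measurableSet_or (measurableSet_not (measurableSet_le (by fun_prop) measurable_const))
      (measurableSet_exists fun i => measurableSet_and ?_ (measurableSet_and ?_ ?_))
    · exact measurableSet_eq_fun (by fun_prop) (by fun_prop)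
    · exact MeasurableSet.const _
    · exact measurableSet_eq_fun (by fun_prop) (by fun_prop)
  · fun_prop
  · fun_prop
  · fun_prop
  · have := continuous_rootPos p.1.1 n p.2
    fun_prop

/-- Configurations with a collision tree in `S` that has the labels `ι`. -/
def labelledEvent {N : ℕ} (ε t : ℝ) (n : ℕ) (ι : Fin n → Fin N)
    (S : Set ((E3 × E3) × (Fin n → Marker))) : Set (Config N) :=
  {ω | ∃ m, (ω.1, m) ∈ S ∧ IsLabelledTree ε t ω n m ι}

theorem IsLabelledTree.unique {N : ℕ} {ε t : ℝ} (hε : 0 < ε) {ω : Config N} {n n' : ℕ}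
    {m : Fin n → Marker} {m' : Fin n' → Marker} {ι : Fin n → Fin N} {ι' : Fin n' → Fin N}
    (h : IsLabelledTree ε t ω n m ι) (h' : IsLabelledTree ε t ω n' m' ι') :
    (⟨n, m, ι⟩ : Σ n, (Fin n → Marker) × (Fin n → Fin N)) = ⟨n', m', ι'⟩ := by
  have h1 : IsCollisionTree ε t ω ⟨n, ω.1, m⟩ := isCollisionTree_iff.2 ⟨rfl, ι, h⟩
  have h2 : IsCollisionTree ε t ω ⟨n', ω.1, m'⟩ := isCollisionTree_iff.2 ⟨rfl, ι', h'⟩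
  have h3 := h1.unique hε h2
  obtain rfl : n = n' := congrArg Sigma.fst h3
  obtain rfl : m = m' := congrArg Prod.snd (eq_of_heq (Sigma.mk.inj h3).2)
  rw [h.label_unique hε h']

/-- The event is a projection of a Borel set along the markers; uniqueness of the tree makes the
projection injective there, so the image is Borel. -/
theorem measurableSet_labelledEvent {N : ℕ} {ε : ℝ} (hε : 0 < ε) (t : ℝ) (n : ℕ)
    (ι : Fin n → Fin N) {S : Set ((E3 × E3) × (Fin n → Marker))} (hS : MeasurableSet S) :
    MeasurableSet (labelledEvent ε t n ι S) := by
  have himg : labelledEvent ε t n ι S = Prod.fst '' {p : Config N × (Fin n → Marker) |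
      (p.1.1, p.2) ∈ S ∧ IsLabelledTree ε t p.1 n p.2 ι} := by
    ext ω
    constructor
    · rintro ⟨m, h⟩
      exact ⟨(ω, m), h, rfl⟩
    · rintro ⟨⟨ω, m⟩, h, rfl⟩
      exact ⟨m, h⟩
  rw [himg]
  refine MeasurableSet.image_of_measurable_injOn ?_ measurable_fst ?_
  · exact measurableSet_and (hS.preimage (by fun_prop)) (measurableSet_isLabelledTree ε t n ι)
  · rintro ⟨ω, m⟩ h ⟨ω', m'⟩ h' heq
    obtain rfl : ω = ω' := heq
    have := h.2.unique hε h'.2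
    rw [Prod.mk.injEq]
    exact ⟨rfl, congrArg Prod.fst (eq_of_heq (Sigma.mk.inj this).2)⟩

/-- The tree with `n` collisions given by its root and its markers. -/
def treeMk (n : ℕ) (p : (E3 × E3) × (Fin n → Marker)) : Tree := ⟨n, p⟩

theorem measurableSet_tree {S : Set Tree} (hS : MeasurableSet S) (n : ℕ) :
    MeasurableSet (treeMk n ⁻¹' S) :=
  MeasurableSpace.measurableSet_iInf.1 hS n

theorem measurable_treeMk (n : ℕ) : Measurable (treeMk n) :=
  fun _ hS => measurableSet_tree hS n

theorem exists_isCollisionTree_eq {N : ℕ} (ε t : ℝ) (S : Set Tree) :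
    {ω : Config N | ∃ Φ, IsCollisionTree ε t ω Φ ∧ Φ ∈ S} =
      ⋃ p : Σ n, (Fin n → Fin N), labelledEvent ε t p.1 p.2 (treeMk p.1 ⁻¹' S) := by
  ext ω
  rw [mem_iUnion]
  constructor
  · rintro ⟨⟨n, z, m⟩, h, hS⟩
    obtain ⟨rfl, ι, hι⟩ := isCollisionTree_iff.1 h
    exact ⟨⟨n, ι⟩, m, hS, hι⟩
  · rintro ⟨⟨n, ι⟩, m, hS, hι⟩
    exact ⟨⟨n, ω.1, m⟩, isCollisionTree_iff.2 ⟨rfl, ι, hι⟩, hS⟩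

theorem measurableSet_exists_isCollisionTree {N : ℕ} {ε : ℝ} (hε : 0 < ε) (t : ℝ) {S : Set Tree}
    (hS : MeasurableSet S) :
    MeasurableSet {ω : Config N | ∃ Φ, IsCollisionTree ε t ω Φ ∧ Φ ∈ S} := by
  rw [exists_isCollisionTree_eq]
  exact MeasurableSet.iUnion fun p =>
    measurableSet_labelledEvent hε t p.1 p.2 (measurableSet_tree hS p.1)

theorem collisionTree_eq {N : ℕ} {ε t : ℝ} (hε : 0 < ε) {ω : Config N} {Φ : Tree}
    (h : IsCollisionTree ε t ω Φ) : collisionTree ε t ω = Φ := by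
  have hex : ∃ Φ, IsCollisionTree ε t ω Φ := ⟨Φ, h⟩
  rw [collisionTree, dif_pos hex]
  exact hex.choose_spec.unique hε h

theorem measurable_collisionTree {N : ℕ} {ε : ℝ} (hε : 0 < ε) (t : ℝ) :
    Measurable (collisionTree ε t : Config N → Tree) := by
  intro S hS
  have huniv := measurableSet_exists_isCollisionTree (N := N) hε t MeasurableSet.univ
  have hdef : MeasurableSet {ω : Config N | (⟨0, ω.1, Fin.elim0⟩ : Tree) ∈ S} :=
    ((measurable_treeMk 0).comp (by fun_prop :
      Measurable fun ω : Config N => (ω.1, (Fin.elim0 : Fin 0 → Marker)))) hS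
  have heq : collisionTree ε t ⁻¹' S = {ω : Config N | ∃ Φ, IsCollisionTree ε t ω Φ ∧ Φ ∈ S} ∪
      ({ω : Config N | ∃ Φ, IsCollisionTree ε t ω Φ ∧ Φ ∈ univ}ᶜ ∩
        {ω : Config N | (⟨0, ω.1, Fin.elim0⟩ : Tree) ∈ S}) := by
    ext ω
    by_cases hex : ∃ Φ, IsCollisionTree ε t ω Φ
    · obtain ⟨Φ, hΦ⟩ := hex
      rw [mem_preimage, collisionTree_eq hε hΦ]
      constructor
      · exact fun h => Or.inl ⟨Φ, hΦ, h⟩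
      · rintro (⟨Ψ, hΨ, h⟩ | ⟨h, -⟩)
        · rwa [hΦ.unique hε hΨ]
        · exact absurd ⟨Φ, hΦ, mem_univ _⟩ h
    · rw [mem_preimage, collisionTree, dif_neg hex]
      constructor
      · exact fun h => Or.inr ⟨fun ⟨Φ, hΦ, _⟩ => hex ⟨Φ, hΦ⟩, h⟩
      · rintro (⟨Ψ, hΨ, h⟩ | ⟨-, h⟩)
        · exact absurd ⟨Ψ, hΨ⟩ hex
        · exact h
  rw [heq]
  exact (measurableSet_exists_isCollisionTree hε t hS).union (huniv.compl.inter hdef)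

theorem empiricalLaw_apply (f₀ : E3 × E3 → ℝ) (g₀ : E3 → ℝ) (N : ℕ) {ε : ℝ} (hε : 0 < ε) (t : ℝ)
    {S : Set Tree} (hS : MeasurableSet S) :
    empiricalLaw f₀ g₀ N ε t S =
      configLaw f₀ g₀ N {ω | ∃ Φ, IsCollisionTree ε t ω Φ ∧ Φ ∈ S} := by
  rw [empiricalLaw, Measure.map_apply (measurable_collisionTree hε t) hS,
    Measure.restrict_apply (measurable_collisionTree hε t hS)]
  congr 1
  ext ω
  constructor
  · rintro ⟨h, Φ, hΦ⟩
    rw [mem_preimage, collisionTree_eq hε hΦ] at h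
    exact ⟨Φ, hΦ, h⟩
  · rintro ⟨Φ, hΦ, h⟩
    refine ⟨?_, Φ, hΦ⟩
    rwa [mem_preimage, collisionTree_eq hε hΦ]

/-- Tree and labels are unique, so events with different labellings are disjoint. This is what lets
the contributions of all labellings be added, producing the combinatorial factor of the lower bound.
-/
theorem empiricalLaw_eq_tsum (f₀ : E3 × E3 → ℝ) (g₀ : E3 → ℝ) (N : ℕ) {ε : ℝ} (hε : 0 < ε)
    (t : ℝ) {S : Set Tree} (hS : MeasurableSet S) :
    empiricalLaw f₀ g₀ N ε t S = ∑' n, ∑ ι : Fin n → Fin N,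
      configLaw f₀ g₀ N (labelledEvent ε t n ι (treeMk n ⁻¹' S)) := by
  rw [empiricalLaw_apply f₀ g₀ N hε t hS, exists_isCollisionTree_eq, measure_iUnion,
    ENNReal.tsum_sigma']
  · exact tsum_congr fun n => tsum_fintype _
  · rintro ⟨n, ι⟩ ⟨n', ι'⟩ hne
    refine disjoint_left.2 ?_
    rintro ω ⟨m, -, h⟩ ⟨m', -, h'⟩
    apply hne
    have := h.unique hε h'
    obtain rfl : n = n' := congrArg Sigma.fst this
    have hι : ι = ι' := congrArg Prod.snd (eq_of_heq (Sigma.mk.inj this).2)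
    rw [hι]
  · exact fun p => measurableSet_labelledEvent hε t p.1 p.2 (measurableSet_tree hS p.1)

/-! ### Good trees and their realization by configurations -/

/-- Up to time `T`, no colliding particle gets into contact with the root except at its
collision. -/
def GoodTree (ε T : ℝ) (z : E3 × E3) (n : ℕ) (m : Fin n → Marker) : Prop :=
  ∀ i k, ∀ s ∈ Icc 0 T, 0 < |s - (m i).1| →
    0 < ‖rootPos z n m s - (rootPos z n m (m i).1 + ε • ((m i).2.1 : E3) +
      (s - (m i).1) • (m i).2.2 + latticeVec k)‖ - ε

theorem measurableSet_goodTree {α : Type*} [MeasurableSpace α] (ε T : ℝ) {n : ℕ}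
    {a : α → E3 × E3} (ha : Measurable a) {b : α → Fin n → Marker} (hb : Measurable b) :
    MeasurableSet {x | GoodTree ε T (a x) n (b x)} := by
  refine measurableSet_forall fun i => measurableSet_forall fun k =>
    measurableSet_forall_imp_pos isCompact_Icc (fun s => ?_) (fun x => ?_)
      (fun s => ?_) fun x => ?_
  · fun_prop
  · fun_prop
  · fun_prop
  · have := continuous_rootPos (a x) n (b x)
    fun_prop

theorem Ordered.init_le {n : ℕ} {m : Fin (n + 1) → Marker} {t : ℝ} (h : Ordered (n + 1) m t)
    (i : Fin n) : (m i.castSucc).1 ≤ (m (Fin.last n)).1 :=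
  (ordered_iff.1 h).2.monotone (Fin.le_last _)

theorem GoodTree.init {ε T : ℝ} {z : E3 × E3} {n : ℕ} {m : Fin (n + 1) → Marker} {t : ℝ}
    (h : GoodTree ε T z (n + 1) m) (hord : Ordered (n + 1) m t) (htT : t ≤ T) :
    GoodTree ε (m (Fin.last n)).1 z n (Fin.init m) := by
  intro i k s hs hne
  have h1 := h i.castSucc k s ⟨hs.1, hs.2.trans (hord.2.2.trans htT)⟩ hne
  rwa [rootPos_init z n m hs.2, rootPos_init z n m (hord.init_le i)] at h1

theorem GoodTree.noEarlierContact {ε T : ℝ} {z : E3 × E3} {n : ℕ} {m : Fin n → Marker} {t : ℝ}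
    (h : GoodTree ε T z n m) (hord : Ordered n m t) (htT : t ≤ T) : NoEarlierContact ε z n m := by
  induction n generalizing t T with
  | zero => trivial
  | succ n ih =>
    refine ⟨ih (h.init hord htT) hord.1 le_rfl, fun s hs hlt k => ?_⟩
    have hsτ : s < (m (Fin.last n)).1 := sub_pos.1 hlt
    have h1 := h (Fin.last n) k s ⟨hs, hsτ.le.trans (hord.2.2.trans htT)⟩
      (abs_pos.2 (sub_neg.2 hsτ).ne)
    rwa [rootPos_init z n m hsτ.le, rootPos_init z n m le_rfl] at h1

theorem insertPartners_of_notMem (ε : ℝ) (z : E3 × E3) {N n : ℕ} (ι : Fin n → Fin N)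
    (m : Fin n → Marker) (ω : Fin N → E3 × E3) {j : Fin N} (hj : ∀ i, ι i ≠ j) :
    insertPartners ε z n ι m ω j = ω j := by
  induction n generalizing ω with
  | zero => rfl
  | succ n ih =>
    rw [insertPartners, ih (Fin.init ι) _ _ fun i => hj i.castSucc,
      Function.update_of_ne (hj (Fin.last n)).symm]

/-- The partner of the latest collision is put in first; injectivity of the labels keeps the earlier
ones from overwriting it. -/
theorem insertPartners_apply (ε : ℝ) (z : E3 × E3) {N n : ℕ} {ι : Fin n → Fin N}
    (hι : Function.Injective ι) {m : Fin n → Marker} {t : ℝ} (hord : Ordered n m t)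
    (ω : Fin N → E3 × E3) (i : Fin n) :
    insertPartners ε z n ι m ω (ι i) = partner ε z n m (m i) := by
  induction n generalizing ω t with
  | zero => exact i.elim0
  | succ n ih =>
    rw [insertPartners]
    refine Fin.lastCases ?_ (fun i => ?_) i
    · rw [insertPartners_of_notMem, Function.update_self, partner, partner,
        rootPos_init z n m le_rfl]
      exact fun i h => (Fin.castSucc_lt_last i).ne (hι h)
    · have h1 := ih (ι := Fin.init ι) (hι.comp (Fin.castSucc_injective n)) hord.1
        (Function.update ω (ι (Fin.last n)) (partner ε z n (Fin.init m) (m (Fin.last n)))) i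
      rw [show ι i.castSucc = Fin.init ι i from rfl, h1, partner, partner,
        rootPos_init z n m (hord.init_le i)]
      rfl

/-- The deterministic core of the lower bound. Goodness of the tree keeps the partners away from the
root outside their collision times, and avoiding the tube keeps every other particle farther than ε.
The slots about to be overwritten are also required to avoid the tube; this costs only finitely many
factors close to one and keeps the exponent equal to N. -/
theorem isLabelledTree_insertPartners {ε r t T : ℝ} (hε : 0 < ε) (hε2 : ε < 1 / 2) (hr : ε < r)
    (htT : t ≤ T) {z : E3 × E3} {N n : ℕ} {ι : Fin n → Fin N}
    (hι : Function.Injective ι) {m : Fin n → Marker} (hord : Ordered n m t)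
    (hgood : GoodTree ε T z n m) {ω : Fin N → E3 × E3} (hω : ∀ j, ω j ∉ tube z n m r t) :
    IsLabelledTree ε t (z, insertPartners ε z n ι m ω) n m ι := by
  have hpart : ∀ i, ∃ k₀, (insertPartners ε z n ι m ω (ι i)).2 = (m i).2.2 ∧
      (insertPartners ε z n ι m ω (ι i)).1 = rootPos z n m (m i).1 + ε • ((m i).2.1 : E3) -
        (m i).1 • (m i).2.2 - latticeVec k₀ := fun i => by
    -- The integer shift removed when the initial position is folded into the cube.
    refine ⟨floorVec (rootPos z n m (m i).1 + ε • ((m i).2.1 : E3) - (m i).1 • (m i).2.2), ?_⟩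
    rw [insertPartners_apply ε z hι hord]
    exact ⟨rfl, rfl⟩
  refine ⟨ordered_iff.1 hord, fun i => ?_, fun s hs j k hle => ?_⟩
  · obtain ⟨k₀, h2, h1⟩ := hpart i
    refine ⟨h2.symm, k₀, ?_⟩
    simp only [h1, h2]
    abel
  · by_cases hj : ∃ i, ι i = j
    · obtain ⟨i, rfl⟩ := hj
      obtain ⟨k₀, h2, h1⟩ := hpart i
      simp only [h1, h2] at hle ⊢
      have h3 : rootPos z n m (m i).1 + ε • ((m i).2.1 : E3) - (m i).1 • (m i).2.2 -
          latticeVec k₀ + s • (m i).2.2 + latticeVec k = rootPos z n m (m i).1 +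
            ε • ((m i).2.1 : E3) + (s - (m i).1) • (m i).2.2 + latticeVec (k - k₀) := by
        rw [latticeVec_sub, sub_smul]
        abel
      rw [h3] at hle
      have hst : s = (m i).1 := by
        by_contra hne
        have := hgood i (k - k₀) s ⟨hs.1, hs.2.trans htT⟩ (abs_pos.2 (sub_ne_zero.2 hne))
        linarith
      refine ⟨i, hst.symm, rfl, ?_⟩
      rw [h3]
      rw [hst, sub_self, zero_smul, add_zero] at hle ⊢
      -- At the collision time itself another translate within distance ε would give a nonzero
      -- lattice vector of length at most 2ε < 1.
      have hk : k - k₀ = 0 := by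
        by_contra hk
        have h4 := one_le_norm_latticeVec hk
        have h5 : latticeVec (k - k₀) = -(rootPos z n m (m i).1 - (rootPos z n m (m i).1 +
          ε • ((m i).2.1 : E3) + latticeVec (k - k₀))) - ε • ((m i).2.1 : E3) := by abel
        rw [h5] at h4
        have h6 := h4.trans (norm_sub_le _ _)
        rw [norm_neg, norm_smul, Real.norm_of_nonneg hε.le] at h6
        simp only [norm_eq_of_mem_sphere, mul_one] at h6
        linarith
      rw [hk, latticeVec_zero, add_zero]
    · push Not at hj
      simp only [insertPartners_of_notMem ε z ι m ω hj] at hle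
      exact absurd ⟨s, hs, k, hle.trans_lt hr⟩ (hω j)

/-! ### Lower bound for the empirical law on good trees -/

/-- The initial density of the tagged particle, extended by zero. -/
def rootDensity (f : E3 × E3 → ℝ) (z : E3 × E3) : ℝ≥0∞ :=
  (unitCube ×ˢ univ).indicator (fun z => ENNReal.ofReal (f z)) z

theorem measurable_rootDensity {f : E3 × E3 → ℝ} (hf : Measurable f) :
    Measurable (rootDensity f) :=
  Measurable.indicator (by fun_prop) (measurableSet_unitCube.prod MeasurableSet.univ)

theorem phaseVolume_eq :
    phaseVolume = (volume : Measure (E3 × E3)).restrict (unitCube ×ˢ univ) := by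
  rw [phaseVolume, Measure.volume_eq_prod, ← Measure.prod_restrict, Measure.restrict_univ]

theorem withDensity_rootDensity {f : E3 × E3 → ℝ} :
    (volume : Measure (E3 × E3)).withDensity (rootDensity f) =
      phaseVolume.withDensity fun z => ENNReal.ofReal (f z) := by
  have h2 : rootDensity f = (unitCube ×ˢ univ).indicator fun z => ENNReal.ofReal (f z) := rfl
  rw [phaseVolume_eq, h2, withDensity_indicator (measurableSet_unitCube.prod MeasurableSet.univ)]

theorem configLaw_apply {f : E3 × E3 → ℝ} (hf : Measurable f) {g : E3 → ℝ} (hg : GasDensity g)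
    {N : ℕ} {A : Set (Config N)} (hA : MeasurableSet A) :
    configLaw f g N A = ∫⁻ z, rootDensity f z *
      ∫⁻ ω, A.indicator 1 (z, ω) ∂(Measure.pi fun _ : Fin N => bathLaw g) := by
  have := isProbabilityMeasure_bathLaw hg
  have hm : Measurable (A.indicator (1 : Config N → ℝ≥0∞)) := measurable_one.indicator hA
  have h1 : configLaw f g N = ((volume : Measure (E3 × E3)).withDensity (rootDensity f)).prod
      (Measure.pi fun _ : Fin N => bathLaw g) := by
    rw [withDensity_rootDensity]
    rfl
  rw [h1, ← lintegral_indicator_one hA, lintegral_prod _ hm.aemeasurable,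
    lintegral_withDensity_eq_lintegral_mul _ (measurable_rootDensity hf)
      hm.lintegral_prod_right']
  rfl

/-- The insertion inequality is applied to the indicator of the event. For a good tree the inserted
configuration lies in the event as soon as all N independent bath particles avoid the tube, which
gives the N-th power. -/
theorem configLaw_labelledEvent_ge {f : E3 × E3 → ℝ} (hf : Measurable f) {g : E3 → ℝ}
    (hg : GasDensity g) {ε r t T : ℝ} (hε : 0 < ε) (hε2 : ε < 1 / 2) (hr : ε < r) (ht : 0 ≤ t)
    (htT : t ≤ T) {N n : ℕ} {ι : Fin n → Fin N} (hι : Function.Injective ι)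
    {S : Set ((E3 × E3) × (Fin n → Marker))} (hS : MeasurableSet S) :
    ∫⁻ z, rootDensity f z * ∫⁻ m in {m | Ordered n m t ∧ GoodTree ε T z n m ∧ (z, m) ∈ S},
      ENNReal.ofReal (ε ^ 2) ^ n * collisionWeight g z.2 n m *
        (1 - (volume (Metric.ball (0 : E3) r) + ENNReal.ofReal (r ^ 2 * pathRate g z.2 n m t))) ^ N
          ∂markersMeasure n ≤ configLaw f g N (labelledEvent ε t n ι S) := by
  have := isProbabilityMeasure_bathLaw hg
  have hE := measurableSet_labelledEvent hε t n ι hS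
  rw [configLaw_apply hf hg hE]
  refine lintegral_mono fun z => mul_le_mul_right ?_ _
  have hFm : Measurable fun ω : Fin N → E3 × E3 => (labelledEvent ε t n ι S).indicator
      (1 : Config N → ℝ≥0∞) (z, ω) := (measurable_one.indicator hE).comp measurable_prodMk_left
  refine le_trans ?_ (setLIntegral_insertPartners_le hg hε hε2 z n ι t _ hFm)
  have hm1 : MeasurableSet {m : Fin n → Marker | Ordered n m t ∧ GoodTree ε T z n m ∧
      (z, m) ∈ S} :=
    measurableSet_and (measurableSet_ordered measurable_id measurable_const)
      (measurableSet_and (measurableSet_goodTree ε T measurable_const measurable_id)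
        (hS.preimage measurable_prodMk_left))
  have hm2 : MeasurableSet {m : Fin n → Marker | Ordered n m t ∧ NoEarlierContact ε z n m} :=
    measurableSet_and (measurableSet_ordered measurable_id measurable_const)
      (measurableSet_noEarlierContact ε measurable_const measurable_id)
  rw [← lintegral_indicator hm1, ← lintegral_indicator hm2]
  refine lintegral_mono fun m => indicator_apply_le' (fun hmem => ?_) fun _ => zero_le
  obtain ⟨hord, hgood, hmS⟩ := hmem
  rw [indicator_of_mem (s := {m | Ordered n m t ∧ NoEarlierContact ε z n m})
    ⟨hord, hgood.noEarlierContact hord htT⟩]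
  refine mul_le_mul_right ?_ _
  have htube := (isOpen_tube z n m r t).measurableSet
  calc (1 - (volume (Metric.ball (0 : E3) r) + ENNReal.ofReal (r ^ 2 * pathRate g z.2 n m t))) ^ N
      ≤ (bathLaw g (tube z n m r t)ᶜ) ^ N := by
        rw [prob_compl_eq_one_sub htube]
        exact pow_le_pow_left₀ zero_le
          (tsub_le_tsub_left (bathLaw_tube_le hg z (hε.trans hr) hord ht) _) N
    _ = (Measure.pi fun _ : Fin N => bathLaw g) (univ.pi fun _ => (tube z n m r t)ᶜ) := by
        rw [Measure.pi_pi]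
        simp
    _ = ∫⁻ ω, (univ.pi fun _ : Fin N => (tube z n m r t)ᶜ).indicator 1 ω
          ∂(Measure.pi fun _ : Fin N => bathLaw g) := by
        rw [lintegral_indicator_one (MeasurableSet.univ_pi fun _ => htube.compl)]
    _ ≤ _ := by
        refine lintegral_mono fun ω => indicator_apply_le' (fun hω => ?_) fun _ => zero_le
        rw [indicator_of_mem]
        · rfl
        · exact ⟨m, hmS, isLabelledTree_insertPartners hε hε2 hr htT hι hord hgood fun j =>
            hω j (mem_univ j)⟩

theorem card_injective_fin (n N : ℕ) :
    (Finset.univ.filter fun ι : Fin n → Fin N => Function.Injective ι).card =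
      N.descFactorial n := by
  classical
  rw [← Fintype.card_subtype, Fintype.card_congr (Equiv.subtypeInjectiveEquivEmbedding _ _),
    Fintype.card_embedding_eq, Fintype.card_fin, Fintype.card_fin]

/-- A lower bound for the density of the empirical distribution on good trees. -/
def lowerDensity (f : E3 × E3 → ℝ) (g : E3 → ℝ) (N : ℕ) (ε r t : ℝ) (n : ℕ) (z : E3 × E3)
    (m : Fin n → Marker) : ℝ≥0∞ :=
  rootDensity f z * collisionWeight g z.2 n m *
    ((N.descFactorial n : ℝ≥0∞) * ENNReal.ofReal (ε ^ 2) ^ n) *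
      (1 - (volume (Metric.ball (0 : E3) r) + ENNReal.ofReal (r ^ 2 * pathRate g z.2 n m t))) ^ N

theorem measurable_pathRate {α : Type*} [MeasurableSpace α] {g : E3 → ℝ} (hg : GasDensity g)
    {n : ℕ} {a : α → E3} (ha : Measurable a) {b : α → Fin n → Marker} (hb : Measurable b)
    {c : α → ℝ} (hc : Measurable c) : Measurable fun x => pathRate g (a x) n (b x) (c x) := by
  have hr := measurable_collisionRate hg
  induction n generalizing c with
  | zero => simp only [pathRate]; fun_prop
  | succ n ih =>
    simp only [pathRate]
    have := ih (measurable_init hb) (c := fun x => (b x (Fin.last n)).1) (by fun_prop)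
    fun_prop

theorem measurable_lowerDensity {f : E3 × E3 → ℝ} (hf : Measurable f) {g : E3 → ℝ}
    (hg : GasDensity g) (N : ℕ) (ε r t : ℝ) (n : ℕ) :
    Measurable fun p : (E3 × E3) × (Fin n → Marker) => lowerDensity f g N ε r t n p.1 p.2 := by
  have h1 := measurable_pathRate hg (n := n)
    (a := fun p : (E3 × E3) × (Fin n → Marker) => p.1.2) (by fun_prop) (b := fun p => p.2)
      (by fun_prop) (c := fun _ => t) (by fun_prop)
  have h2 := measurable_collisionWeight hg.meas
    (a := fun p : (E3 × E3) × (Fin n → Marker) => p.1.2) (by fun_prop) (b := fun p => p.2)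
      (by fun_prop)
  have h3 := measurable_rootDensity hf
  unfold lowerDensity
  fun_prop

/-- Labellings that use a particle twice are discarded. Each injective one admits the same lower
bound, and their number is the descending factorial in `lowerDensity`. -/
theorem empiricalLaw_ge {f : E3 × E3 → ℝ} (hf : Measurable f) {g : E3 → ℝ}
    (hg : GasDensity g) {ε r t T : ℝ} (hε : 0 < ε) (hε2 : ε < 1 / 2) (hr : ε < r) (ht : 0 ≤ t)
    (htT : t ≤ T) (N : ℕ) {S : Set Tree} (hS : MeasurableSet S) :
    ∑' n, ∫⁻ p in {p : (E3 × E3) × (Fin n → Marker) | Ordered n p.2 t ∧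
      GoodTree ε T p.1 n p.2 ∧ treeMk n p ∈ S}, lowerDensity f g N ε r t n p.1 p.2
        ∂(volume.prod (markersMeasure n)) ≤ empiricalLaw f g N ε t S := by
  classical
  rw [empiricalLaw_eq_tsum f g N hε t hS]
  refine ENNReal.tsum_le_tsum fun n => ?_
  have hSn := measurableSet_tree hS n
  set A : Set ((E3 × E3) × (Fin n → Marker)) := {p | Ordered n p.2 t ∧
      GoodTree ε T p.1 n p.2 ∧ treeMk n p ∈ S} with hA
  have hAm : MeasurableSet A :=
    measurableSet_and (measurableSet_ordered measurable_snd measurable_const)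
      (measurableSet_and (measurableSet_goodTree ε T measurable_fst measurable_snd) hSn)
  have hLm := measurable_lowerDensity hf hg N ε r t n
  have hcard : (N.descFactorial n : ℝ≥0∞) ≠ ∞ := ENNReal.natCast_ne_top _
  calc ∫⁻ p in A, lowerDensity f g N ε r t n p.1 p.2 ∂(volume.prod (markersMeasure n))
      = ∑ _ι ∈ Finset.univ.filter fun ι : Fin n → Fin N => Function.Injective ι,
          ∫⁻ z, rootDensity f z * ∫⁻ m in {m | Ordered n m t ∧ GoodTree ε T z n m ∧
            (z, m) ∈ treeMk n ⁻¹' S}, ENNReal.ofReal (ε ^ 2) ^ n * collisionWeight g z.2 n m *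
            (1 - (volume (Metric.ball (0 : E3) r) +
              ENNReal.ofReal (r ^ 2 * pathRate g z.2 n m t))) ^ N ∂markersMeasure n := by
        rw [Finset.sum_const, card_injective_fin, nsmul_eq_mul, ← lintegral_const_mul' _ _ hcard,
          ← lintegral_indicator hAm, lintegral_prod _ (hLm.indicator hAm).aemeasurable]
        refine lintegral_congr fun z => ?_
        have hzt : rootDensity f z ≠ ∞ := by
          unfold rootDensity
          exact ne_top_of_le_ne_top ENNReal.ofReal_ne_top (indicator_le_self _ _ _)
        have hAz : MeasurableSet {m : Fin n → Marker | (z, m) ∈ A} :=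
          hAm.preimage measurable_prodMk_left
        rw [← lintegral_const_mul' _ _ hzt, ← lintegral_const_mul' _ _ hcard]
        rw [show {m : Fin n → Marker | Ordered n m t ∧ GoodTree ε T z n m ∧
          (z, m) ∈ treeMk n ⁻¹' S} = {m | (z, m) ∈ A} from rfl, ← lintegral_indicator hAz]
        refine lintegral_congr fun m => indicator_eq_of_iff Iff.rfl fun _ => ?_
        simp only [lowerDensity]
        ring
    _ ≤ ∑ ι ∈ Finset.univ.filter fun ι : Fin n → Fin N => Function.Injective ι,
          configLaw f g N (labelledEvent ε t n ι (treeMk n ⁻¹' S)) :=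
        Finset.sum_le_sum fun ι hι => configLaw_labelledEvent_ge hf hg hε hε2 hr ht htT
          (Finset.mem_filter.1 hι).2 hSn
    _ ≤ _ := Finset.sum_le_sum_of_subset (Finset.filter_subset _ _)

/-! ### Mass of the idealized distribution -/

theorem norm_collide_sq (v : E3) (ν : S2) (w : E3) : ‖collide v ν w‖ ^ 2 =
    ‖v‖ ^ 2 - inner ℝ (ν : E3) v ^ 2 + inner ℝ (ν : E3) w ^ 2 := by
  have h1 : ‖(ν : E3)‖ = 1 := by simp
  rw [collide, @norm_sub_sq_real, norm_smul, h1, real_inner_smul_right, mul_one, Real.norm_eq_abs,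
    sq_abs, real_inner_comm (ν : E3) v, inner_sub_right]
  ring

/-- If the collision raises the speed, then |ν·v| < |ν·w| because only the normal component is
replaced. Both the flux and the gain in speed are then at most 2‖w‖, so their product is bounded
independently of the velocity v. -/
theorem flux_mul_norm_collide_le (v : E3) (ν : S2) (w : E3) :
    flux v ν w * (1 + ‖collide v ν w‖) ≤ flux v ν w * (1 + ‖v‖) + 4 * (1 + ‖w‖ ^ 2) := by
  have hf := flux_nonneg v ν w
  have hw := norm_nonneg w
  have hν : ‖(ν : E3)‖ = 1 := by simp
  rcases le_or_gt ‖collide v ν w‖ ‖v‖ with h | h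
  · nlinarith [mul_le_mul_of_nonneg_left h hf]
  have hsq : ‖v‖ ^ 2 < ‖collide v ν w‖ ^ 2 := pow_lt_pow_left₀ h (norm_nonneg _) two_ne_zero
  rw [norm_collide_sq] at hsq
  have hlt : |inner ℝ (ν : E3) v| < |inner ℝ (ν : E3) w| := sq_lt_sq.1 (by linarith)
  have hle : |inner ℝ (ν : E3) w| ≤ ‖w‖ := by simpa [hν] using abs_real_inner_le_norm (ν : E3) w
  have habs : |inner ℝ (ν : E3) (v - w)| ≤ 2 * ‖w‖ := by
    rw [inner_sub_right]
    exact (abs_sub _ _).trans (by linarith)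
  have h1 : flux v ν w ≤ 2 * ‖w‖ := by
    refine max_le ?_ (by positivity)
    rw [real_inner_comm]
    exact (le_abs_self _).trans habs
  have h2 : ‖collide v ν w‖ ≤ ‖v‖ + 2 * ‖w‖ := by
    refine (norm_sub_le _ _).trans ?_
    rw [norm_smul, hν, mul_one, Real.norm_eq_abs]
    linarith
  have h3 : flux v ν w * ‖collide v ν w‖ ≤ flux v ν w * (‖v‖ + 2 * ‖w‖) :=
    mul_le_mul_of_nonneg_left h2 hf
  have h4 : flux v ν w * (2 * ‖w‖) ≤ 2 * ‖w‖ * (2 * ‖w‖) :=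
    mul_le_mul_of_nonneg_right h1 (by positivity)
  nlinarith

/-- The weight `1 + ‖v‖` controlling the collision rate. -/
def speedWeight (v : E3) : ℝ≥0∞ := ENNReal.ofReal (1 + ‖v‖)

@[fun_prop]
theorem measurable_speedWeight : Measurable speedWeight := by unfold speedWeight; fun_prop

/-- Bound of the collision rate in terms of `speedWeight`. -/
def rateBound (g : E3 → ℝ) : ℝ≥0∞ :=
  sphereMeasure univ * ∫⁻ w, ENNReal.ofReal (g w * (1 + ‖w‖ ^ 2))

theorem rateBound_lt_top (hg : GasDensity g) : rateBound g < ∞ :=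
  ENNReal.mul_lt_top (measure_lt_top _ _) hg.moment

/-- A Lyapunov estimate: the jump generator applied to 1 + ‖v‖ is bounded by a constant. -/
theorem collisionIntegral_speedWeight_le (hg : GasDensity g) (v : E3) :
    collisionIntegral g v (fun ν w => speedWeight (collide v ν w)) ≤
      ENNReal.ofReal (collisionRate g v) * speedWeight v + 4 * rateBound g := by
  have hm := hg.meas
  have hpt : ∀ (ν : S2) (w : E3), ENNReal.ofReal (g w) * ENNReal.ofReal (flux v ν w) *
      speedWeight (collide v ν w) ≤ ENNReal.ofReal (g w) * ENNReal.ofReal (flux v ν w) *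
        1 * speedWeight v + 4 * ENNReal.ofReal (g w * (1 + ‖w‖ ^ 2)) := fun ν w => by
    have h4 : (4 : ℝ≥0∞) = ENNReal.ofReal 4 := by simp
    have hgw := hg.nonneg w
    have hfl := flux_nonneg v ν w
    rw [speedWeight, speedWeight, h4, mul_one, ← ENNReal.ofReal_mul hgw, ← ENNReal.ofReal_mul
      (mul_nonneg hgw hfl), ← ENNReal.ofReal_mul (mul_nonneg hgw hfl),
      ← ENNReal.ofReal_mul (by norm_num), ← ENNReal.ofReal_add (by positivity) (by positivity)]
    refine ENNReal.ofReal_le_ofReal ?_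
    nlinarith [mul_le_mul_of_nonneg_left (flux_mul_norm_collide_le v ν w) hgw]
  refine (lintegral_mono fun ν => lintegral_mono fun w => hpt ν w).trans_eq ?_
  rw [← collisionIntegral_eq_ofReal hg, collisionIntegral, rateBound]
  have h1 : ∀ ν : S2, ∫⁻ w : E3, ENNReal.ofReal (g w) * ENNReal.ofReal (flux v ν w) *
        1 * speedWeight v + 4 * ENNReal.ofReal (g w * (1 + ‖w‖ ^ 2)) =
      (∫⁻ w : E3, ENNReal.ofReal (g w) * ENNReal.ofReal (flux v ν w) * 1) * speedWeight v +
        4 * ∫⁻ w : E3, ENNReal.ofReal (g w * (1 + ‖w‖ ^ 2)) := fun ν => by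
    rw [lintegral_add_right _ (by fun_prop), lintegral_mul_const _ (by fun_prop),
      lintegral_const_mul _ (by fun_prop)]
  simp_rw [h1]
  rw [lintegral_add_right _ measurable_const, lintegral_const, lintegral_mul_const]
  · ring
  · exact Measurable.lintegral_prod_right' (f := fun p : S2 × E3 => ENNReal.ofReal (g p.2) *
      ENNReal.ofReal (flux v p.1 p.2) * 1) (by fun_prop)

/-- The integral `∫ₐᵗ exp(-(s - a) l) ds`. -/
def expIntegral (a t l : ℝ) : ℝ≥0∞ := ∫⁻ s in Ioc a t, ENNReal.ofReal (Real.exp (-((s - a) * l)))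

/-- An exponential clock started at time `a` either rings before `t` or does not. -/
theorem ofReal_mul_expIntegral_add {a t l : ℝ} (hat : a ≤ t) (hl : 0 ≤ l) :
    ENNReal.ofReal l * expIntegral a t l + ENNReal.ofReal (Real.exp (-((t - a) * l))) = 1 := by
  have h1 : ENNReal.ofReal l * expIntegral a t l =
      ENNReal.ofReal (∫ s in a..t, l * Real.exp (-((s - a) * l))) := by
    rw [expIntegral, ← lintegral_const_mul _ (by fun_prop), intervalIntegral.integral_of_le hat,
      ofReal_integral_eq_lintegral_ofReal]
    · simp_rw [ENNReal.ofReal_mul hl]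
    · exact (by fun_prop : Continuous fun s => l * Real.exp (-((s - a) * l))).integrableOn_Ioc
    · exact Filter.Eventually.of_forall fun s => by positivity
  have h2 : ∫ s in a..t, l * Real.exp (-((s - a) * l)) = 1 - Real.exp (-((t - a) * l)) := by
    rw [intervalIntegral.integral_eq_sub_of_hasDerivAt
      (f := fun s => -Real.exp (-((s - a) * l)))]
    · simp; ring
    · intro s _
      have h := ((((hasDerivAt_id s).sub_const a).mul_const l).neg.exp).neg
      refine (show HasDerivAt (fun s => -Real.exp (-((s - a) * l))) _ s from h).congr_deriv ?_
      simp [mul_comm]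
    · exact (by fun_prop : Continuous fun s => l * Real.exp (-((s - a) * l))).intervalIntegrable _ _
  rw [h1, h2, ← ENNReal.ofReal_add _ (Real.exp_nonneg _)]
  · simp
  · have : Real.exp (-((t - a) * l)) ≤ 1 :=
      Real.exp_le_one_iff.2 (neg_nonpos.2 (mul_nonneg (sub_nonneg.2 hat) hl))
    linarith

@[fun_prop]
theorem measurable_expIntegral {α : Type*} [MeasurableSpace α] {a t l : α → ℝ}
    (ha : Measurable a) (ht : Measurable t) (hl : Measurable l) :
    Measurable fun x => expIntegral (a x) (t x) (l x) := by
  have h : ∀ x, expIntegral (a x) (t x) (l x) = ∫⁻ s, {q : α × ℝ | q.2 ∈ Ioc (a q.1) (t q.1)}.indicator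
      (fun q => ENNReal.ofReal (Real.exp (-((q.2 - a q.1) * l q.1)))) (x, s) := fun x => by
    rw [expIntegral, ← lintegral_indicator measurableSet_Ioc]
    rfl
  simp_rw [h]
  refine Measurable.lintegral_prod_right' (Measurable.indicator (by fun_prop) ?_)
  exact measurableSet_and (measurableSet_lt (by fun_prop) (by fun_prop))
    (measurableSet_le (by fun_prop) (by fun_prop))

/-- Integral of `H(v)`, `v` the velocity after the `n`-th collision, over the `n`-th collision up
to time `t`. -/
def birthIntegral (g : E3 → ℝ) (v₀ : E3) (n : ℕ) (H : E3 → ℝ≥0∞) (t : ℝ) : ℝ≥0∞ :=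
  ∫⁻ m in {m : Fin n → Marker | Ordered n m t}, collisionWeight g v₀ n m *
    ENNReal.ofReal (Real.exp (-pathRate g v₀ n m (lastTime n m))) * H (finalVel v₀ n m)
      ∂markersMeasure n

/-- Integral of `H(v)`, `v` the velocity at time `t`, on the event of exactly `n` collisions. -/
def stateIntegral (g : E3 → ℝ) (v₀ : E3) (n : ℕ) (H : E3 → ℝ≥0∞) (t : ℝ) : ℝ≥0∞ :=
  ∫⁻ m in {m : Fin n → Marker | Ordered n m t}, collisionWeight g v₀ n m *
    ENNReal.ofReal (Real.exp (-pathRate g v₀ n m t)) * H (finalVel v₀ n m) ∂markersMeasure n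

/-- Integral of `H(v(s))` over the times `s ≤ t` after exactly `n` collisions. -/
def sojournIntegral (g : E3 → ℝ) (v₀ : E3) (n : ℕ) (H : E3 → ℝ≥0∞) (t : ℝ) : ℝ≥0∞ :=
  ∫⁻ m in {m : Fin n → Marker | Ordered n m t}, collisionWeight g v₀ n m *
    ENNReal.ofReal (Real.exp (-pathRate g v₀ n m (lastTime n m))) *
      (H (finalVel v₀ n m) * expIntegral (lastTime n m) t (collisionRate g (finalVel v₀ n m)))
      ∂markersMeasure n

theorem measurableSet_ordered_const (n : ℕ) (t : ℝ) :
    MeasurableSet {m : Fin n → Marker | Ordered n m t} :=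
  measurableSet_ordered measurable_id measurable_const

theorem exp_neg_pathRate (v₀ : E3) (n : ℕ) (m : Fin n → Marker) (t : ℝ) :
    ENNReal.ofReal (Real.exp (-pathRate g v₀ n m t)) =
      ENNReal.ofReal (Real.exp (-pathRate g v₀ n m (lastTime n m))) *
        ENNReal.ofReal (Real.exp (-((t - lastTime n m) * collisionRate g (finalVel v₀ n m)))) := by
  rw [← ENNReal.ofReal_mul (Real.exp_nonneg _), ← Real.exp_add, pathRate_eq_add v₀ n m t, neg_add]

theorem ordered_snoc_iff {n : ℕ} {m : Fin n → Marker} {x : Marker} {t : ℝ} :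
    Ordered (n + 1) (Fin.snoc m x) t ↔ Ordered n m t ∧ x.1 ∈ Ioc (lastTime n m) t := by
  simp only [Ordered, Fin.init_snoc, Fin.snoc_last, mem_Ioc]
  exact ⟨fun h => ⟨h.1.mono h.2.2, h.2⟩, fun h => ⟨h.1.of_lastTime_le h.2.1.le, h.2⟩⟩

/-- The last marker integrates out into an exponential waiting time after the previous collision,
times the collision integral at the velocity held during the wait. -/
theorem birthIntegral_succ (hg : GasDensity g) (v₀ : E3) (n : ℕ) {H : E3 → ℝ≥0∞}
    (hH : Measurable H) (t : ℝ) : birthIntegral g v₀ (n + 1) H t =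
      sojournIntegral g v₀ n
        (fun v => collisionIntegral g v (fun ν w => H (collide v ν w))) t := by
  have hm := hg.meas
  have hr := measurable_collisionRate hg
  rw [birthIntegral, ← lintegral_indicator (measurableSet_ordered_const _ t), lintegral_snoc,
    sojournIntegral, ← lintegral_indicator (measurableSet_ordered_const _ t)]
  swap
  · refine Measurable.indicator ?_ (measurableSet_ordered_const _ t)
    have h1 := measurable_collisionWeight hm (n := n + 1) (a := fun _ => v₀) measurable_const
      measurable_id
    have h2 := measurable_pathRate hg (n := n + 1) (a := fun _ => v₀) measurable_const
      measurable_id (c := fun m => lastTime (n + 1) m) (by fun_prop)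
    simp only [id] at h1 h2
    fun_prop
  refine lintegral_congr fun m => ?_
  by_cases hord : Ordered n m t
  swap
  · rw [indicator_of_notMem (s := {m | Ordered n m t}) hord]
    simp only [indicator]
    refine (lintegral_congr fun x => if_neg ?_).trans lintegral_zero
    exact fun h => hord (ordered_snoc_iff.1 h).1
  rw [indicator_of_mem (s := {m | Ordered n m t}) hord]
  set v := finalVel v₀ n m
  set c := collisionWeight g v₀ n m *
    ENNReal.ofReal (Real.exp (-pathRate g v₀ n m (lastTime n m)))
  have h1 : ∀ x : Marker, {m : Fin (n + 1) → Marker | Ordered (n + 1) m t}.indicator (fun m =>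
      collisionWeight g v₀ (n + 1) m *
      ENNReal.ofReal (Real.exp (-pathRate g v₀ (n + 1) m (lastTime (n + 1) m))) *
      H (finalVel v₀ (n + 1) m)) (Fin.snoc m x) = c * ((Ioc (lastTime n m) t).indicator
        (fun s => ENNReal.ofReal (Real.exp (-((s - lastTime n m) * collisionRate g v)))) x.1 *
        (ENNReal.ofReal (g x.2.2) * ENNReal.ofReal (flux v x.2.1 x.2.2) *
          H (collide v x.2.1 x.2.2))) := fun x => by
    by_cases hx : x.1 ∈ Ioc (lastTime n m) t
    · rw [indicator_of_mem (s := {m : Fin (n + 1) → Marker | Ordered (n + 1) m t})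
        (ordered_snoc_iff.2 ⟨hord, hx⟩), indicator_of_mem hx]
      have hlast : lastTime (n + 1) (Fin.snoc m x : Fin (n + 1) → Marker) = x.1 := by
        simp [lastTime]
      rw [hlast]
      simp only [collisionWeight, pathRate, finalVel, Fin.init_snoc, Fin.snoc_last,
        sub_self, zero_mul, add_zero]
      rw [exp_neg_pathRate v₀ n m x.1]
      simp only [c, v]
      ring
    · rw [indicator_of_notMem hx, zero_mul, mul_zero,
        indicator_of_notMem (s := {m : Fin (n + 1) → Marker | Ordered (n + 1) m t})]
      exact fun h => hx (ordered_snoc_iff.1 h).2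
  simp_rw [h1]
  have hind : Measurable ((Ioc (lastTime n m) t).indicator
      fun s => ENNReal.ofReal (Real.exp (-((s - lastTime n m) * collisionRate g v)))) :=
    Measurable.indicator (by fun_prop) measurableSet_Ioc
  rw [lintegral_const_mul _ (by fun_prop), lintegral_marker _ (by fun_prop)]
  congr 1
  have h2 : ∀ s : ℝ, ∫⁻ ν : S2, ∫⁻ w : E3, (Ioc (lastTime n m) t).indicator
      (fun s => ENNReal.ofReal (Real.exp (-((s - lastTime n m) * collisionRate g v)))) s *
        (ENNReal.ofReal (g w) * ENNReal.ofReal (flux v ν w) * H (collide v ν w))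
        ∂volume ∂sphereMeasure = (Ioc (lastTime n m) t).indicator
      (fun s => ENNReal.ofReal (Real.exp (-((s - lastTime n m) * collisionRate g v)))) s *
        collisionIntegral g v (fun ν w => H (collide v ν w)) := fun s => by
    rw [collisionIntegral, ← lintegral_const_mul]
    · refine lintegral_congr fun ν => ?_
      rw [lintegral_const_mul _ (by fun_prop)]
    · exact Measurable.lintegral_prod_right' (f := fun p : S2 × E3 => ENNReal.ofReal (g p.2) *
        ENNReal.ofReal (flux v p.1 p.2) * H (collide v p.1 p.2)) (by fun_prop)
  simp_rw [h2]
  rw [lintegral_mul_const _ hind, lintegral_indicator measurableSet_Ioc, expIntegral, mul_comm]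

/-- The survival factor up to the last collision times the waiting factor is the survival factor up
to time s; then Tonelli in s. -/
theorem sojournIntegral_le (hg : GasDensity g) (v₀ : E3) (n : ℕ) {H : E3 → ℝ≥0∞}
    (hH : Measurable H) (t : ℝ) :
    sojournIntegral g v₀ n H t ≤ ∫⁻ s in Ioc 0 t, stateIntegral g v₀ n H s := by
  have hm := hg.meas
  have hr := measurable_collisionRate hg
  have hw := measurable_collisionWeight hm (n := n) (a := fun _ : (Fin n → Marker) × ℝ => v₀)
    measurable_const measurable_fst
  have hp := measurable_pathRate hg (n := n) (a := fun _ : (Fin n → Marker) × ℝ => v₀)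
    measurable_const measurable_fst measurable_snd
  have hord : MeasurableSet {q : (Fin n → Marker) × ℝ | Ordered n q.1 q.2 ∧ q.2 ∈ Ioc 0 t} :=
    measurableSet_and (measurableSet_ordered measurable_fst measurable_snd)
      (measurable_snd measurableSet_Ioc)
  set F : (Fin n → Marker) × ℝ → ℝ≥0∞ :=
    {q : (Fin n → Marker) × ℝ | Ordered n q.1 q.2 ∧ q.2 ∈ Ioc 0 t}.indicator fun q =>
      collisionWeight g v₀ n q.1 * ENNReal.ofReal (Real.exp (-pathRate g v₀ n q.1 q.2)) *
        H (finalVel v₀ n q.1)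
  have hF : Measurable F := Measurable.indicator (by fun_prop) hord
  have h1 : ∫⁻ s in Ioc 0 t, stateIntegral g v₀ n H s =
      ∫⁻ m, ∫⁻ s, F (m, s) ∂volume ∂markersMeasure n := by
    rw [lintegral_lintegral_swap (f := fun m s => F (m, s)) hF.aemeasurable, ← lintegral_indicator measurableSet_Ioc]
    refine lintegral_congr fun s => ?_
    by_cases hs : s ∈ Ioc 0 t
    · rw [indicator_of_mem hs, stateIntegral, ← lintegral_indicator (measurableSet_ordered_const _ s)]
      refine lintegral_congr fun m => ?_
      exact indicator_eq_of_iff ⟨fun h => ⟨h, hs⟩, fun h => h.1⟩ fun _ => rfl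
    · rw [indicator_of_notMem hs]
      refine ((lintegral_congr fun m => ?_).trans lintegral_zero).symm
      exact indicator_of_notMem (fun h => hs h.2) _
  rw [h1, sojournIntegral, ← lintegral_indicator (measurableSet_ordered_const _ t)]
  refine lintegral_mono (indicator_le (s := {m : Fin n → Marker | Ordered n m t}) fun m hmt => ?_)
  rw [expIntegral, ← mul_assoc, ← lintegral_const_mul _ (by fun_prop),
    ← lintegral_indicator measurableSet_Ioc]
  refine lintegral_mono (indicator_le fun s hs => ?_)
  have hmem : (m, s) ∈ {q : (Fin n → Marker) × ℝ | Ordered n q.1 q.2 ∧ q.2 ∈ Ioc 0 t} :=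
    ⟨hmt.of_lastTime_le hs.1.le, hmt.lastTime_nonneg.trans_lt hs.1, hs.2⟩
  simp only [F]
  rw [indicator_of_mem hmem, exp_neg_pathRate v₀ n m s]
  exact le_of_eq (by ring)

theorem birthIntegral_zero (v₀ : E3) (H : E3 → ℝ≥0∞) (t : ℝ) :
    birthIntegral g v₀ 0 H t = H v₀ := by
  simp [birthIntegral, Ordered, collisionWeight, pathRate, lastTime, finalVel, markersMeasure]

/-- After its n-th collision the root either collides again by time t or survives until t. -/
theorem birthIntegral_add_eq (hg : GasDensity g) (v₀ : E3) (n : ℕ) {t : ℝ} (ht : 0 ≤ t)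
    {H : E3 → ℝ≥0∞} (hH : Measurable H) :
    sojournIntegral g v₀ n (fun v => ENNReal.ofReal (collisionRate g v) * H v) t +
      stateIntegral g v₀ n H t = birthIntegral g v₀ n H t := by
  have hm := hg.meas
  have hr := measurable_collisionRate hg
  have hw := measurable_collisionWeight hm (n := n) (a := fun _ : (Fin n → Marker) => v₀)
    measurable_const measurable_id
  have hp := measurable_pathRate hg (n := n) (a := fun _ : (Fin n → Marker) => v₀)
    measurable_const measurable_id (c := fun _ => t) (by fun_prop)
  simp only [id] at hw hp
  rw [sojournIntegral, stateIntegral, birthIntegral, ← lintegral_add_right _ (by fun_prop)]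
  refine setLIntegral_congr_fun (measurableSet_ordered_const _ t) fun m hm => ?_
  have h := ofReal_mul_expIntegral_add (hm.lastTime_le ht)
    (collisionRate_nonneg hg (finalVel v₀ n m))
  rw [exp_neg_pathRate v₀ n m t]
  calc _ = collisionWeight g v₀ n m *
          ENNReal.ofReal (Real.exp (-pathRate g v₀ n m (lastTime n m))) * H (finalVel v₀ n m) *
        (ENNReal.ofReal (collisionRate g (finalVel v₀ n m)) * expIntegral (lastTime n m) t
          (collisionRate g (finalVel v₀ n m)) + ENNReal.ofReal
          (Real.exp (-((t - lastTime n m) * collisionRate g (finalVel v₀ n m))))) := by ring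
    _ = _ := by rw [h, mul_one]

/-- Conservation of probability: fewer than n collisions by time t, or at least n. The sum
telescopes. -/
theorem sum_stateIntegral_add (hg : GasDensity g) (v₀ : E3) {t : ℝ} (ht : 0 ≤ t) (n : ℕ) :
    ∑ k ∈ Finset.range n, stateIntegral g v₀ k (fun _ => 1) t +
      birthIntegral g v₀ n (fun _ => 1) t = 1 := by
  induction n with
  | zero => simp [birthIntegral_zero]
  | succ n ih =>
    refine Eq.trans ?_ ih
    rw [Finset.sum_range_succ, birthIntegral_succ hg v₀ n measurable_const,
      ← birthIntegral_add_eq hg v₀ n ht (H := fun _ => 1) measurable_const]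
    simp only [collisionIntegral_eq_ofReal hg, mul_one]
    ring

theorem sum_lintegral_le {α : Type*} [MeasurableSpace α] {μ : Measure α} (F : ℕ → α → ℝ≥0∞)
    (n : ℕ) : ∑ k ∈ Finset.range n, ∫⁻ x, F k x ∂μ ≤ ∫⁻ x, ∑ k ∈ Finset.range n, F k x ∂μ := by
  induction n with
  | zero => simp
  | succ n ih =>
    simp_rw [Finset.sum_range_succ]
    exact (add_le_add_left ih _).trans (le_lintegral_add _ _)

/-- At each time s the states with fewer than n collisions carry mass at most one. -/
theorem sum_sojournIntegral_one_le (hg : GasDensity g) (v₀ : E3) (t : ℝ) (n : ℕ) :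
    ∑ k ∈ Finset.range n, sojournIntegral g v₀ k (fun _ => 1) t ≤ ENNReal.ofReal t := by
  calc ∑ k ∈ Finset.range n, sojournIntegral g v₀ k (fun _ => 1) t
      ≤ ∑ k ∈ Finset.range n, ∫⁻ s in Ioc 0 t, stateIntegral g v₀ k (fun _ => 1) s :=
        Finset.sum_le_sum fun k _ => sojournIntegral_le hg v₀ k measurable_const t
    _ ≤ ∫⁻ s in Ioc 0 t, ∑ k ∈ Finset.range n, stateIntegral g v₀ k (fun _ => 1) s :=
        sum_lintegral_le _ _
    _ ≤ ∫⁻ s in Ioc 0 t, 1 := by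
        refine setLIntegral_mono measurable_const fun s hs => ?_
        exact le_self_add.trans (sum_stateIntegral_add hg v₀ hs.1.le n).le
    _ = _ := by simp

/-- Dynkin's formula for 1 + ‖v‖ as an inequality. The loss term of the Lyapunov estimate cancels in
the telescoping sum, leaving a constant times the elapsed time. -/
theorem sum_stateIntegral_speedWeight_add_le (hg : GasDensity g) (v₀ : E3) {t : ℝ} (ht : 0 ≤ t)
    (n : ℕ) : ∑ k ∈ Finset.range n, stateIntegral g v₀ k speedWeight t +
      birthIntegral g v₀ n speedWeight t ≤ speedWeight v₀ +
        4 * rateBound g * ∑ k ∈ Finset.range n, sojournIntegral g v₀ k (fun _ => 1) t := by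
  have hm := hg.meas
  have hr := measurable_collisionRate hg
  induction n with
  | zero => simp [birthIntegral_zero]
  | succ n ih =>
    have hw := measurable_collisionWeight hm (n := n) (a := fun _ : (Fin n → Marker) => v₀)
      measurable_const measurable_id
    have hp := measurable_pathRate hg (n := n) (a := fun _ : (Fin n → Marker) => v₀)
      measurable_const measurable_id (c := fun m => lastTime n m) (by fun_prop)
    simp only [id] at hw hp
    have h1 : birthIntegral g v₀ (n + 1) speedWeight t ≤ sojournIntegral g v₀ n
        (fun v => ENNReal.ofReal (collisionRate g v) * speedWeight v) t +
          4 * rateBound g * sojournIntegral g v₀ n (fun _ => 1) t := by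
      rw [birthIntegral_succ hg v₀ n measurable_speedWeight]
      unfold sojournIntegral
      rw [← lintegral_const_mul _ (by fun_prop), ← lintegral_add_right _ (by fun_prop)]
      refine lintegral_mono fun m => ?_
      refine (mul_le_mul_right (mul_le_mul_left
        (collisionIntegral_speedWeight_le hg (finalVel v₀ n m)) _) _).trans_eq ?_
      ring
    have h2 := birthIntegral_add_eq hg v₀ n ht measurable_speedWeight
    rw [Finset.sum_range_succ, Finset.sum_range_succ, mul_add, ← add_assoc]
    refine le_trans ?_ (add_le_add_left ih _)
    rw [← h2]
    refine (add_le_add_right h1 _).trans_eq ?_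
    ring

/-- The n-th term is the probability of at least n collisions, so the sum is one plus their expected
number. The rate is at most a constant times 1 + ‖v‖, whose mean is controlled by the previous
estimates. -/
theorem tsum_birthIntegral_le (hg : GasDensity g) (v₀ : E3) (t : ℝ) :
    ∑' n, birthIntegral g v₀ n (fun _ => 1) t ≤ 1 + rateBound g * (ENNReal.ofReal t *
      (speedWeight v₀ + 4 * rateBound g * ENNReal.ofReal t)) := by
  have hm := hg.meas
  have hr := measurable_collisionRate hg
  rw [tsum_eq_zero_add' ENNReal.summable, birthIntegral_zero]
  refine add_le_add_right (ENNReal.tsum_le_of_sum_range_le fun n => ?_) _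
  calc ∑ k ∈ Finset.range n, birthIntegral g v₀ (k + 1) (fun _ => 1) t
      ≤ ∑ k ∈ Finset.range n, rateBound g * sojournIntegral g v₀ k speedWeight t := by
        refine Finset.sum_le_sum fun k _ => ?_
        have hw := measurable_collisionWeight hm (n := k) (a := fun _ : (Fin k → Marker) => v₀)
          measurable_const measurable_id
        have hp := measurable_pathRate hg (n := k) (a := fun _ : (Fin k → Marker) => v₀)
          measurable_const measurable_id (c := fun m => lastTime k m) (by fun_prop)
        simp only [id] at hw hp
        rw [birthIntegral_succ hg v₀ k measurable_const]
        unfold sojournIntegral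
        rw [← lintegral_const_mul _ (by fun_prop)]
        refine lintegral_mono fun m => ?_
        refine (mul_le_mul_right (mul_le_mul_left
          (collisionIntegral_le hg (finalVel v₀ k m)) _) _).trans_eq ?_
        rw [speedWeight, rateBound]
        ring
    _ ≤ rateBound g * ∫⁻ s in Ioc 0 t, ∑ k ∈ Finset.range n,
          stateIntegral g v₀ k speedWeight s := by
        rw [← Finset.mul_sum]
        refine mul_le_mul_right ((Finset.sum_le_sum fun k _ =>
          sojournIntegral_le hg v₀ k measurable_speedWeight t).trans (sum_lintegral_le _ _)) _
    _ ≤ rateBound g * ∫⁻ s in Ioc 0 t,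
          (speedWeight v₀ + 4 * rateBound g * ENNReal.ofReal t) := by
        refine mul_le_mul_right (setLIntegral_mono measurable_const fun s hs => ?_) _
        refine (le_self_add.trans (sum_stateIntegral_speedWeight_add_le hg v₀ hs.1.le n)).trans ?_
        refine add_le_add_right (mul_le_mul_right ?_ _) _
        exact (sum_sojournIntegral_one_le hg v₀ s n).trans (ENNReal.ofReal_le_ofReal hs.2)
    _ = _ := by
        rw [setLIntegral_const, Real.volume_Ioc, sub_zero]
        ring

/-- No explosion: a finite expected number of collisions makes the probability of at least n of them
tend to zero. -/
theorem tsum_stateIntegral (hg : GasDensity g) (v₀ : E3) {t : ℝ} (ht : 0 ≤ t) :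
    ∑' n, stateIntegral g v₀ n (fun _ => 1) t = 1 := by
  have hR := (rateBound_lt_top hg).ne
  have hfin : ∑' n, birthIntegral g v₀ n (fun _ => 1) t ≠ ∞ := by
    refine ne_top_of_le_ne_top ?_ (tsum_birthIntegral_le hg v₀ t)
    unfold speedWeight
    finiteness
  have h0 := ENNReal.tendsto_atTop_zero_of_tsum_ne_top hfin
  have h1 := (ENNReal.tendsto_nat_tsum fun n => stateIntegral g v₀ n (fun _ => 1) t).add h0
  simp only [sum_stateIntegral_add hg v₀ ht, add_zero] at h1
  exact tendsto_nhds_unique h1 tendsto_const_nhds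

/-! ### The idealized law on trees with a given number of collisions -/

theorem measurableSet_tree_iff {S : Set Tree} :
    MeasurableSet S ↔ ∀ n, MeasurableSet (treeMk n ⁻¹' S) :=
  MeasurableSpace.measurableSet_iInf

theorem treeMk_injective (n : ℕ) : Function.Injective (treeMk n) :=
  fun _ _ h => eq_of_heq (Sigma.mk.inj h).2

theorem measurableEmbedding_treeMk (n : ℕ) : MeasurableEmbedding (treeMk n) where
  injective := treeMk_injective n
  measurable := measurable_treeMk n
  measurableSet_image' := fun {s} hs => by
    refine measurableSet_tree_iff.2 fun k => ?_
    by_cases hk : k = n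
    · subst hk
      rwa [preimage_image_eq _ (treeMk_injective k)]
    · convert MeasurableSet.empty
      ext p
      simp only [mem_preimage, mem_image, mem_empty_iff_false, iff_false]
      rintro ⟨q, -, hq⟩
      exact hk (congrArg Sigma.fst hq).symm

theorem treeMk_mem_collisionTrees {T : ℝ} {n : ℕ} {p : (E3 × E3) × (Fin n → Marker)} :
    treeMk n p ∈ collisionTrees T ↔ p.1.1 ∈ unitCube ∧ Ordered n p.2 T := by
  rw [ordered_iff]
  rfl

theorem measurableSet_collisionTrees (T : ℝ) : MeasurableSet (collisionTrees T) := by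
  refine measurableSet_tree_iff.2 fun n => ?_
  have : treeMk n ⁻¹' collisionTrees T = {p | p.1.1 ∈ unitCube ∧ Ordered n p.2 T} := by
    ext p
    exact treeMk_mem_collisionTrees
  rw [this]
  exact measurableSet_and (measurableSet_unitCube.preimage (by fun_prop))
    (measurableSet_ordered (by fun_prop) measurable_const)

theorem idealDensity_nonneg {f : E3 × E3 → ℝ} (hf : ∀ z, 0 ≤ f z) (hg : GasDensity g)
    (z : E3 × E3) (n : ℕ) (m : Fin n → Marker) (t : ℝ) : 0 ≤ idealDensity f g z n m t := by
  induction n generalizing t with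
  | zero => exact mul_nonneg (Real.exp_nonneg _) (hf z)
  | succ n ih =>
    rw [idealDensity]
    split_ifs
    · exact mul_nonneg (mul_nonneg (mul_nonneg (Real.exp_nonneg _) (ih _ _)) (hg.nonneg _))
        (le_max_right _ _)
    · exact le_rfl

/-- Unrolling the recursion collects the survival factors of the flights into one exponential of the
rate integrated along the path. -/
theorem ofReal_idealDensity {f : E3 × E3 → ℝ} (hf : ∀ z, 0 ≤ f z) (hg : GasDensity g)
    (z : E3 × E3) {n : ℕ} {m : Fin n → Marker} {t : ℝ} (h : Ordered n m t) :
    ENNReal.ofReal (idealDensity f g z n m t) = ENNReal.ofReal (f z) *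
      collisionWeight g z.2 n m * ENNReal.ofReal (Real.exp (-pathRate g z.2 n m t)) := by
  induction n generalizing t with
  | zero =>
    rw [idealDensity, collisionWeight, pathRate, ENNReal.ofReal_mul (Real.exp_nonneg _), mul_one,
      mul_comm, neg_mul]
  | succ n ih =>
    have hnn := idealDensity_nonneg hf hg z n (Fin.init m) (m (Fin.last n)).1
    rw [idealDensity, if_pos h.2.2, ENNReal.ofReal_mul (mul_nonneg (mul_nonneg (Real.exp_nonneg _)
      hnn) (hg.nonneg _)), ENNReal.ofReal_mul (mul_nonneg (Real.exp_nonneg _) hnn),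
      ENNReal.ofReal_mul (Real.exp_nonneg _), ih h.1, collisionWeight, pathRate, neg_add,
      Real.exp_add, ENNReal.ofReal_mul (Real.exp_nonneg _), neg_mul, flux]
    ring

theorem idealDensity_of_not_ordered (f : E3 × E3 → ℝ) (z : E3 × E3) {n : ℕ} {m : Fin n → Marker}
    {t T : ℝ} (h : Ordered n m T) (h' : ¬ Ordered n m t) : idealDensity f g z n m t = 0 := by
  cases n with
  | zero => exact absurd trivial h'
  | succ n =>
    rw [idealDensity, if_neg]
    exact fun hle => h' ⟨h.1, h.2.1, hle⟩

/-- The density of the idealized distribution on trees with `n` collisions before time `t`. -/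
def idealWeight (f : E3 × E3 → ℝ) (g : E3 → ℝ) (t : ℝ) (n : ℕ)
    (p : (E3 × E3) × (Fin n → Marker)) : ℝ≥0∞ :=
  rootDensity f p.1 * (collisionWeight g p.1.2 n p.2 *
    ENNReal.ofReal (Real.exp (-pathRate g p.1.2 n p.2 t)))

/-- The density of the idealized distribution at the time of the `n`-th collision. -/
def birthWeight (f : E3 × E3 → ℝ) (g : E3 → ℝ) (n : ℕ)
    (p : (E3 × E3) × (Fin n → Marker)) : ℝ≥0∞ :=
  rootDensity f p.1 * (collisionWeight g p.1.2 n p.2 *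
    ENNReal.ofReal (Real.exp (-pathRate g p.1.2 n p.2 (lastTime n p.2))))

theorem measurable_idealWeight {f : E3 × E3 → ℝ} (hf : Measurable f) (hg : GasDensity g) (t : ℝ)
    (n : ℕ) : Measurable (idealWeight f g t n) := by
  have h1 := measurable_pathRate hg (n := n)
    (a := fun p : (E3 × E3) × (Fin n → Marker) => p.1.2) (by fun_prop) (b := fun p => p.2)
      (by fun_prop) (c := fun _ => t) (by fun_prop)
  have h2 := measurable_collisionWeight hg.meas (n := n)
    (a := fun p : (E3 × E3) × (Fin n → Marker) => p.1.2) (by fun_prop) (b := fun p => p.2)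
      (by fun_prop)
  have h3 := measurable_rootDensity hf
  unfold idealWeight
  fun_prop

theorem measurable_birthWeight {f : E3 × E3 → ℝ} (hf : Measurable f) (hg : GasDensity g)
    (n : ℕ) : Measurable (birthWeight f g n) := by
  have h1 := measurable_pathRate hg (n := n)
    (a := fun p : (E3 × E3) × (Fin n → Marker) => p.1.2) (by fun_prop) (b := fun p => p.2)
      (by fun_prop) (c := fun p => lastTime n p.2) (by fun_prop)
  have h2 := measurable_collisionWeight hg.meas (n := n)
    (a := fun p : (E3 × E3) × (Fin n → Marker) => p.1.2) (by fun_prop) (b := fun p => p.2)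
      (by fun_prop)
  have h3 := measurable_rootDensity hf
  unfold birthWeight
  fun_prop

/-- The time indicators in the recursive density restrict trees up to time T to those whose
collisions all occur by time t. -/
theorem idealLaw_apply {f : E3 × E3 → ℝ} (hf0 : ∀ z, 0 ≤ f z)
    (hg : GasDensity g) {t T : ℝ} (htT : t ≤ T) {S : Set Tree} (hS : MeasurableSet S) :
    idealLaw f g T t S = ∑' n, ∫⁻ p in {p : (E3 × E3) × (Fin n → Marker) | Ordered n p.2 t ∧
      treeMk n p ∈ S}, idealWeight f g t n p ∂(volume.prod (markersMeasure n)) := by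
  rw [idealLaw, withDensity_apply _ hS, treeVolume, Measure.restrict_restrict hS,
    Measure.restrict_sum_of_countable, lintegral_sum_measure]
  refine tsum_congr fun n => ?_
  have hSn := measurableSet_tree hS n
  have hSt := measurableSet_tree (measurableSet_collisionTrees T) n
  have hemb := measurableEmbedding_treeMk n
  have h1 := hemb.restrict_map ((volume : Measure (E3 × E3)).prod (markersMeasure n))
    (S ∩ collisionTrees T)
  have h2 := hemb.lintegral_map (μ := ((volume : Measure (E3 × E3)).prod
    (markersMeasure n)).restrict (treeMk n ⁻¹' (S ∩ collisionTrees T)))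
    (fun Φ => ENNReal.ofReal (idealDensity f g Φ.2.1 Φ.1 Φ.2.2 t))
  rw [← h1] at h2
  refine Eq.trans h2 ?_
  have hord : MeasurableSet {p : (E3 × E3) × (Fin n → Marker) | Ordered n p.2 t ∧
      treeMk n p ∈ S} := measurableSet_and (measurableSet_ordered (by fun_prop) measurable_const) hSn
  rw [preimage_inter, ← lintegral_indicator (hSn.inter hSt), ← lintegral_indicator hord]
  refine lintegral_congr fun p => ?_
  by_cases hcube : p.1.1 ∈ unitCube
  swap
  · have h3 : rootDensity f p.1 = 0 :=
      indicator_of_notMem (s := unitCube ×ˢ univ) (fun h => hcube h.1) _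
    rw [indicator_of_notMem fun h => hcube (treeMk_mem_collisionTrees.1 h.2).1]
    by_cases h4 : p ∈ {p : (E3 × E3) × (Fin n → Marker) | Ordered n p.2 t ∧ treeMk n p ∈ S}
    · rw [indicator_of_mem h4, idealWeight, h3, zero_mul]
    · rw [indicator_of_notMem h4]
  have h3 : rootDensity f p.1 = ENNReal.ofReal (f p.1) :=
    indicator_of_mem (s := unitCube ×ˢ univ) ⟨hcube, trivial⟩ _
  by_cases h4 : p ∈ {p : (E3 × E3) × (Fin n → Marker) | Ordered n p.2 t ∧ treeMk n p ∈ S}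
  · have h5 : p ∈ treeMk n ⁻¹' S ∩ treeMk n ⁻¹' collisionTrees T :=
      ⟨h4.2, treeMk_mem_collisionTrees.2 ⟨hcube, h4.1.mono htT⟩⟩
    rw [indicator_of_mem h4, indicator_of_mem h5, idealWeight, h3, ← mul_assoc]
    exact ofReal_idealDensity hf0 hg p.1 h4.1
  · rw [indicator_of_notMem h4]
    refine indicator_apply_eq_zero.2 fun h5 => ?_
    have h6 := idealDensity_of_not_ordered (g := g) f p.1 (treeMk_mem_collisionTrees.1 h5.2).2
      fun h => h4 ⟨h, h5.1⟩
    rw [show idealDensity f g (treeMk n p).2.1 (treeMk n p).1 (treeMk n p).2.2 t = 0 from h6,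
      ENNReal.ofReal_zero]

theorem lintegral_idealWeight {f : E3 × E3 → ℝ} (hf : Measurable f) (hg : GasDensity g) (t : ℝ)
    (n : ℕ) : ∫⁻ p in {p : (E3 × E3) × (Fin n → Marker) | Ordered n p.2 t},
      idealWeight f g t n p ∂(volume.prod (markersMeasure n)) =
        ∫⁻ z, rootDensity f z * stateIntegral g z.2 n (fun _ => 1) t := by
  have hord : MeasurableSet {p : (E3 × E3) × (Fin n → Marker) | Ordered n p.2 t} :=
    measurableSet_ordered (by fun_prop) measurable_const
  rw [← lintegral_indicator hord, lintegral_prod _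
    ((measurable_idealWeight hf hg t n).indicator hord).aemeasurable]
  refine lintegral_congr fun z => ?_
  have hw := measurable_collisionWeight hg.meas (n := n) (a := fun _ : (Fin n → Marker) => z.2)
    measurable_const measurable_id
  have hp := measurable_pathRate hg (n := n) (a := fun _ : (Fin n → Marker) => z.2)
    measurable_const measurable_id (c := fun _ => t) (by fun_prop)
  simp only [id] at hw hp
  rw [stateIntegral, ← lintegral_const_mul _ (by fun_prop),
    ← lintegral_indicator (measurableSet_ordered_const n t)]
  refine lintegral_congr fun m => indicator_eq_of_iff Iff.rfl fun _ => ?_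
  rw [idealWeight, mul_one]

theorem lintegral_birthWeight {f : E3 × E3 → ℝ} (hf : Measurable f) (hg : GasDensity g) (t : ℝ)
    (n : ℕ) : ∫⁻ p in {p : (E3 × E3) × (Fin n → Marker) | Ordered n p.2 t},
      birthWeight f g n p ∂(volume.prod (markersMeasure n)) =
        ∫⁻ z, rootDensity f z * birthIntegral g z.2 n (fun _ => 1) t := by
  have hord : MeasurableSet {p : (E3 × E3) × (Fin n → Marker) | Ordered n p.2 t} :=
    measurableSet_ordered (by fun_prop) measurable_const
  rw [← lintegral_indicator hord, lintegral_prod _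
    ((measurable_birthWeight hf hg n).indicator hord).aemeasurable]
  refine lintegral_congr fun z => ?_
  have hw := measurable_collisionWeight hg.meas (n := n) (a := fun _ : (Fin n → Marker) => z.2)
    measurable_const measurable_id
  have hp := measurable_pathRate hg (n := n) (a := fun _ : (Fin n → Marker) => z.2)
    measurable_const measurable_id (c := fun m => lastTime n m) (by fun_prop)
  simp only [id] at hw hp
  rw [birthIntegral, ← lintegral_const_mul _ (by fun_prop),
    ← lintegral_indicator (measurableSet_ordered_const n t)]
  refine lintegral_congr fun m => indicator_eq_of_iff Iff.rfl fun _ => ?_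
  rw [birthWeight, mul_one]

theorem measurable_stateIntegral (hg : GasDensity g) (n : ℕ) (t : ℝ) :
    Measurable fun z : E3 × E3 => stateIntegral g z.2 n (fun _ => 1) t := by
  have h1 := measurable_pathRate hg (n := n)
    (a := fun p : (E3 × E3) × (Fin n → Marker) => p.1.2) (by fun_prop) (b := fun p => p.2)
      (by fun_prop) (c := fun _ => t) (by fun_prop)
  have h2 := measurable_collisionWeight hg.meas (n := n)
    (a := fun p : (E3 × E3) × (Fin n → Marker) => p.1.2) (by fun_prop) (b := fun p => p.2)
      (by fun_prop)
  exact Measurable.lintegral_prod_right' (ν := (markersMeasure n).restrict {m | Ordered n m t})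
    (f := fun p : (E3 × E3) × (Fin n → Marker) => collisionWeight g p.1.2 n p.2 *
    ENNReal.ofReal (Real.exp (-pathRate g p.1.2 n p.2 t)) * 1) (by fun_prop)

theorem measurable_birthIntegral (hg : GasDensity g) (n : ℕ) (t : ℝ) :
    Measurable fun z : E3 × E3 => birthIntegral g z.2 n (fun _ => 1) t := by
  have h1 := measurable_pathRate hg (n := n)
    (a := fun p : (E3 × E3) × (Fin n → Marker) => p.1.2) (by fun_prop) (b := fun p => p.2)
      (by fun_prop) (c := fun p => lastTime n p.2) (by fun_prop)
  have h2 := measurable_collisionWeight hg.meas (n := n)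
    (a := fun p : (E3 × E3) × (Fin n → Marker) => p.1.2) (by fun_prop) (b := fun p => p.2)
      (by fun_prop)
  exact Measurable.lintegral_prod_right' (ν := (markersMeasure n).restrict {m | Ordered n m t})
    (f := fun p : (E3 × E3) × (Fin n → Marker) => collisionWeight g p.1.2 n p.2 *
    ENNReal.ofReal (Real.exp (-pathRate g p.1.2 n p.2 (lastTime n p.2))) * 1) (by fun_prop)

theorem idealLaw_univ {f : E3 × E3 → ℝ} (hf : Measurable f) (hf0 : ∀ z, 0 ≤ f z)
    (hg : GasDensity g) {t T : ℝ} (ht : 0 ≤ t) (htT : t ≤ T) :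
    idealLaw f g T t univ = ∫⁻ z, rootDensity f z := by
  have hr := measurable_rootDensity hf
  have hs := fun n => measurable_stateIntegral hg n t
  rw [idealLaw_apply hf0 hg htT MeasurableSet.univ]
  simp only [mem_univ, and_true]
  simp_rw [lintegral_idealWeight hf hg t]
  rw [← lintegral_tsum fun n => by have := hs n; fun_prop]
  refine lintegral_congr fun z => ?_
  rw [ENNReal.tsum_mul_left, tsum_stateIntegral hg z.2 ht, mul_one]

/-- Averaged over the initial law, the expected number of collisions is finite because 1 + ‖v₀‖ is
integrable. This is the majorant in the final limit. -/
theorem tsum_lintegral_birthWeight_lt_top {f : E3 × E3 → ℝ} (hf : Measurable f)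
    (hg : GasDensity g) (t : ℝ) (hmass : ∫⁻ z, rootDensity f z ≠ ∞)
    (hmom : ∫⁻ z, rootDensity f z * speedWeight z.2 ≠ ∞) :
    ∑' n, ∫⁻ p in {p : (E3 × E3) × (Fin n → Marker) | Ordered n p.2 t},
      birthWeight f g n p ∂(volume.prod (markersMeasure n)) < ∞ := by
  have hr := measurable_rootDensity hf
  have hs := fun n => measurable_birthIntegral hg n t
  have hR := (rateBound_lt_top hg).ne
  simp_rw [lintegral_birthWeight hf hg t]
  rw [← lintegral_tsum fun n => by have := hs n; fun_prop]
  simp_rw [ENNReal.tsum_mul_left]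
  calc ∫⁻ z, rootDensity f z * ∑' n, birthIntegral g z.2 n (fun _ => 1) t
      ≤ ∫⁻ z, ((1 + rateBound g * ENNReal.ofReal t * (4 * rateBound g * ENNReal.ofReal t)) *
          rootDensity f z + rateBound g * ENNReal.ofReal t *
            (rootDensity f z * speedWeight z.2)) := by
        refine lintegral_mono fun z => ?_
        refine (mul_le_mul_right (tsum_birthIntegral_le hg z.2 t) _).trans_eq ?_
        ring
    _ = (1 + rateBound g * ENNReal.ofReal t * (4 * rateBound g * ENNReal.ofReal t)) *
          (∫⁻ z, rootDensity f z) + rateBound g * ENNReal.ofReal t *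
            ∫⁻ z, rootDensity f z * speedWeight z.2 := by
        rw [lintegral_add_right _ (by fun_prop), lintegral_const_mul _ hr,
          lintegral_const_mul _ (by fun_prop)]
    _ < ∞ := by finiteness

/-! ### Trees without recollisions -/

theorem isClosed_range_latticeVec : IsClosed (range latticeVec) := by
  refine Metric.isClosed_of_pairwise_le_dist one_pos ?_
  rintro _ ⟨k, rfl⟩ _ ⟨l, rfl⟩ hne
  rw [dist_eq_norm, ← latticeVec_sub]
  exact one_le_norm_latticeVec fun h => hne (by rw [sub_eq_zero.1 h])

/-- The root takes over the normal velocity of its partner, so afterwards they separate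
tangentially: the distance still grows, but only to second order in time. -/
theorem inner_collide_sub (v : E3) (ν : S2) (w : E3) :
    inner ℝ (collide v ν w - w) (ν : E3) = 0 := by
  have h1 : inner ℝ (ν : E3) (ν : E3) = 1 := by simp
  rw [collide, sub_right_comm, inner_sub_left, real_inner_smul_left, h1, mul_one,
    real_inner_comm, sub_self]

/-- Around the `i`-th collision the root moves with constant velocity before and after it. -/
theorem exists_rootPos_eq_near {g : E3 → ℝ} (z : E3 × E3) {n : ℕ} {m : Fin n → Marker} {t : ℝ}
    (h : Ordered n m t) (i : Fin n) : ∃ η > 0, ∃ v : E3,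
      (collisionWeight g z.2 n m ≠ 0 → 0 < inner ℝ (v - (m i).2.2) ((m i).2.1 : E3)) ∧
      (∀ s ∈ Icc ((m i).1 - η) (m i).1, rootPos z n m s =
        rootPos z n m (m i).1 + (s - (m i).1) • v) ∧
      ∀ s ∈ Icc (m i).1 ((m i).1 + η), rootPos z n m s =
        rootPos z n m (m i).1 + (s - (m i).1) • collide v (m i).2.1 (m i).2.2 := by
  induction n generalizing t with
  | zero => exact i.elim0
  | succ n ih =>
    refine Fin.lastCases ?_ (fun i => ?_) i
    · refine ⟨(m (Fin.last n)).1 - lastTime n (Fin.init m), sub_pos.2 h.2.1,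
        finalVel z.2 n (Fin.init m), fun hw => ?_, fun s hs => ?_, fun s hs => ?_⟩
      · rw [collisionWeight] at hw
        have h1 := right_ne_zero_of_mul (right_ne_zero_of_mul hw)
        rw [ne_eq, ENNReal.ofReal_eq_zero, not_le, flux] at h1
        exact (lt_max_iff.1 h1).resolve_right (lt_irrefl _)
      · rw [rootPos_init z n m hs.2, rootPos_init z n m le_rfl,
          rootPos_of_lastTime_le z n _ (by linarith [hs.1]),
          rootPos_of_lastTime_le z n (Fin.init m) h.2.1.le, add_assoc, ← add_smul]
        congr 2
        ring
      · exact rootPos_of_lastTime_le z (n + 1) m hs.1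
    · obtain ⟨η, hη, v, h1, h2, h3⟩ := ih h.1 i
      have hlt : (m i.castSucc).1 < (m (Fin.last n)).1 :=
        (ordered_iff.1 h).2 (Fin.castSucc_lt_last i)
      have hle := h.init_le i
      refine ⟨min η ((m (Fin.last n)).1 - (m i.castSucc).1), lt_min hη (sub_pos.2 hlt), v,
        fun hw => h1 (left_ne_zero_of_mul hw), fun s hs => ?_, fun s hs => ?_⟩
      · rw [rootPos_init z n m (hs.2.trans hle), rootPos_init z n m hle]
        exact h2 s ⟨(sub_le_sub_left (min_le_left _ _) _).trans hs.1, hs.2⟩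
      · have hs2 : s ≤ (m (Fin.last n)).1 := by
          have := hs.2.trans (add_le_add_right (min_le_right _ _) _)
          linarith
        rw [rootPos_init z n m hs2, rootPos_init z n m hle]
        exact h3 s ⟨hs.1, hs.2.trans (add_le_add_right (min_le_left _ _) _)⟩

theorem lt_norm_sub_smul_of_inner_neg {a ν : E3} (hν : ‖ν‖ = 1) (ha : inner ℝ a ν < 0) {ε : ℝ}
    (hε : 0 < ε) : ε < ‖a - ε • ν‖ := by
  refine lt_of_pow_lt_pow_left₀ 2 (norm_nonneg _) ?_
  rw [@norm_sub_sq_real, real_inner_smul_right, norm_smul, hν, Real.norm_of_nonneg hε.le]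
  nlinarith [mul_pos hε (neg_pos.2 ha), sq_nonneg ‖a‖]

theorem lt_norm_sub_smul_of_inner_eq_zero {a ν : E3} (hν : ‖ν‖ = 1) (ha : inner ℝ a ν = 0)
    (ha0 : a ≠ 0) {ε : ℝ} (hε : 0 < ε) : ε < ‖a - ε • ν‖ := by
  refine lt_of_pow_lt_pow_left₀ 2 (norm_nonneg _) ?_
  rw [@norm_sub_sq_real, real_inner_smul_right, norm_smul, hν, Real.norm_of_nonneg hε.le, ha]
  nlinarith [norm_pos_iff.2 ha0]

/-- Away from the collision time, compactness separates root and partner by a fixed gap. Near it,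
the other translates are too far away. For the colliding translate, the incoming relative velocity
has positive normal part, so the distance exceeds ε before the collision; the outgoing relative
velocity is orthogonal to ν and nonzero, so it exceeds ε afterwards. The nonzero weight excludes
grazing collisions. -/
theorem eventually_goodTree {g : E3 → ℝ} {T : ℝ} {z : E3 × E3} {n : ℕ} {m : Fin n → Marker}
    (hord : Ordered n m T) (hw : collisionWeight g z.2 n m ≠ 0) (h0 : GoodTree 0 T z n m) :
    ∀ᶠ ε in nhdsWithin (0 : ℝ) (Ioi 0), GoodTree ε T z n m := by
  refine Filter.eventually_all.2 fun i => ?_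
  obtain ⟨η₀, hη₀, v, hpos, hbefore, hafter⟩ := exists_rootPos_eq_near (g := g) z hord i
  replace hpos := hpos hw
  obtain ⟨t, ν, w, hmi⟩ : ∃ t ν w, m i = (t, ν, w) := ⟨_, _, _, rfl⟩
  have hν : ‖(ν : E3)‖ = 1 := by simp
  simp only [hmi] at hpos hbefore hafter ⊢
  -- The displacement of the root from its partner in the point-particle picture; at diameter ε it
  -- is shifted by -εν.
  set D : ℝ → E3 := fun s => rootPos z n m s - rootPos z n m t - (s - t) • w with hD
  have hDc : Continuous D := by
    have := continuous_rootPos z n m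
    fun_prop
  have hD0 : ∀ s ∈ Icc 0 T, s ≠ t → ∀ k, D s ≠ latticeVec k := by
    intro s hs hst k he
    have h1 := h0 i k s hs (by rw [hmi]; exact abs_pos.2 (sub_ne_zero.2 hst))
    rw [hmi] at h1
    simp only [zero_smul, add_zero, sub_zero] at h1
    refine (norm_pos_iff.1 h1) ?_
    rw [← he]
    simp only [hD]
    abel
  have hDt : D t = 0 := by simp [hD]
  have hrw : ∀ (ε s : ℝ) k, rootPos z n m s - (rootPos z n m t + ε • (ν : E3) + (s - t) • w +
      latticeVec k) = D s - ε • (ν : E3) - latticeVec k := fun ε s k => by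
    simp only [hD]
    abel
  simp only [hrw]
  obtain ⟨η₁, hη₁, hnear⟩ := Metric.continuousAt_iff.1 (hDc.continuousAt (x := t)) (1 / 4)
    (by norm_num)
  rw [hDt] at hnear
  set η := min η₀ η₁
  have hη : 0 < η := lt_min hη₀ hη₁
  have hK : IsCompact (Icc 0 T ∩ {s | η ≤ |s - t|}) :=
    isCompact_Icc.inter_right (isClosed_le continuous_const (by fun_prop))
  -- Outside the window around `t` the displacements form a compact set disjoint from the closed
  -- lattice, so `r` is a uniform gap. The shift by ε then requires 2ε < r.
  obtain ⟨r, hr, hfar⟩ := Metric.exists_pos_forall_lt_edist (hK.image hDc)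
    isClosed_range_latticeVec (by
      rw [disjoint_left]
      rintro _ ⟨s, hs, rfl⟩ ⟨k, hk⟩
      refine hD0 s hs.1 (fun h => ?_) k hk.symm
      have : η ≤ |s - t| := hs.2
      rw [h, sub_self, abs_zero] at this
      linarith)
  have hr' : 0 < (r : ℝ) := hr
  filter_upwards [Ioo_mem_nhdsGT (show 0 < min (1 / 8 : ℝ) (r / 2) by positivity)]
    with ε hε k s hs hst
  have hε0 : 0 < ε := hε.1
  have hε1 : ε < 1 / 8 := hε.2.trans_le (min_le_left _ _)
  have hε2 : ε < r / 2 := hε.2.trans_le (min_le_right _ _)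
  have hst' : s ≠ t := sub_ne_zero.1 (abs_pos.1 hst)
  have hεν : ‖ε • (ν : E3)‖ = ε := by rw [norm_smul, hν, Real.norm_of_nonneg hε0.le, mul_one]
  rw [sub_pos]
  rcases le_or_gt η |s - t| with hsη | hsη
  · have h1 := hfar (D s) (mem_image_of_mem D ⟨hs, hsη⟩) (latticeVec k) ⟨k, rfl⟩
    have h2 : (r : ℝ) < ‖D s - latticeVec k‖ := by
      rw [← dist_eq_norm]
      rw [edist_dist, ENNReal.coe_nnreal_eq] at h1
      exact (ENNReal.ofReal_lt_ofReal_iff_of_nonneg r.coe_nonneg).1 h1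
    have h3 : D s - ε • (ν : E3) - latticeVec k = D s - latticeVec k - ε • (ν : E3) := by abel
    rw [h3]
    have h4 := norm_sub_norm_le (D s - latticeVec k) (ε • (ν : E3))
    linarith
  by_cases hk : k = 0
  · rw [hk, latticeVec_zero, sub_zero]
    rcases lt_or_gt_of_ne hst' with hlt | hgt
    · have hDs : D s = (s - t) • (v - w) := by
        simp only [hD]
        rw [hbefore s ⟨?_, hlt.le⟩, smul_sub]
        · abel
        · rw [abs_of_neg (sub_neg.2 hlt)] at hsη
          have := hsη.trans_le (min_le_left η₀ η₁)
          linarith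
      refine lt_norm_sub_smul_of_inner_neg hν ?_ hε0
      rw [hDs, real_inner_smul_left]
      exact mul_neg_of_neg_of_pos (sub_neg.2 hlt) hpos
    · have hDs : D s = (s - t) • (collide v ν w - w) := by
        simp only [hD]
        rw [hafter s ⟨hgt.le, ?_⟩, smul_sub]
        · abel
        · rw [abs_of_pos (sub_pos.2 hgt)] at hsη
          have := hsη.trans_le (min_le_left η₀ η₁)
          linarith
      refine lt_norm_sub_smul_of_inner_eq_zero hν ?_ ?_ hε0
      · rw [hDs, real_inner_smul_left, inner_collide_sub, mul_zero]
      · have := hD0 s hs hst' 0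
        rwa [latticeVec_zero] at this
  -- A nonzero translate is at distance at least 1 - 1/4 - ε > ε, because ε < 1/8.
  · have h1 := one_le_norm_latticeVec hk
    have h2 : ‖D s‖ < 1 / 4 := by
      have := hnear (x := s) (by
        rw [Real.dist_eq]
        exact hsη.trans_le (min_le_right _ _))
      rwa [dist_zero_right] at this
    have h3 := norm_sub_norm_le (latticeVec k) (D s - ε • (ν : E3))
    rw [norm_sub_rev (latticeVec k)] at h3
    have h4 := norm_sub_le (D s) (ε • (ν : E3))
    linarith

/-- Such a set lies in a single translate of a proper subspace. -/
theorem volume_eq_zero_of_sub_mem {K : Submodule ℝ E3} (hK : K ≠ ⊤) {A : Set E3}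
    (hA : ∀ a ∈ A, ∀ b ∈ A, b - a ∈ K) : volume A = 0 := by
  rcases A.eq_empty_or_nonempty with rfl | ⟨a, ha⟩
  · simp
  have h : A ⊆ (fun x => x - a) ⁻¹' (K : Set E3) := fun b hb => hA a ha b hb
  refine measure_mono_null h ?_
  rw [(measurePreserving_sub_right volume a).measure_preimage
    (Submodule.closed_of_finiteDimensional K).measurableSet.nullMeasurableSet]
  exact Measure.addHaar_submodule volume K hK

theorem span_pair_ne_top (a b : E3) : Submodule.span ℝ {a, b} ≠ ⊤ := by
  intro h
  have h1 := finrank_span_finset_le_card (R := ℝ) ({a, b} : Finset E3)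
  rw [Set.finrank, Finset.coe_pair, h, finrank_top, finrank_euclideanSpace_fin] at h1
  have := Finset.card_le_two (a := a) (b := b)
  omega

theorem span_singleton_ne_top (a : E3) : Submodule.span ℝ {a} ≠ ⊤ := by
  have := span_pair_ne_top a a
  rwa [pair_eq_singleton] at this

/-- Surface measure is given by the volume of the cone over a set, and this cone lies in a line. -/
theorem ae_sphere_notMem_span (c : E3) : ∀ᵐ ν : S2 ∂sphereMeasure, (ν : E3) ∉ Submodule.span ℝ {c} := by
  have hcl : MeasurableSet {ν : S2 | (ν : E3) ∈ Submodule.span ℝ {c}} :=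
    (Submodule.closed_of_finiteDimensional (Submodule.span ℝ {c})).measurableSet.preimage
      measurable_subtype_coe
  rw [ae_iff]
  simp only [not_not]
  rw [Measure.toSphere_apply' _ hcl]
  refine mul_eq_zero_of_right _ (measure_mono_null ?_
    (Measure.addHaar_submodule volume _ (span_singleton_ne_top c)))
  rintro _ ⟨r, -, _, ⟨ν, hν, rfl⟩, rfl⟩
  exact Submodule.smul_mem _ r hν

/-- The path of the root consists of finitely many straight lines. -/
theorem exists_finite_rootPos (z : E3 × E3) (n : ℕ) (m : Fin n → Marker) :
    ∃ F : Set (E3 × E3), F.Finite ∧ ∀ s, ∃ q ∈ F, rootPos z n m s = q.1 + s • q.2 := by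
  induction n with
  | zero => exact ⟨{z}, finite_singleton z, fun s => ⟨z, rfl, rfl⟩⟩
  | succ n ih =>
    obtain ⟨F, hF, h⟩ := ih (Fin.init m)
    refine ⟨insert (rootPos z n (Fin.init m) (m (Fin.last n)).1 -
      (m (Fin.last n)).1 • finalVel z.2 (n + 1) m, finalVel z.2 (n + 1) m) F, hF.insert _,
      fun s => ?_⟩
    rw [rootPos]
    split_ifs with hs
    · obtain ⟨q, hq, he⟩ := h s
      exact ⟨q, mem_insert_of_mem _ hq, he⟩
    · refine ⟨_, mem_insert _ _, ?_⟩
      simp only [sub_smul]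
      abel

/-- For each of the finitely many straight pieces of the path and each translate, a contact at a
time other than τ confines `w` to an affine line. -/
theorem ae_no_contact_before (z : E3 × E3) (n : ℕ) (m : Fin n → Marker) (τ : ℝ) :
    ∀ᵐ w : E3, ∀ k s, s ≠ τ →
      rootPos z n m s ≠ rootPos z n m τ + (s - τ) • w + latticeVec k := by
  obtain ⟨F, hF, h⟩ := exists_finite_rootPos z n m
  have key : ∀ k, ∀ q ∈ F, ∀ᵐ w : E3, w - q.2 ∉ Submodule.span ℝ
      {q.1 + τ • q.2 - rootPos z n m τ - latticeVec k} := fun k q _ => by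
    rw [ae_iff]
    simp only [not_not]
    refine volume_eq_zero_of_sub_mem (span_singleton_ne_top
      (q.1 + τ • q.2 - rootPos z n m τ - latticeVec k)) fun a ha b hb => ?_
    have := Submodule.sub_mem (Submodule.span ℝ _) hb ha
    rwa [sub_sub_sub_cancel_right] at this
  have hall : ∀ᵐ w : E3, ∀ k, ∀ q ∈ F, w - q.2 ∉ Submodule.span ℝ
      {q.1 + τ • q.2 - rootPos z n m τ - latticeVec k} :=
    ae_all_iff.2 fun k => (ae_ball_iff hF.countable).2 (key k)
  filter_upwards [hall] with w hw k s hs he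
  obtain ⟨q, hq, hqs⟩ := h s
  refine hw k q hq (Submodule.mem_span_singleton.2 ⟨(s - τ)⁻¹, ?_⟩)
  have hne : s - τ ≠ 0 := sub_ne_zero.2 hs
  rw [inv_smul_eq_iff₀ hne]
  rw [hqs] at he
  have h1 : q.1 = rootPos z n m τ + (s - τ) • w + latticeVec k - s • q.2 := eq_sub_of_add_eq he
  rw [h1, smul_sub, sub_smul s τ q.2]
  abel

/-- Meeting the partner of the last collision again around the torus makes the outgoing relative
velocity a multiple of a lattice vector. Then v - w lies in the plane spanned by ν and that vector.
-/
theorem ae_no_contact_after_self (y v : E3) (ν : S2) :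
    ∀ᵐ w : E3, ∀ k, ∀ s : ℝ, s ≠ 0 →
      y + s • collide v ν w ≠ y + s • w + latticeVec k := by
  refine ae_all_iff.2 fun k => ?_
  rw [ae_iff]
  refine volume_eq_zero_of_sub_mem (span_pair_ne_top (ν : E3) (latticeVec k)) fun a ha b hb => ?_
  have key : ∀ w ∈ {w : E3 | ¬ ∀ s : ℝ, s ≠ 0 →
      y + s • collide v ν w ≠ y + s • w + latticeVec k},
      v - w ∈ Submodule.span ℝ {(ν : E3), latticeVec k} := by
    intro w hw
    simp only [mem_ofPred_eq, not_forall, not_not] at hw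
    obtain ⟨s, hs, he⟩ := hw
    refine Submodule.mem_span_pair.2 ⟨inner ℝ (ν : E3) (v - w), s⁻¹, ?_⟩
    have h1 : latticeVec k = s • (collide v ν w - w) := by
      rw [add_assoc] at he
      rw [smul_sub, add_left_cancel he]
      abel
    rw [h1, inv_smul_smul₀ hs, collide]
    abel
  have := Submodule.sub_mem _ (key a ha) (key b hb)
  rwa [sub_sub_sub_cancel_left] at this

/-- A contact with an earlier partner confines the outgoing velocity to a line of direction c. Two
outgoing velocities differ by a multiple of ν, which is not on that line, so the bad w share their
component along ν and lie in a plane. -/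
theorem ae_no_contact_after {c : E3} (v w₀ : E3) {ν : S2}
    (hν : (ν : E3) ∉ Submodule.span ℝ {c}) :
    ∀ᵐ w : E3, ∀ s : ℝ, s ≠ 0 → c + s • (collide v ν w - w₀) ≠ 0 := by
  have hν1 : inner ℝ (ν : E3) (ν : E3) = 1 := by simp
  have hK : (Submodule.span ℝ {(ν : E3)})ᗮ ≠ ⊤ := by
    rw [ne_eq, Submodule.orthogonal_eq_top_iff, Submodule.span_singleton_eq_bot]
    intro h
    rw [h, inner_zero_left] at hν1
    exact zero_ne_one hν1
  rw [ae_iff]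
  refine volume_eq_zero_of_sub_mem hK fun a ha b hb => ?_
  have key : ∀ w ∈ {w : E3 | ¬ ∀ s : ℝ, s ≠ 0 → c + s • (collide v ν w - w₀) ≠ 0},
      collide v ν w - w₀ ∈ Submodule.span ℝ {c} := by
    intro w hw
    simp only [mem_ofPred_eq, not_forall, not_not] at hw
    obtain ⟨s, hs, he⟩ := hw
    refine Submodule.mem_span_singleton.2 ⟨-s⁻¹, ?_⟩
    rw [neg_smul, ← smul_neg, inv_smul_eq_iff₀ hs]
    exact neg_eq_of_add_eq_zero_right he
  have h1 := Submodule.sub_mem _ (key b hb) (key a ha)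
  have h2 : collide v ν b - w₀ - (collide v ν a - w₀) = inner ℝ (ν : E3) (b - a) • (ν : E3) := by
    simp only [collide, inner_sub_right, sub_smul]
    abel
  rw [h2] at h1
  rw [Submodule.mem_orthogonal_singleton_iff_inner_right]
  by_contra hne
  exact hν ((Submodule.smul_mem_iff _ hne).1 h1)

theorem goodTree_zero_iff {T : ℝ} {z : E3 × E3} {n : ℕ} {m : Fin n → Marker} :
    GoodTree 0 T z n m ↔ ∀ i k, ∀ s ∈ Icc 0 T, s ≠ (m i).1 → rootPos z n m s ≠
      rootPos z n m (m i).1 + (s - (m i).1) • (m i).2.2 + latticeVec k := by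
  simp only [GoodTree, zero_smul, add_zero, sub_zero, norm_pos_iff, abs_pos, sub_ne_zero]

/-- A new collision can create a recollision in three ways: the new partner touched the root before,
it touches it again, or an earlier partner touches it on the new flight. The direction ν must avoid
countably many lines for the third. -/
theorem ae_goodTree_snoc {T : ℝ} {z : E3 × E3} {n : ℕ} {m : Fin n → Marker}
    (h0 : GoodTree 0 T z n m) (hord : Ordered n m T) (τ : ℝ) :
    ∀ᵐ ν : S2 ∂sphereMeasure, ∀ᵐ w : E3, Ordered (n + 1) (Fin.snoc m (τ, ν, w)) T →
      GoodTree 0 T z (n + 1) (Fin.snoc m (τ, ν, w)) := by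
  by_cases hτ : τ ∈ Ioc (lastTime n m) T
  swap
  · exact ae_of_all _ fun ν => ae_of_all _ fun w h => absurd (ordered_snoc_iff.1 h).2 hτ
  have hmτ : ∀ i, (m i).1 < τ := fun i => (le_lastTime (ordered_iff.1 hord).2 i).trans_lt hτ.1
  rw [goodTree_zero_iff] at h0
  set c : Fin n → (Fin 3 → ℤ) → E3 := fun i k => rootPos z n m τ -
    (rootPos z n m (m i).1 + (τ - (m i).1) • (m i).2.2 + latticeVec k) with hc
  have hae : ∀ᵐ ν : S2 ∂sphereMeasure, ∀ i k, (ν : E3) ∉ Submodule.span ℝ {c i k} :=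
    ae_all_iff.2 fun i => ae_all_iff.2 fun k => ae_sphere_notMem_span _
  filter_upwards [hae] with ν hν
  have hafter : ∀ᵐ w : E3, ∀ i k, ∀ s : ℝ, s ≠ 0 →
      c i k + s • (collide (finalVel z.2 n m) ν w - (m i).2.2) ≠ 0 :=
    ae_all_iff.2 fun i => ae_all_iff.2 fun k =>
      ae_no_contact_after (finalVel z.2 n m) (m i).2.2 (hν i k)
  filter_upwards [ae_no_contact_before z n m τ,
    ae_no_contact_after_self (rootPos z n m τ) (finalVel z.2 n m) ν, hafter] with w h1 h2 h3 _
  have hold : ∀ s ≤ τ, rootPos z (n + 1) (Fin.snoc m (τ, ν, w)) s = rootPos z n m s := by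
    intro s hs
    rw [rootPos_init z n _ (by simpa using hs), Fin.init_snoc]
  have hnew : ∀ s, τ < s → rootPos z (n + 1) (Fin.snoc m (τ, ν, w)) s =
      rootPos z n m τ + (s - τ) • collide (finalVel z.2 n m) ν w := by
    intro s hs
    rw [rootPos, if_neg (by simpa using hs)]
    simp [finalVel]
  rw [goodTree_zero_iff]
  intro i k s hs
  refine Fin.lastCases ?_ (fun i => ?_) i
  · simp only [Fin.snoc_last, hold τ le_rfl]
    intro hne
    rcases lt_or_gt_of_ne hne with hlt | hgt
    · rw [hold s hlt.le]
      exact h1 k s hne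
    · rw [hnew s hgt]
      exact h2 k (s - τ) (sub_ne_zero.2 hne)
  · simp only [Fin.snoc_castSucc, hold _ (hmτ i).le]
    intro hne
    rcases le_or_gt s τ with hle | hgt
    · rw [hold s hle]
      exact h0 i k s hs hne
    · rw [hnew s hgt]
      intro he
      refine h3 i k (s - τ) (sub_ne_zero.2 hgt.ne') ?_
      simp only [hc]
      rw [smul_sub, eq_sub_of_add_eq he, ← sub_eq_zero]
      module

/-- Tonelli, adding one collision at a time. -/
theorem ae_goodTree (T : ℝ) (z : E3 × E3) (n : ℕ) :
    ∀ᵐ m ∂markersMeasure n, Ordered n m T → GoodTree 0 T z n m := by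
  induction n with
  | zero => exact ae_of_all _ fun m _ i => i.elim0
  | succ n ih =>
    have hmeas : ∀ n, MeasurableSet {m : Fin n → Marker | ¬ (Ordered n m T → GoodTree 0 T z n m)} :=
      fun n => measurableSet_not (by
        have : {m : Fin n → Marker | Ordered n m T → GoodTree 0 T z n m} =
            {m | ¬ Ordered n m T ∨ GoodTree 0 T z n m} := by
          ext m
          exact imp_iff_not_or
        rw [this]
        exact measurableSet_or (measurableSet_not (measurableSet_ordered_const n T))
          (measurableSet_goodTree 0 T measurable_const measurable_id))
    rw [ae_iff, ← lintegral_indicator_one (hmeas (n + 1)),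
      lintegral_snoc _ (measurable_one.indicator (hmeas (n + 1)))]
    refine (lintegral_congr_ae ?_).trans lintegral_zero
    filter_upwards [ih] with m hm
    have hmb := (measurable_one.indicator (hmeas (n + 1)) :
      Measurable (indicator {m : Fin (n + 1) → Marker |
        ¬ (Ordered (n + 1) m T → GoodTree 0 T z (n + 1) m)} (1 : (Fin (n + 1) → Marker) → ℝ≥0∞)))
    rw [lintegral_marker _ (by fun_prop)]
    refine (lintegral_congr fun τ => ?_).trans lintegral_zero
    by_cases hord : Ordered n m T
    · refine (lintegral_congr_ae ?_).trans lintegral_zero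
      filter_upwards [ae_goodTree_snoc (hm hord) hord τ] with ν hν
      refine (lintegral_congr_ae ?_).trans lintegral_zero
      filter_upwards [hν] with w hw
      exact indicator_of_notMem (s := {m : Fin (n + 1) → Marker |
        ¬ (Ordered (n + 1) m T → GoodTree 0 T z (n + 1) m)})
        (fun h => h hw) _
    · refine (lintegral_congr fun ν => ?_).trans lintegral_zero
      refine (lintegral_congr fun w => ?_).trans lintegral_zero
      exact indicator_of_notMem (s := {m : Fin (n + 1) → Marker |
        ¬ (Ordered (n + 1) m T → GoodTree 0 T z (n + 1) m)})
        (fun h => h fun h' => absurd (ordered_snoc_iff.1 h').1 hord) _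

/-! ### Comparison of the two densities -/

/-- From 1 + A ≤ e^A follows e^(-A)(1 - A²) ≤ 1 - A. Raise this to the power N and apply Bernoulli
to the factor 1 - A². -/
theorem exp_mul_le_one_sub_pow {A : ℝ} (hA0 : 0 ≤ A) (hA1 : A ≤ 1) (N : ℕ) :
    Real.exp (-(N * A)) * (1 - N * A ^ 2) ≤ (1 - A) ^ N := by
  have h1 : Real.exp (-A) * (1 - A ^ 2) ≤ 1 - A := by
    rw [Real.exp_neg, inv_mul_le_iff₀ (Real.exp_pos A)]
    nlinarith [Real.add_one_le_exp A]
  have h2 : 1 - N * A ^ 2 ≤ (1 - A ^ 2) ^ N := by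
    have := one_add_mul_le_pow (a := -A ^ 2) (by nlinarith) N
    rw [← sub_eq_add_neg] at this
    linarith
  calc Real.exp (-(N * A)) * (1 - N * A ^ 2)
      ≤ Real.exp (-(N * A)) * (1 - A ^ 2) ^ N :=
        mul_le_mul_of_nonneg_left h2 (Real.exp_nonneg _)
    _ = (Real.exp (-A) * (1 - A ^ 2)) ^ N := by
        rw [mul_pow, ← Real.exp_nat_mul, mul_neg]
    _ ≤ (1 - A) ^ N := by
        refine pow_le_pow_left₀ (mul_nonneg (Real.exp_nonneg _) ?_) h1 N
        nlinarith

/-- Volume of the unit ball. -/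
def ballVolume : ℝ := (volume (Metric.ball (0 : E3) 1)).toReal

theorem ballVolume_nonneg : 0 ≤ ballVolume := ENNReal.toReal_nonneg

theorem volume_ball_eq {r : ℝ} (hr : 0 ≤ r) :
    volume (Metric.ball (0 : E3) r) = ENNReal.ofReal (ballVolume * r ^ 3) := by
  rw [Measure.addHaar_ball _ _ hr, finrank_euclideanSpace_fin, mul_comm, ballVolume,
    ENNReal.ofReal_mul ENNReal.toReal_nonneg, ENNReal.ofReal_toReal measure_ball_lt_top.ne]

/-- Bound for the relative error of the survival probability. -/
def survivalError (ε L : ℝ) : ℝ :=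
  (2 * ε + ε ^ 2) * L + (1 + ε) ^ 2 * (ballVolume * (ε * (1 + ε))) +
    ((1 + ε) * (ε * (1 + ε)) * (ballVolume * (ε * (1 + ε)) + L)) ^ 2

/-- Here A bounds the bath measure of the tube. Since Nr² = (1 + ε)², the first two error terms
bound NA - L and the last bounds NA². The error is stated with L' ≥ L, the integrated rate up to the
final time, so that it does not depend on t. -/
theorem exp_neg_mul_le_one_sub_pow {ε L L' r C A : ℝ} (hε : 0 < ε) (hL : 0 ≤ L) (hLL : L ≤ L')
    (hC : 0 ≤ C) {N : ℕ} (hN : (N : ℝ) * ε ^ 2 = 1) (hr : r = ε * (1 + ε))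
    (hA : A = r ^ 2 * (C * r + L)) (hθ : (2 * ε + ε ^ 2) * L' + (1 + ε) ^ 2 * (C * r) +
      ((1 + ε) * r * (C * r + L')) ^ 2 < 1) :
    A ≤ 1 ∧ Real.exp (-L) * (1 - ((2 * ε + ε ^ 2) * L' + (1 + ε) ^ 2 * (C * r) +
      ((1 + ε) * r * (C * r + L')) ^ 2)) ≤ (1 - A) ^ N := by
  have hr0 : 0 < r := by rw [hr]; positivity
  have hCr : 0 ≤ C * r := by positivity
  have hA0 : 0 ≤ A := by rw [hA]; positivity
  have hNr : (N : ℝ) * r ^ 2 = (1 + ε) ^ 2 := by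
    rw [hr]
    linear_combination (1 + ε) ^ 2 * hN
  have hx : (N : ℝ) * A = (1 + ε) ^ 2 * (C * r + L) := by
    rw [hA, ← mul_assoc, hNr]
  have hy : (N : ℝ) * A ^ 2 = ((1 + ε) * r * (C * r + L)) ^ 2 := by
    rw [hA]
    linear_combination r ^ 2 * (C * r + L) ^ 2 * hNr
  have hyle : (N : ℝ) * A ^ 2 ≤ ((1 + ε) * r * (C * r + L')) ^ 2 := by
    rw [hy]
    refine pow_le_pow_left₀ (by positivity) (mul_le_mul_of_nonneg_left ?_ (by positivity)) 2
    linarith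
  have hLε := mul_le_mul_of_nonneg_left hLL (show 0 ≤ 2 * ε + ε ^ 2 by positivity)
  have hx' : (N : ℝ) * A - L = (2 * ε + ε ^ 2) * L + (1 + ε) ^ 2 * (C * r) := by
    rw [hx]
    ring
  have hxnn : 0 ≤ (N : ℝ) * A - L := by
    rw [hx']
    positivity
  set x := (N : ℝ) * A - L with hxdef
  set y := (N : ℝ) * A ^ 2 with hydef
  have hxy : x + y ≤ (2 * ε + ε ^ 2) * L' + (1 + ε) ^ 2 * (C * r) +
      ((1 + ε) * r * (C * r + L')) ^ 2 := by linarith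
  set θ := (2 * ε + ε ^ 2) * L' + (1 + ε) ^ 2 * (C * r) + ((1 + ε) * r * (C * r + L')) ^ 2
  have hy0 : 0 ≤ y := by positivity
  have hN1 : (1 : ℝ) ≤ N := by
    have : N ≠ 0 := by
      rintro rfl
      simp at hN
    exact_mod_cast Nat.one_le_iff_ne_zero.2 this
  have hA1 : A ≤ 1 := by
    have h1 : A ^ 2 ≤ y := le_mul_of_one_le_left (sq_nonneg A) hN1
    exact (sq_le_one_iff₀ hA0).1 (by linarith)
  refine ⟨hA1, le_trans ?_ (exp_mul_le_one_sub_pow hA0 hA1 N)⟩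
  have h1 : Real.exp (-(N * A)) = Real.exp (-L) * Real.exp (-x) := by
    rw [← Real.exp_add]
    congr 1
    rw [hxdef]
    ring
  rw [h1, mul_assoc, ← hydef]
  refine mul_le_mul_of_nonneg_left ?_ (Real.exp_nonneg _)
  have h2 : 1 - x ≤ Real.exp (-x) := by
    have := Real.add_one_le_exp (-x)
    linarith
  have h4 := mul_le_mul_of_nonneg_right h2 (show 0 ≤ 1 - y by linarith)
  have h5 := mul_nonneg hxnn hy0
  linarith

theorem exp_neg_mul_le_survival {ε L L' : ℝ} (hε : 0 < ε) (hL : 0 ≤ L) (hLL : L ≤ L') {N : ℕ}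
    (hN : (N : ℝ) * ε ^ 2 = 1) :
    ENNReal.ofReal (Real.exp (-L) * (1 - survivalError ε L')) ≤
      (1 - (volume (Metric.ball (0 : E3) (ε * (1 + ε))) +
        ENNReal.ofReal ((ε * (1 + ε)) ^ 2 * L))) ^ N := by
  rcases le_or_gt (1 - survivalError ε L') 0 with hθ | hθ
  · rw [ENNReal.ofReal_of_nonpos (mul_nonpos_of_nonneg_of_nonpos (Real.exp_nonneg _) hθ)]
    exact zero_le
  have hC := ballVolume_nonneg
  obtain ⟨hA1, hle⟩ := exp_neg_mul_le_one_sub_pow hε hL hLL hC hN rfl rfl (sub_pos.1 hθ)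
  have hA0 : 0 ≤ (ε * (1 + ε)) ^ 2 * (ballVolume * (ε * (1 + ε)) + L) := by positivity
  rw [volume_ball_eq (by positivity), ← ENNReal.ofReal_add (by positivity) (by positivity),
    show ballVolume * (ε * (1 + ε)) ^ 3 + (ε * (1 + ε)) ^ 2 * L =
      (ε * (1 + ε)) ^ 2 * (ballVolume * (ε * (1 + ε)) + L) by ring,
    ← ENNReal.ofReal_one, ← ENNReal.ofReal_sub _ hA0, ← ENNReal.ofReal_pow (sub_nonneg.2 hA1)]
  exact ENNReal.ofReal_le_ofReal hle

/-- Each factor of the descending factorial is at least N - n, and (N - n)ε² = 1 - nε²; then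
Bernoulli. When N ≤ n and n > 0, the left side is zero because n²ε² ≥ nNε² = n. -/
theorem ofReal_one_sub_le_descFactorial {ε : ℝ} {N : ℕ} (hN : (N : ℝ) * ε ^ 2 = 1) (n : ℕ) :
    ENNReal.ofReal (1 - (n : ℝ) ^ 2 * ε ^ 2) ≤
      (N.descFactorial n : ℝ≥0∞) * ENNReal.ofReal (ε ^ 2) ^ n := by
  rcases le_or_gt N n with hle | hlt
  · rcases Nat.eq_zero_or_pos n with rfl | hn
    · simp
    · rw [ENNReal.ofReal_of_nonpos]
      · exact zero_le
      · have h1 : (N : ℝ) ≤ n := by exact_mod_cast hle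
        have h2 : (1 : ℝ) ≤ n := by exact_mod_cast hn
        nlinarith [mul_le_mul_of_nonneg_right h1 (sq_nonneg ε),
          mul_le_mul_of_nonneg_right h2 (mul_nonneg (Nat.cast_nonneg (α := ℝ) n) (sq_nonneg ε))]
  have hsub : ((N : ℝ) - n) ^ n ≤ N.descFactorial n := by
    have h1 := Nat.pow_sub_le_descFactorial N n
    have h2 : (N - n) ^ n ≤ N.descFactorial n := (Nat.pow_le_pow_left (by omega) n).trans h1
    have h3 : (((N - n : ℕ) : ℝ)) ^ n ≤ N.descFactorial n := by exact_mod_cast h2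
    rwa [Nat.cast_sub hlt.le] at h3
  have hnN : (n : ℝ) * ε ^ 2 ≤ 1 := by
    rw [← hN]
    exact mul_le_mul_of_nonneg_right (by exact_mod_cast hlt.le) (sq_nonneg ε)
  rw [← ENNReal.ofReal_pow (sq_nonneg ε), ← ENNReal.ofReal_natCast,
    ← ENNReal.ofReal_mul (Nat.cast_nonneg _)]
  refine ENNReal.ofReal_le_ofReal ?_
  have h1 := one_add_mul_le_pow (a := -((n : ℝ) * ε ^ 2)) (by linarith) n
  calc 1 - (n : ℝ) ^ 2 * ε ^ 2 = 1 + n * -((n : ℝ) * ε ^ 2) := by ring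
    _ ≤ (1 + -((n : ℝ) * ε ^ 2)) ^ n := h1
    _ = (((N : ℝ) - n) * ε ^ 2) ^ n := by
        congr 1
        linear_combination -hN
    _ = ((N : ℝ) - n) ^ n * (ε ^ 2) ^ n := mul_pow _ _ _
    _ ≤ _ := mul_le_mul_of_nonneg_right hsub (by positivity)

theorem pathRate_mono (hg : GasDensity g) (v₀ : E3) (n : ℕ) (m : Fin n → Marker) {s t : ℝ}
    (hst : s ≤ t) : pathRate g v₀ n m s ≤ pathRate g v₀ n m t := by
  rw [pathRate_eq_add v₀ n m s, pathRate_eq_add v₀ n m t]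
  have := mul_le_mul_of_nonneg_right (sub_le_sub_right hst (lastTime n m))
    (collisionRate_nonneg hg (finalVel v₀ n m))
  linarith

/-- Bound for the relative error of the density of a tree. -/
def densityError (ε : ℝ) (n : ℕ) (L : ℝ) : ℝ := (n : ℝ) ^ 2 * ε ^ 2 + survivalError ε L

/-- The combinatorial and the survival errors combine through (1 - a)(1 - b) ≥ 1 - a - b. -/
theorem idealWeight_mul_le_lowerDensity (f : E3 × E3 → ℝ) (hg : GasDensity g) {ε t T : ℝ}
    (hε : 0 < ε) (ht : 0 ≤ t) (htT : t ≤ T) {N : ℕ} (hN : (N : ℝ) * ε ^ 2 = 1) {n : ℕ}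
    {p : (E3 × E3) × (Fin n → Marker)} (h : Ordered n p.2 t) :
    idealWeight f g t n p *
        ENNReal.ofReal (1 - densityError ε n (pathRate g p.1.2 n p.2 T)) ≤
      lowerDensity f g N ε (ε * (1 + ε)) t n p.1 p.2 := by
  set L := pathRate g p.1.2 n p.2 t
  set L' := pathRate g p.1.2 n p.2 T
  have hL : 0 ≤ L := pathRate_nonneg hg _ h ht
  have hLL : L ≤ L' := pathRate_mono hg _ _ _ htT
  have hC := ballVolume_nonneg
  have hs : 0 ≤ survivalError ε L' := by
    have : 0 ≤ L' := hL.trans hLL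
    unfold survivalError
    positivity
  have h1 : ENNReal.ofReal (1 - densityError ε n L') ≤
      ENNReal.ofReal (1 - (n : ℝ) ^ 2 * ε ^ 2) * ENNReal.ofReal (1 - survivalError ε L') := by
    rcases le_or_gt (1 - densityError ε n L') 0 with h0 | h0
    · rw [ENNReal.ofReal_of_nonpos h0]
      exact zero_le
    have h2 : 0 ≤ (n : ℝ) ^ 2 * ε ^ 2 := by positivity
    rw [densityError] at h0 ⊢
    rw [← ENNReal.ofReal_mul (by linarith)]
    refine ENNReal.ofReal_le_ofReal ?_
    nlinarith [mul_nonneg h2 hs]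
  have h2 := exp_neg_mul_le_survival hε hL hLL hN
  rw [ENNReal.ofReal_mul (Real.exp_nonneg _)] at h2
  calc idealWeight f g t n p * ENNReal.ofReal (1 - densityError ε n L')
      ≤ rootDensity f p.1 * (collisionWeight g p.1.2 n p.2 * ENNReal.ofReal (Real.exp (-L))) *
        (ENNReal.ofReal (1 - (n : ℝ) ^ 2 * ε ^ 2) * ENNReal.ofReal (1 - survivalError ε L')) :=
        mul_le_mul_right h1 _
    _ = rootDensity f p.1 * collisionWeight g p.1.2 n p.2 *
        ENNReal.ofReal (1 - (n : ℝ) ^ 2 * ε ^ 2) * (ENNReal.ofReal (Real.exp (-L)) *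
          ENNReal.ofReal (1 - survivalError ε L')) := by ring
    _ ≤ _ := mul_le_mul' (mul_le_mul_right (ofReal_one_sub_le_descFactorial hN n) _) h2

/-- Dropping the survival factor after the last collision gives a majorant that does not depend on
t. -/
theorem idealWeight_le_birthWeight (f : E3 × E3 → ℝ) (hg : GasDensity g) {t : ℝ} (ht : 0 ≤ t)
    {n : ℕ} {p : (E3 × E3) × (Fin n → Marker)} (h : Ordered n p.2 t) :
    idealWeight f g t n p ≤ birthWeight f g n p := by
  refine mul_le_mul_right (mul_le_mul_right (ENNReal.ofReal_le_ofReal (Real.exp_le_exp.2 ?_)) _) _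
  exact neg_le_neg (pathRate_mono hg _ _ _ (h.lastTime_le ht))

open Classical in
/-- Bound for the part of the density of a tree that the empirical distribution misses. -/
def missingFactor (g : E3 → ℝ) (ε T : ℝ) (n : ℕ) (p : (E3 × E3) × (Fin n → Marker)) : ℝ≥0∞ :=
  if GoodTree ε T p.1 n p.2 then
    min 1 (ENNReal.ofReal (densityError ε n (pathRate g p.1.2 n p.2 T))) else 1

theorem missingFactor_le_one (g : E3 → ℝ) (ε T : ℝ) (n : ℕ)
    (p : (E3 × E3) × (Fin n → Marker)) : missingFactor g ε T n p ≤ 1 := by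
  unfold missingFactor
  split_ifs
  · exact min_le_left _ _
  · exact le_rfl

theorem measurable_missingFactor (hg : GasDensity g) (ε T : ℝ) (n : ℕ) :
    Measurable (missingFactor g ε T n) := by
  have h1 := measurable_pathRate hg (n := n)
    (a := fun p : (E3 × E3) × (Fin n → Marker) => p.1.2) (by fun_prop) (b := fun p => p.2)
      (by fun_prop) (c := fun _ => T) (by fun_prop)
  refine Measurable.ite (measurableSet_goodTree ε T (by fun_prop) (by fun_prop)) ?_
    measurable_const
  unfold densityError survivalError
  fun_prop

/-- Bound for the total variation distance of the idealized and the empirical distribution. -/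
def missingMass (f : E3 × E3 → ℝ) (g : E3 → ℝ) (T ε : ℝ) : ℝ≥0∞ :=
  ∑' n, ∫⁻ p in {p : (E3 × E3) × (Fin n → Marker) | Ordered n p.2 T},
    birthWeight f g n p * missingFactor g ε T n p ∂(volume.prod (markersMeasure n))

/-- A pointwise comparison of densities: a good tree loses at most its relative error, a tree that
is not good is given up entirely. -/
theorem idealLaw_le_add {f : E3 × E3 → ℝ} (hf : Measurable f) (hf0 : ∀ z, 0 ≤ f z)
    (hg : GasDensity g) {ε t T : ℝ} (hε : 0 < ε) (hε2 : ε < 1 / 2) (ht : 0 ≤ t) (htT : t ≤ T)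
    {N : ℕ} (hN : (N : ℝ) * ε ^ 2 = 1) {S : Set Tree} (hS : MeasurableSet S) :
    idealLaw f g T t S ≤ empiricalLaw f g N ε t S + missingMass f g T ε := by
  -- The tube radius ε(1 + ε) exceeds ε strictly, yet differs from it only to second order, so Nr²
  -- still tends to one.
  refine le_trans ?_ (add_le_add_left (empiricalLaw_ge hf hg hε hε2
    (show ε < ε * (1 + ε) by nlinarith) ht htT N hS) _)
  rw [idealLaw_apply hf0 hg htT hS, missingMass, ← ENNReal.tsum_add]
  refine ENNReal.tsum_le_tsum fun n => ?_
  have hSn := measurableSet_tree hS n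
  have hordt : MeasurableSet {p : (E3 × E3) × (Fin n → Marker) | Ordered n p.2 t} :=
    measurableSet_ordered (by fun_prop) measurable_const
  have hordT : MeasurableSet {p : (E3 × E3) × (Fin n → Marker) | Ordered n p.2 T} :=
    measurableSet_ordered (by fun_prop) measurable_const
  have hgood : MeasurableSet {p : (E3 × E3) × (Fin n → Marker) | GoodTree ε T p.1 n p.2} :=
    measurableSet_goodTree ε T (by fun_prop) (by fun_prop)
  rw [← lintegral_indicator (measurableSet_and hordt hSn),
    ← lintegral_indicator (measurableSet_and hordt (measurableSet_and hgood hSn)),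
    ← lintegral_indicator hordT, ← lintegral_add_left
      ((measurable_lowerDensity hf hg N ε _ t n).indicator
        (measurableSet_and hordt (measurableSet_and hgood hSn)))]
  refine lintegral_mono (indicator_le
    (s := {p : (E3 × E3) × (Fin n → Marker) | Ordered n p.2 t ∧ treeMk n p ∈ S}) fun p hp => ?_)
  have h1 := idealWeight_le_birthWeight f hg ht hp.1
  rw [indicator_of_mem (s := {p : (E3 × E3) × (Fin n → Marker) | Ordered n p.2 T})
    (hp.1.mono htT)]
  by_cases hg' : GoodTree ε T p.1 n p.2
  · rw [indicator_of_mem (s := {p : (E3 × E3) × (Fin n → Marker) | Ordered n p.2 t ∧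
      GoodTree ε T p.1 n p.2 ∧ treeMk n p ∈ S}) ⟨hp.1, hg', hp.2⟩, missingFactor, if_pos hg']
    set ρ := densityError ε n (pathRate g p.1.2 n p.2 T)
    have h2 : (1 : ℝ≥0∞) ≤ ENNReal.ofReal (1 - ρ) + min 1 (ENNReal.ofReal ρ) := by
      rcases le_total 1 (ENNReal.ofReal ρ) with h | h
      · rw [min_eq_left h]
        exact le_add_self
      · rw [min_eq_right h]
        refine le_trans ?_ ENNReal.ofReal_add_le
        simp
    calc idealWeight f g t n p = idealWeight f g t n p * 1 := (mul_one _).symm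
      _ ≤ idealWeight f g t n p * (ENNReal.ofReal (1 - ρ) + min 1 (ENNReal.ofReal ρ)) :=
        mul_le_mul_right h2 _
      _ = idealWeight f g t n p * ENNReal.ofReal (1 - ρ) +
          idealWeight f g t n p * min 1 (ENNReal.ofReal ρ) := mul_add _ _ _
      _ ≤ _ := add_le_add (idealWeight_mul_le_lowerDensity f hg hε ht htT hN hp.1)
        (mul_le_mul_left h1 _)
  · rw [missingFactor, if_neg hg', mul_one]
    exact h1.trans le_add_self

/-! ### Convergence -/

theorem tendsto_densityError (n : ℕ) (L : ℝ) :
    Filter.Tendsto (fun ε => densityError ε n L) (nhdsWithin 0 (Ioi 0)) (nhds 0) := by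
  have h : Continuous fun ε => densityError ε n L := by
    unfold densityError survivalError
    fun_prop
  have h0 : densityError 0 n L = 0 := by simp [densityError, survivalError]
  have := h.tendsto 0
  rw [h0] at this
  exact this.mono_left nhdsWithin_le_nhds

theorem ae_goodTree_prod (T : ℝ) (n : ℕ) :
    ∀ᵐ p : (E3 × E3) × (Fin n → Marker) ∂(volume.prod (markersMeasure n)),
      Ordered n p.2 T → GoodTree 0 T p.1 n p.2 := by
  refine (Measure.ae_prod_iff_ae_ae ?_).2 (ae_of_all _ fun z => ae_goodTree T z n)
  have : {p : (E3 × E3) × (Fin n → Marker) | Ordered n p.2 T → GoodTree 0 T p.1 n p.2} =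
      {p | ¬ Ordered n p.2 T ∨ GoodTree 0 T p.1 n p.2} := by
    ext p
    exact imp_iff_not_or
  rw [this]
  exact measurableSet_or (measurableSet_not (measurableSet_ordered (by fun_prop) measurable_const))
    (measurableSet_goodTree 0 T (by fun_prop) (by fun_prop))

theorem rootDensity_ne_top (f : E3 × E3 → ℝ) (z : E3 × E3) : rootDensity f z ≠ ∞ := by
  unfold rootDensity indicator
  split_ifs <;> simp

theorem tendsto_birthWeight_mul_missingFactor (f : E3 × E3 → ℝ) {T : ℝ} {n : ℕ}
    {p : (E3 × E3) × (Fin n → Marker)} (hord : Ordered n p.2 T) (hgood : GoodTree 0 T p.1 n p.2) :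
    Filter.Tendsto (fun ε => birthWeight f g n p * missingFactor g ε T n p)
      (nhdsWithin 0 (Ioi 0)) (nhds 0) := by
  -- Trees of zero weight, such as those with a grazing collision, need no geometric argument.
  by_cases hw : collisionWeight g p.1.2 n p.2 = 0
  · simp [birthWeight, hw]
  have h1 := eventually_goodTree hord hw hgood
  have h2 : Filter.Tendsto (fun ε => min 1
      (ENNReal.ofReal (densityError ε n (pathRate g p.1.2 n p.2 T))))
      (nhdsWithin 0 (Ioi 0)) (nhds 0) := by
    have h3 := (ENNReal.continuous_ofReal.tendsto 0).comp
      (tendsto_densityError n (pathRate g p.1.2 n p.2 T))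
    have h4 := (tendsto_const_nhds (x := (1 : ℝ≥0∞))).min h3
    simpa using h4
  have h5 : Filter.Tendsto (fun ε => missingFactor g ε T n p)
      (nhdsWithin 0 (Ioi 0)) (nhds 0) := by
    refine h2.congr' ?_
    filter_upwards [h1] with ε hε
    rw [missingFactor, if_pos hε]
  have hne : birthWeight f g n p ≠ ∞ :=
    ENNReal.mul_ne_top (rootDensity_ne_top f _)
      (ENNReal.mul_ne_top (collisionWeight_ne_top g _ n _) ENNReal.ofReal_ne_top)
  have := ENNReal.Tendsto.const_mul h5 (Or.inr hne)
  rwa [mul_zero] at this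

/-- Dominated convergence is used twice with the majorant `birthWeight`: over the trees with n
collisions, and then over n. -/
theorem tendsto_missingMass {f : E3 × E3 → ℝ} (hf : Measurable f)
    (hg : GasDensity g) (T : ℝ) (hmass : ∫⁻ z, rootDensity f z ≠ ∞)
    (hmom : ∫⁻ z, rootDensity f z * speedWeight z.2 ≠ ∞) :
    Filter.Tendsto (missingMass f g T) (nhdsWithin 0 (Ioi 0)) (nhds 0) := by
  have hsum := tsum_lintegral_birthWeight_lt_top hf hg T hmass hmom
  have hbd : ∀ n (p : (E3 × E3) × (Fin n → Marker)) ε,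
      birthWeight f g n p * missingFactor g ε T n p ≤ birthWeight f g n p := fun n p ε =>
    mul_le_of_le_one_right' (missingFactor_le_one g ε T n p)
  have hn : ∀ n, Filter.Tendsto (fun ε => ∫⁻ p in {p : (E3 × E3) × (Fin n → Marker) |
      Ordered n p.2 T}, birthWeight f g n p * missingFactor g ε T n p
        ∂(volume.prod (markersMeasure n))) (nhdsWithin 0 (Ioi 0)) (nhds 0) := fun n => by
    have hord : MeasurableSet {p : (E3 × E3) × (Fin n → Marker) | Ordered n p.2 T} :=
      measurableSet_ordered (by fun_prop) measurable_const
    rw [← lintegral_zero (μ := (volume.prod (markersMeasure n)).restrict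
      {p : (E3 × E3) × (Fin n → Marker) | Ordered n p.2 T})]
    refine tendsto_lintegral_filter_of_dominated_convergence (birthWeight f g n)
      (Filter.Eventually.of_forall fun ε =>
        (measurable_birthWeight hf hg n).mul (measurable_missingFactor hg ε T n))
      (Filter.Eventually.of_forall fun ε => ae_of_all _ fun p => hbd n p ε)
      (ne_top_of_le_ne_top hsum.ne (ENNReal.le_tsum n)) ?_
    rw [ae_restrict_iff' hord]
    filter_upwards [ae_goodTree_prod T n] with p hp hpo
    exact tendsto_birthWeight_mul_missingFactor f hpo (hp hpo)
  -- The series over n is treated as an integral against counting measure.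
  have h := tendsto_lintegral_filter_of_dominated_convergence (μ := Measure.count)
    (l := nhdsWithin (0 : ℝ) (Ioi 0)) (F := fun ε n => ∫⁻ p in {p : (E3 × E3) × (Fin n → Marker) |
      Ordered n p.2 T}, birthWeight f g n p * missingFactor g ε T n p
        ∂(volume.prod (markersMeasure n))) (f := fun _ : ℕ => 0)
    (fun n => ∫⁻ p in {p : (E3 × E3) × (Fin n → Marker) | Ordered n p.2 T},
      birthWeight f g n p ∂(volume.prod (markersMeasure n)))
    (Filter.Eventually.of_forall fun ε => measurable_from_top)
    (Filter.Eventually.of_forall fun ε => ae_of_all _ fun n =>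
      lintegral_mono fun p => hbd n p ε)
    (by rw [lintegral_count]; exact hsum.ne) (ae_of_all _ hn)
  simp only [lintegral_count, tsum_zero] at h
  exact h

theorem empiricalLaw_univ_le {f : E3 × E3 → ℝ} (hf : Measurable f) (hg : GasDensity g) (N : ℕ)
    {ε : ℝ} (hε : 0 < ε) (t : ℝ) : empiricalLaw f g N ε t univ ≤ ∫⁻ z, rootDensity f z := by
  have := isProbabilityMeasure_bathLaw hg
  rw [empiricalLaw_apply f g N hε t MeasurableSet.univ]
  refine (measure_mono (subset_univ _)).trans ?_
  rw [configLaw_apply hf hg MeasurableSet.univ]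
  simp

/-- The one-sided bound on the complement of S, together with the empirical mass ≤ 1 = idealized
mass, bounds the empirical law on S from above. -/
theorem tvDist_le_missingMass {f : E3 × E3 → ℝ} (hf : Measurable f) (hf0 : ∀ z, 0 ≤ f z)
    (hg : GasDensity g) (hmass : ∫⁻ z, rootDensity f z = 1) {ε t T : ℝ} (hε : 0 < ε)
    (hε2 : ε < 1 / 2) (ht : 0 ≤ t) (htT : t ≤ T) {N : ℕ} (hN : (N : ℝ) * ε ^ 2 = 1) :
    tvDist (idealLaw f g T t) (empiricalLaw f g N ε t) ≤ missingMass f g T ε := by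
  have hle := fun {S : Set Tree} (hS : MeasurableSet S) =>
    idealLaw_le_add hf hf0 hg hε hε2 ht htT hN hS
  refine iSup₂_le fun S hS => max_le (tsub_le_iff_left.2 (hle hS)) (tsub_le_iff_left.2 ?_)
  have h1 := idealLaw_univ hf hf0 hg ht htT
  have h2 := empiricalLaw_univ_le hf hg N hε t
  rw [hmass, ← measure_add_measure_compl hS] at h1 h2
  have hfin : empiricalLaw f g N ε t Sᶜ ≠ ∞ :=
    ne_top_of_le_ne_top ENNReal.one_ne_top (le_add_self.trans h2)
  refine (ENNReal.add_le_add_iff_right hfin).1 (h2.trans (h1.ge.trans ?_))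
  rw [add_assoc, add_comm (missingMass f g T ε)]
  exact add_le_add_right (hle hS.compl) _

theorem exists_tvDist_lt {f : E3 × E3 → ℝ} (hf : Measurable f) (hf0 : ∀ z, 0 ≤ f z)
    (hg : GasDensity g) (hmass : ∫⁻ z, rootDensity f z = 1)
    (hmom : ∫⁻ z, rootDensity f z * speedWeight z.2 ≠ ∞) (T : ℝ) {δ : ℝ} (hδ : 0 < δ) :
    ∃ ε₀ : ℝ, 0 < ε₀ ∧ ∀ (ε : ℝ) (N : ℕ), 0 < ε → ε < ε₀ → (N : ℝ) * ε ^ 2 = 1 →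
      ∀ t ∈ Icc (0 : ℝ) T,
        tvDist (idealLaw f g T t) (empiricalLaw f g N ε t) < ENNReal.ofReal δ := by
  have h := tendsto_missingMass hf hg T (by rw [hmass]; exact ENNReal.one_ne_top) hmom
  have h1 := h.eventually (gt_mem_nhds (ENNReal.ofReal_pos.2 hδ))
  obtain ⟨ε₁, hε₁, hsub⟩ := mem_nhdsGT_iff_exists_Ioo_subset.1 h1
  refine ⟨min ε₁ (1 / 2), lt_min hε₁ (by norm_num), fun ε N hε hlt hN t ht => ?_⟩
  exact (tvDist_le_missingMass hf hf0 hg hmass hε (hlt.trans_le (min_le_right _ _)) ht.1 ht.2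
    hN).trans_lt (hsub ⟨hε, hlt.trans_le (min_le_left _ _)⟩)

/-! ### Versions of the initial densities -/

theorem collisionRate_congr {g g' : E3 → ℝ} (h : g =ᵐ[volume] g') :
    collisionRate g = collisionRate g' := by
  funext v
  refine integral_congr_ae (ae_of_all _ fun ν => integral_congr_ae ?_)
  filter_upwards [h] with w hw
  rw [hw]

theorem idealDensity_congr {f f' : E3 × E3 → ℝ} {g g' : E3 → ℝ}
    (hrate : collisionRate g = collisionRate g') {z : E3 × E3} (hf : f z = f' z) {n : ℕ}
    {m : Fin n → Marker} (hm : ∀ i, g (m i).2.2 = g' (m i).2.2) (t : ℝ) :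
    idealDensity f g z n m t = idealDensity f' g' z n m t := by
  induction n generalizing t with
  | zero => rw [idealDensity, idealDensity, hrate, hf]
  | succ n ih =>
    rw [idealDensity, idealDensity, hrate, ih (m := Fin.init m) (fun i => hm i.castSucc), hm (Fin.last n)]

theorem ae_markers {g g' : E3 → ℝ} (h : g =ᵐ[volume] g') (n : ℕ) :
    ∀ᵐ m ∂markersMeasure n, ∀ i, g (m i).2.2 = g' (m i).2.2 := by
  refine ae_all_iff.2 fun i => ?_
  have h1 : Measure.QuasiMeasurePreserving (fun m : Fin n → Marker => m i) (markersMeasure n)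
      markerMeasure := Measure.quasiMeasurePreserving_eval (fun _ => markerMeasure) i
  have h2 : Measure.QuasiMeasurePreserving (fun x : Marker => x.2) markerMeasure
      (sphereMeasure.prod (volume : Measure E3)) := Measure.quasiMeasurePreserving_snd
  have h3 : Measure.QuasiMeasurePreserving (fun x : S2 × E3 => x.2)
      (sphereMeasure.prod (volume : Measure E3)) volume := Measure.quasiMeasurePreserving_snd
  exact ((h3.comp h2).comp h1).ae h

theorem idealLaw_congr {f f' : E3 × E3 → ℝ} {g g' : E3 → ℝ} (hf : f =ᵐ[phaseVolume] f')
    (hg : g =ᵐ[volume] g') (T t : ℝ) : idealLaw f g T t = idealLaw f' g' T t := by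
  refine withDensity_congr_ae ?_
  rw [Filter.EventuallyEq, treeVolume, ae_restrict_iff' (measurableSet_collisionTrees T),
    Measure.ae_sum_iff]
  intro n
  refine (measurableEmbedding_treeMk n).ae_map_iff.2 ?_
  rw [phaseVolume_eq, Filter.EventuallyEq,
    ae_restrict_iff' (measurableSet_unitCube.prod MeasurableSet.univ)] at hf
  have h1 := (Measure.quasiMeasurePreserving_fst (μ := (volume : Measure (E3 × E3)))
    (ν := markersMeasure n)).ae hf
  have h2 := (Measure.quasiMeasurePreserving_snd (μ := (volume : Measure (E3 × E3)))
    (ν := markersMeasure n)).ae (ae_markers hg n)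
  filter_upwards [h1, h2] with p hp1 hp2 hp
  congr 1
  exact idealDensity_congr (collisionRate_congr hg)
    (hp1 ⟨(treeMk_mem_collisionTrees.1 hp).1, trivial⟩) hp2 t

theorem empiricalLaw_congr {f f' : E3 × E3 → ℝ} {g g' : E3 → ℝ} (hf : f =ᵐ[phaseVolume] f')
    (hg : g =ᵐ[volume] g') (N : ℕ) (ε t : ℝ) :
    empiricalLaw f g N ε t = empiricalLaw f' g' N ε t := by
  have h1 : (phaseVolume.withDensity fun z => ENNReal.ofReal (f z)) =
      phaseVolume.withDensity fun z => ENNReal.ofReal (f' z) :=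
    withDensity_congr_ae (hf.mono fun z hz => congrArg ENNReal.ofReal hz)
  have h2 : ((volume : Measure E3).withDensity fun v => ENNReal.ofReal (g v)) =
      volume.withDensity fun v => ENNReal.ofReal (g' v) :=
    withDensity_congr_ae (hg.mono fun z hz => congrArg ENNReal.ofReal hz)
  rw [empiricalLaw, empiricalLaw, configLaw, configLaw, h1, h2]

/-- Both laws depend only on the almost everywhere classes of the densities, so measurable and
everywhere nonnegative representatives may be used. -/
theorem exists_measurable_version {α : Type*} [MeasurableSpace α] {μ : Measure α} {f : α → ℝ}
    (hf : Integrable f μ) (h0 : ∀ᵐ x ∂μ, 0 ≤ f x) :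
    ∃ f' : α → ℝ, Measurable f' ∧ (∀ x, 0 ≤ f' x) ∧ f =ᵐ[μ] f' := by
  have hm := hf.aestronglyMeasurable.aemeasurable
  refine ⟨fun x => max (hm.mk f x) 0, hm.measurable_mk.max measurable_const,
    fun x => le_max_right _ _, ?_⟩
  filter_upwards [hm.ae_eq_mk, h0] with x hx hx0
  rw [← hx, max_eq_left hx0]

theorem lintegral_rootDensity_mul {f : E3 × E3 → ℝ} (hf : Measurable f) {h : E3 × E3 → ℝ≥0∞}
    (hh : Measurable h) :
    ∫⁻ z, rootDensity f z * h z = ∫⁻ z, ENNReal.ofReal (f z) * h z ∂phaseVolume := by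
  have h1 := lintegral_withDensity_eq_lintegral_mul volume (measurable_rootDensity hf) hh
  have h2 := lintegral_withDensity_eq_lintegral_mul phaseVolume hf.ennreal_ofReal hh
  rw [withDensity_rootDensity, h2] at h1
  exact h1.symm

theorem lintegral_ofReal_eq_one {α : Type*} [MeasurableSpace α] {μ : Measure α} {f : α → ℝ}
    (hf : Integrable f μ) (h0 : ∀ᵐ x ∂μ, 0 ≤ f x) (h1 : ∫ x, f x ∂μ = 1) :
    ∫⁻ x, ENNReal.ofReal (f x) ∂μ = 1 := by
  rw [← ofReal_integral_eq_lintegral_ofReal hf h0, h1, ENNReal.ofReal_one]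

theorem Admissible.exists_tvDist_lt {f₀ : E3 × E3 → ℝ} {g₀ : E3 → ℝ} (hadm : Admissible f₀ g₀)
    (T : ℝ) {δ : ℝ} (hδ : 0 < δ) :
    ∃ ε₀ : ℝ, 0 < ε₀ ∧ ∀ (ε : ℝ) (N : ℕ), 0 < ε → ε < ε₀ → (N : ℝ) * ε ^ 2 = 1 →
      ∀ t ∈ Icc (0 : ℝ) T,
        tvDist (idealLaw f₀ g₀ T t) (empiricalLaw f₀ g₀ N ε t) < ENNReal.ofReal δ := by
  obtain ⟨f, hfm, hf0, hff⟩ := exists_measurable_version hadm.f_integrable hadm.f_nonneg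
  obtain ⟨g, hgm, hg0, hgg⟩ := exists_measurable_version hadm.g_integrable hadm.g_nonneg
  have hg : GasDensity g := by
    refine ⟨hgm, hg0, ?_, ?_⟩
    · rw [← lintegral_ofReal_eq_one hadm.g_integrable hadm.g_nonneg hadm.g_mass]
      exact lintegral_congr_ae (hgg.mono fun v hv => by simp only [hv])
    · refine lt_of_eq_of_lt ?_ hadm.g_moment.lintegral_lt_top
      exact lintegral_congr_ae (hgg.mono fun v hv => by simp only [hv])
  have hmass : ∫⁻ z, rootDensity f z = 1 := by
    have h1 := lintegral_rootDensity_mul hfm (h := fun _ => 1) measurable_const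
    simp only [mul_one] at h1
    rw [h1, ← lintegral_ofReal_eq_one hadm.f_integrable hadm.f_nonneg hadm.f_mass]
    exact lintegral_congr_ae (hff.mono fun v hv => by simp only [hv])
  have hmom : ∫⁻ z, rootDensity f z * speedWeight z.2 ≠ ∞ := by
    rw [lintegral_rootDensity_mul hfm (by fun_prop)]
    -- The first moment is controlled by the second through 1 + x ≤ 2(1 + x²).
    refine ne_top_of_le_ne_top (b := ∫⁻ z, ENNReal.ofReal 2 * ENNReal.ofReal (f₀ z * (1 + ‖z.2‖ ^ 2))
      ∂phaseVolume)
      ?_ (lintegral_mono_ae (hff.mono fun z hz => ?_))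
    · rw [lintegral_const_mul' _ _ ENNReal.ofReal_ne_top]
      exact ENNReal.mul_ne_top ENNReal.ofReal_ne_top hadm.f_moment.lintegral_lt_top.ne
    · rw [hz, speedWeight, ← ENNReal.ofReal_mul (hf0 z),
        ← ENNReal.ofReal_mul (by norm_num)]
      refine ENNReal.ofReal_le_ofReal ?_
      have h1 : 1 + ‖z.2‖ ≤ 2 * (1 + ‖z.2‖ ^ 2) := by nlinarith [sq_nonneg (‖z.2‖ - 1)]
      have := mul_le_mul_of_nonneg_left h1 (hf0 z)
      linarith
  obtain ⟨ε₀, hε₀, h⟩ := RayleighGas.exists_tvDist_lt hfm hf0 hg hmass hmom T hδ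
  refine ⟨ε₀, hε₀, fun ε N hε hlt hN t ht => ?_⟩
  rw [idealLaw_congr hff hgg, empiricalLaw_congr hff hgg]
  exact h ε N hε hlt hN t ht

end RayleighGas

end

theorem theorem5p7 (f₀ : RayleighGas.E3 × RayleighGas.E3 → ℝ) (g₀ : RayleighGas.E3 → ℝ)
    (hadm : RayleighGas.Admissible f₀ g₀) (T : ℝ) (hT : 0 < T) :
    ∀ δ : ℝ, 0 < δ → ∃ ε₀ : ℝ, 0 < ε₀ ∧
      ∀ (ε : ℝ) (N : ℕ), 0 < ε → ε < ε₀ → (N : ℝ) * ε ^ 2 = 1 →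
        ∀ t ∈ Set.Icc (0 : ℝ) T,
          RayleighGas.tvDist (RayleighGas.idealLaw f₀ g₀ T t)
            (RayleighGas.empiricalLaw f₀ g₀ N ε t) < ENNReal.ofReal δ := by
  exact fun δ hδ => hadm.exists_tvDist_lt T hδ
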